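/- Let $k$ be an algebraically closed field. Let $Q=(Q_0,Q_1,s,e)$ be a finite connected quiver and let $\mathcal P$ be a set of paths of length two in $Q$ such that $A=kQ/\langle\mathcal P\rangle$ is gentle; that is: (i) at most two arrows start, and at most two arrows end, at each vertex; (ii) for each $\beta\in Q_1$ there is at most one arrow $\alpha$ with $e(\alpha)=s(\beta)$ and $\beta\alpha\notin\mathcal P$, at most one arrow $\alpha$ with $e(\alpha)=s(\beta)$ and $\beta\alpha\in\mathcal P$, at most one arrow $\gamma$ with $s(\gamma)=e(\beta)$ and $\gamma\beta\notin\mathcal P$, and at most one arrow $\gamma$ with $s(\gamma)=e(\beta)$ and $\gamma\beta\in\mathcal P$; (iii) for each $\beta\in Q_1$, all sufficiently long paths that begin with $\beta$, and all sufficiently long paths that end with $\beta$, contain a subpath in $\mathcal P$. Assume that $Q$ is not the Kronecker quiver (two vertices $a\neq b$ and exactly two arrows, both from $a$ to $b$). Put $c(Q)=\#Q_1-\#Q_0+1$. Let $\operatorname{Aut}(A)$ be the group of $k$-algebra automorphisms of $A$, a Zariski closed subgroup of $\operatorname{GL}(A)$, let $\operatorname{Inn}(A)$ be the normal subgroup of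 the automorphisms $a\mapsto x^{-1}ax$ with $x\in A^*$, and let $\operatorname{Out}^o(A)$ be the connected component of the identity in the affine algebraic group $\operatorname{Out}(A)=\operatorname{Aut}(A)/\operatorname{Inn}(A)$. Then $\operatorname{Out}^o(A)$ is isomorphic, as an affine algebraic group, to a closed subgroup of the group of lower triangular invertible $n\times n$ matrices over $k$ for some $n$, and it is a semidirect product $\operatorname{Out}^o(A)=S\ltimes\mathcal U$, where $S$ is a maximal torus of $\operatorname{Out}^o(A)$ with $S\cong(k^*)^{c(Q)}$ as algebraic groups and $\mathcal U$ is a closed normal nilpotent subgroup. -/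

import Mathlib

universe u v w

open Quiver Topology
open scoped MatrixGroups

noncomputable section

/-! ## Paths and the path algebra of a quiver -/

/-- All paths of the quiver `V`: `p.1` is the start and `p.2.1` the end of `p`. -/
abbrev QPath (V : Type u) [Quiver.{v} V] : Type (max u v) :=
  Σ a b : V, Quiver.Path a b

/-- The `k`-module underlying the path algebra: the paths form a basis. -/
def PathAlgebra (k : Type w) [Field k] (V : Type u) [Quiver.{v} V] : Type (max u v w) :=
  QPath V →₀ k

namespace PathAlgebra

variable (k : Type w) [Field k] {V : Type u} [Quiver.{v} V]

instance : AddCommGroup (PathAlgebra k V) := inferInstanceAs (AddCommGroup (QPath V →₀ k))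

instance : Module k (PathAlgebra k V) := inferInstanceAs (Module k (QPath V →₀ k))

/-- The basis element given by a path. -/
def of (p : QPath V) : PathAlgebra k V := Finsupp.single p (1 : k)

open Classical in
/-- The product `q p` of two paths: first `p`, then `q`, and zero if `p` does not end where `q`
starts. -/
def pathMul (q p : QPath V) : PathAlgebra k V :=
  if h : p.2.1 = q.1 then of k ⟨p.1, q.2.1, p.2.2.comp (q.2.2.cast h.symm rfl)⟩ else 0

/-- The bilinear extension of the product of paths. -/
def mulMap : PathAlgebra k V →ₗ[k] PathAlgebra k V →ₗ[k] PathAlgebra k V :=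
  Finsupp.linearCombination k fun q => Finsupp.linearCombination k fun p => pathMul k q p

instance : Mul (PathAlgebra k V) := ⟨fun x y => mulMap k x y⟩

instance [Fintype V] : One (PathAlgebra k V) := ⟨∑ a : V, of k ⟨a, a, Path.nil⟩⟩

variable {k}

theorem mul_eq (x y : PathAlgebra k V) : x * y = mulMap k x y := rfl

theorem one_eq [Fintype V] : (1 : PathAlgebra k V) = ∑ a : V, of k ⟨a, a, Path.nil⟩ := rfl

theorem mulMap_of_of (q p : QPath V) : mulMap k (of k q) (of k p) = pathMul k q p := by
  unfold mulMap of
  erw [Finsupp.linearCombination_single, one_smul, Finsupp.linearCombination_single, one_smul]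

theorem hom_ext {M : Type*} [AddCommMonoid M] [Module k M] {f g : PathAlgebra k V →ₗ[k] M}
    (h : ∀ p, f (of k p) = g (of k p)) : f = g :=
  Finsupp.lhom_ext' fun p => LinearMap.ext_ring (h p)

theorem pathMul_comp {a b c : V} (q : Path b c) (p : Path a b) :
    pathMul k ⟨b, c, q⟩ ⟨a, b, p⟩ = of k ⟨a, c, p.comp q⟩ := by
  simp [pathMul]

theorem pathMul_ne {q p : QPath V} (h : p.2.1 ≠ q.1) : pathMul k q p = 0 := by
  simp [pathMul, h]

theorem mul_assoc_of (r q p : QPath V) :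
    mulMap k (pathMul k r q) (of k p) = mulMap k (of k r) (pathMul k q p) := by
  obtain ⟨a, b, p⟩ := p
  obtain ⟨b', c, q⟩ := q
  obtain ⟨c', d, r⟩ := r
  by_cases h : b = b'
  · subst h
    by_cases h' : c = c'
    · subst h'
      simp only [pathMul_comp, mulMap_of_of, Path.comp_assoc]
    · rw [pathMul_ne (q := ⟨c', d, r⟩) (p := ⟨b, c, q⟩) h', pathMul_comp, mulMap_of_of,
        pathMul_ne (q := ⟨c', d, r⟩) (p := ⟨a, c, p.comp q⟩) h', map_zero, LinearMap.zero_apply]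
  · rw [pathMul_ne (q := ⟨b', c, q⟩) (p := ⟨a, b, p⟩) h, map_zero]
    by_cases h' : c = c'
    · subst h'
      rw [pathMul_comp, mulMap_of_of,
        pathMul_ne (q := ⟨b', d, q.comp r⟩) (p := ⟨a, b, p⟩) h]
    · rw [pathMul_ne (q := ⟨c', d, r⟩) (p := ⟨b', c, q⟩) h', map_zero, LinearMap.zero_apply]

theorem mulMap_assoc (x y z : PathAlgebra k V) :
    mulMap k (mulMap k x y) z = mulMap k x (mulMap k y z) := by
  have h : (LinearMap.llcomp k (PathAlgebra k V) (PathAlgebra k V)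
        (PathAlgebra k V →ₗ[k] PathAlgebra k V) (mulMap k)).comp (mulMap k) =
      ((LinearMap.llcomp k (PathAlgebra k V) (PathAlgebra k V →ₗ[k] PathAlgebra k V)
        (PathAlgebra k V →ₗ[k] PathAlgebra k V)).flip (mulMap k)).comp
        ((LinearMap.llcomp k (PathAlgebra k V) (PathAlgebra k V) (PathAlgebra k V)).comp
          (mulMap k)) := by
    refine hom_ext fun r => hom_ext fun q => hom_ext fun p => ?_
    simpa [mulMap_of_of] using mul_assoc_of r q p
  simpa using LinearMap.congr_fun (LinearMap.congr_fun (LinearMap.congr_fun h x) y) z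

theorem one_mulMap [Fintype V] (x : PathAlgebra k V) :
    mulMap k (∑ a : V, of k ⟨a, a, Path.nil⟩) x = x := by
  have h : mulMap k (∑ a : V, of k ⟨a, a, Path.nil⟩) = LinearMap.id (M := PathAlgebra k V) := by
    refine hom_ext fun p => ?_
    obtain ⟨a, b, p⟩ := p
    rw [map_sum, LinearMap.sum_apply, Finset.sum_eq_single b]
    · rw [mulMap_of_of, pathMul_comp]; rfl
    · intro c _ hc
      rw [mulMap_of_of, pathMul_ne]
      exact fun h => hc h.symm
    · simp
  rw [h]; rfl

theorem mulMap_one [Fintype V] (x : PathAlgebra k V) :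
    mulMap k x (∑ a : V, of k ⟨a, a, Path.nil⟩) = x := by
  have h : (mulMap k).flip (∑ a : V, of k ⟨a, a, Path.nil⟩) =
      LinearMap.id (M := PathAlgebra k V) := by
    refine hom_ext fun p => ?_
    obtain ⟨a, b, p⟩ := p
    rw [LinearMap.flip_apply, map_sum, Finset.sum_eq_single a]
    · rw [mulMap_of_of, pathMul_comp, Path.nil_comp]; rfl
    · intro c _ hc
      rw [mulMap_of_of, pathMul_ne]
      exact hc
    · simp
  exact LinearMap.congr_fun h x

instance [Fintype V] : Ring (PathAlgebra k V) where
  __ := (inferInstance : AddCommGroup (PathAlgebra k V))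
  left_distrib x y z := map_add (mulMap k x) y z
  right_distrib x y z := by simp only [mul_eq, map_add, LinearMap.add_apply]
  zero_mul x := by simp only [mul_eq, map_zero, LinearMap.zero_apply]
  mul_zero x := map_zero (mulMap k x)
  mul_assoc := mulMap_assoc
  one_mul := one_mulMap
  mul_one := mulMap_one

instance [Fintype V] : Algebra k (PathAlgebra k V) :=
  Algebra.ofModule (fun r x y => by simp only [mul_eq, map_smul, LinearMap.smul_apply])
    (fun r x y => by simp only [mul_eq, map_smul])

end PathAlgebra

/-! ## Gentle quivers with relations -/

section Gentle

variable {V : Type u} [Quiver.{v} V]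

/-- The path of length two `β α` (first `α`, then `β`). -/
def twoPath {a b c : V} (α : a ⟶ b) (β : b ⟶ c) : QPath V :=
  ⟨a, c, α.toPath.comp β.toPath⟩

/-- The path `p` contains a subpath belonging to `P`. -/
def HasSubpathIn (P : Set (QPath V)) {a b : V} (p : Path a b) : Prop :=
  ∃ (c d : V) (x : Path a c) (y : Path c d) (z : Path d b),
    p = (x.comp y).comp z ∧ (⟨c, d, y⟩ : QPath V) ∈ P

/-- The quiver `V` with the set of paths `P` as relations is gentle. -/
structure IsGentle (P : Set (QPath V)) : Prop where
  /-- All relations are monomials (paths) of length two. -/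
  length_two : ∀ p ∈ P, p.2.2.length = 2
  /-- At most two arrows start at each vertex. -/
  card_out : ∀ a : V, Cardinal.mk (Σ b : V, a ⟶ b) ≤ 2
  /-- At most two arrows end at each vertex. -/
  card_in : ∀ b : V, Cardinal.mk (Σ a : V, a ⟶ b) ≤ 2
  /-- For each arrow `β` there is at most one arrow `α` with `β α` a path not in `P`. -/
  pred_not_mem : ∀ {b c : V} (β : b ⟶ c), {α : Σ a : V, a ⟶ b | twoPath α.2 β ∉ P}.Subsingleton
  /-- For each arrow `β` there is at most one arrow `γ` with `γ β` a path not in `P`. -/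
  succ_not_mem : ∀ {a b : V} (β : a ⟶ b), {γ : Σ c : V, b ⟶ c | twoPath β γ.2 ∉ P}.Subsingleton
  /-- All sufficiently long paths ending with a given arrow `β` contain a relation, and so do all
  sufficiently long paths beginning with `β`. -/
  bounded : ∀ {a b : V} (β : a ⟶ b), ∃ n : ℕ,
    (∀ (x : V) (p : Path x a), n ≤ (p.comp β.toPath).length → HasSubpathIn P (p.comp β.toPath)) ∧
    (∀ (y : V) (q : Path b y), n ≤ (β.toPath.comp q).length → HasSubpathIn P (β.toPath.comp q))
  /-- For each arrow `β` there is at most one arrow `α` with `β α` a path in `P`. -/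
  pred_mem : ∀ {b c : V} (β : b ⟶ c), {α : Σ a : V, a ⟶ b | twoPath α.2 β ∈ P}.Subsingleton
  /-- For each arrow `β` there is at most one arrow `γ` with `γ β` a path in `P`. -/
  succ_mem : ∀ {a b : V} (β : a ⟶ b), {γ : Σ c : V, b ⟶ c | twoPath β γ.2 ∈ P}.Subsingleton

variable (V)

/-- The quiver is connected: it is nonempty and its underlying undirected graph is connected. -/
def QuiverConnected : Prop :=
  Nonempty V ∧ ∀ a b : V, Nonempty (@Path (Symmetrify V) _ a b)

/-- The Kronecker quiver: two vertices, and exactly two arrows, both from the first vertex to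
the second. -/
def IsKroneckerQuiver : Prop :=
  ∃ a b : V, a ≠ b ∧ (∀ c : V, c = a ∨ c = b) ∧ Nat.card (a ⟶ b) = 2 ∧
    IsEmpty (b ⟶ a) ∧ IsEmpty (a ⟶ a) ∧ IsEmpty (b ⟶ b)

/-- The number of cycles `c(Q) = #Q₁ - #Q₀ + 1` of a finite connected quiver (for which
`#Q₀ ≤ #Q₁ + 1`, so that the subtraction does not truncate). -/
def cycleNumber : ℕ := Nat.card (Σ a b : V, a ⟶ b) + 1 - Nat.card V

end Gentle

/-- The ideal of the path algebra generated by the paths in `P`. -/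
def relIdeal (k : Type w) [Field k] {V : Type u} [Quiver.{v} V] [Fintype V]
    (P : Set (QPath V)) : TwoSidedIdeal (PathAlgebra k V) :=
  TwoSidedIdeal.span (PathAlgebra.of k '' P)

/-- The algebra `kQ / ⟨P⟩`. -/
abbrev QuiverAlgebra (k : Type w) [Field k] {V : Type u} [Quiver.{v} V] [Fintype V]
    (P : Set (QPath V)) : Type (max u v w) :=
  (relIdeal k P).ringCon.Quotient

/-! ## Affine algebraic groups over an algebraically closed field

An affine algebraic group is an abstract group `G` together with its `k`-algebra of regular
functions, a subalgebra of the algebra of all functions `G → k`. -/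

section AffineGroups

variable {k : Type w} [Field k]

/-- The Zariski topology determined by an algebra of regular functions: the basic open sets are
the sets where a regular function does not vanish. -/
@[reducible]
def zariskiTopology {G : Type*} (R : Subalgebra k (G → k)) : TopologicalSpace G :=
  TopologicalSpace.generateFrom {U | ∃ F ∈ R, U = {g | F g ≠ 0}}

/-- Pullback of functions along a map. -/
def pullback (k : Type w) [Field k] {G H : Type*} (f : G → H) : (H → k) →ₐ[k] (G → k) where
  toFun F := F ∘ f
  map_one' := rfl
  map_mul' _ _ := rfl
  map_zero' := rfl
  map_add' _ _ := rfl
  commutes' _ := rfl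

/-- The regular functions on a closed subgroup: the restrictions of regular functions. -/
def restrictRegular {G : Type*} [Group G] (R : Subalgebra k (G → k)) (H : Subgroup G) :
    Subalgebra k (H → k) :=
  R.map (pullback k (Subtype.val : H → G))

/-- The regular functions on a quotient by a normal subgroup: the functions whose pullback is
regular, that is, the regular functions invariant under the subgroup. -/
def quotientRegular {G : Type*} [Group G] (R : Subalgebra k (G → k)) (N : Subgroup G) :
    Subalgebra k (G ⧸ N → k) :=
  R.comap (pullback k (QuotientGroup.mk : G → G ⧸ N))

/-- The group isomorphism `e` is an isomorphism of affine algebraic groups: both it and its inverse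
carry regular functions to regular functions. -/
def IsRegularIso {G H : Type*} [Group G] [Group H] (R : Subalgebra k (G → k))
    (R' : Subalgebra k (H → k)) (e : G ≃* H) : Prop :=
  ∀ F : H → k, F ∈ R' ↔ F ∘ e ∈ R

variable (k)

/-- The regular functions on `GL n k`: polynomials in the entries of a matrix and of its inverse. -/
def glRegular (n : ℕ) : Subalgebra k (GL (Fin n) k → k) :=
  Algebra.adjoin k
    ({F | ∃ i j, F = fun g : GL (Fin n) k => (g : Matrix (Fin n) (Fin n) k) i j} ∪
      {F | ∃ i j, F = fun g : GL (Fin n) k => ((g⁻¹ : GL (Fin n) k) : Matrix (Fin n) (Fin n) k) i j})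

/-- The regular functions on the torus `(kˣ)ⁿ`: Laurent polynomials in the coordinates. -/
def torusRegular (n : ℕ) : Subalgebra k ((Fin n → kˣ) → k) :=
  Algebra.adjoin k
    ({F | ∃ i, F = fun t : Fin n → kˣ => (t i : k)} ∪ {F | ∃ i, F = fun t : Fin n → kˣ => (((t i)⁻¹ : kˣ) : k)})

variable {k}

/-- The subgroup `T` is a torus of rank `n`: it is closed and, as an algebraic group, isomorphic to
`(kˣ)ⁿ`. -/
def IsTorusOfRank {G : Type*} [Group G] (R : Subalgebra k (G → k)) (T : Subgroup G) (n : ℕ) :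
    Prop :=
  IsClosed[zariskiTopology R] (T : Set G) ∧
    ∃ e : (Fin n → kˣ) ≃* T, IsRegularIso (torusRegular k n) (restrictRegular R T) e

/-- The subgroup `T` is a torus of rank `n` that is not properly contained in any torus. -/
def IsMaximalTorusOfRank {G : Type*} [Group G] (R : Subalgebra k (G → k)) (T : Subgroup G)
    (n : ℕ) : Prop :=
  IsTorusOfRank R T n ∧ ∀ (T' : Subgroup G) (m : ℕ), IsTorusOfRank R T' m → T ≤ T' → T' = T

end AffineGroups

/-! ## Outer automorphisms of an algebra -/

section Outer

variable (k : Type w) [Field k] (A : Type u) [Ring A] [Algebra k A]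

/-- The regular functions on `Aut(A)`, a closed subgroup of `GL(A)` when `A` is
finite-dimensional: polynomials in the matrix coefficients of `f` and of `f⁻¹`. -/
def autRegular : Subalgebra k ((A ≃ₐ[k] A) → k) :=
  Algebra.adjoin k
    ({F | ∃ (φ : A →ₗ[k] k) (a : A), F = fun f => φ (f a)} ∪
      {F | ∃ (φ : A →ₗ[k] k) (a : A), F = fun f => φ (f⁻¹ a)})

/-- The group of inner automorphisms `a ↦ x a x⁻¹`, for `x` a unit of `A`. -/
def Inn : Subgroup (A ≃ₐ[k] A) := (MulSemiringAction.toAlgAut (ConjAct Aˣ) k A).range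

instance : (Inn k A).Normal where
  conj_mem := by
    rintro _ ⟨x, rfl⟩ g
    refine ⟨ConjAct.toConjAct (Units.map (g : A →* A) (ConjAct.ofConjAct x)), ?_⟩
    ext a
    simp [ConjAct.units_smul_def]

/-- The outer automorphism group `Out(A) = Aut(A) / Inn(A)`. -/
abbrev Out : Type u := (A ≃ₐ[k] A) ⧸ Inn k A

/-- The topology on `Out(A)`: the quotient of the Zariski topology on `Aut(A)`. -/
@[reducible]
def outTopology : TopologicalSpace (Out k A) :=
  TopologicalSpace.coinduced (QuotientGroup.mk : (A ≃ₐ[k] A) → Out k A)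
    (zariskiTopology (autRegular k A))

/-- The regular functions on `Out(A)`. -/
def outRegular : Subalgebra k (Out k A → k) := quotientRegular (autRegular k A) (Inn k A)

variable {k A}

theorem autRegular_translate (g : A ≃ₐ[k] A) {F : (A ≃ₐ[k] A) → k} (hF : F ∈ autRegular k A) :
    (fun f => F (g * f)) ∈ autRegular k A := by
  have h : autRegular k A ≤ (autRegular k A).comap (pullback k fun f => g * f) := by
    refine Algebra.adjoin_le ?_
    rintro _ (⟨φ, a, rfl⟩ | ⟨φ, a, rfl⟩)
    · exact Algebra.subset_adjoin (Or.inl ⟨φ.comp g.toLinearMap, a, rfl⟩)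
    · refine Algebra.subset_adjoin (Or.inr ⟨φ, g⁻¹ a, ?_⟩)
      rfl
  exact h hF

theorem continuous_aut_translate (g : A ≃ₐ[k] A) :
    @Continuous _ _ (zariskiTopology (autRegular k A)) (zariskiTopology (autRegular k A))
      (fun f => g * f) := by
  let := zariskiTopology (autRegular k A)
  refine continuous_generateFrom_iff.2 ?_
  rintro _ ⟨F, hF, rfl⟩
  exact TopologicalSpace.isOpen_generateFrom_of_mem ⟨_, autRegular_translate g hF, rfl⟩

theorem continuous_out_translate (x : Out k A) :
    @Continuous _ _ (outTopology k A) (outTopology k A) (fun y => x * y) := by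
  let := zariskiTopology (autRegular k A)
  let := outTopology k A
  obtain ⟨g, rfl⟩ := QuotientGroup.mk_surjective x
  refine continuous_coinduced_dom.2 ?_
  exact (continuous_coinduced_rng (f := (QuotientGroup.mk : (A ≃ₐ[k] A) → Out k A))).comp
    (continuous_aut_translate g)

variable (k A)

/-- The neutral component of `Out(A)`: the connected component of the identity. -/
def OutNeutral : Subgroup (Out k A) :=
  letI := outTopology k A
  have key : ∀ x ∈ connectedComponent (1 : Out k A), ∀ y ∈ connectedComponent (1 : Out k A),
      x⁻¹ * y ∈ connectedComponent (1 : Out k A) := fun x hx y hy =>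
    (isPreconnected_connectedComponent.image (fun z => x⁻¹ * z)
      (continuous_out_translate x⁻¹).continuousOn).subset_connectedComponent
      ⟨x, hx, inv_mul_cancel x⟩ ⟨y, hy, rfl⟩
  have hinv : ∀ x ∈ connectedComponent (1 : Out k A), x⁻¹ ∈ connectedComponent (1 : Out k A) :=
    fun x hx => by simpa using key x hx 1 mem_connectedComponent
  { carrier := connectedComponent (1 : Out k A)
    one_mem' := mem_connectedComponent
    mul_mem' := fun {x y} hx hy => by simpa using key x⁻¹ (hinv x hx) y hy
    inv_mem' := fun {x} hx => hinv x hx }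

/-- The regular functions on the neutral component of `Out(A)`. -/
def outNeutralRegular : Subalgebra k (OutNeutral k A → k) :=
  restrictRegular (outRegular k A) (OutNeutral k A)

end Outer

end

/-! The nonzero paths of a gentle algebra, with the vertices, form a basis (`IsGentle.pathBasis`),
and a path of positive length is determined by its first and last arrow (`GentleDatum.Good.ext`).
Hence there is at most one nonzero cycle at each vertex (`GentleDatum.IsCycle.unique`), and the
nonzero paths parallel to an arrow `α` are `α` itself, `α` multiplied on one side by such a cycle,
and at most one further path, the detour of `α` (`GentleDatum.Good.parallel_cases`,
`GentleDatum.IsDetour.unique`).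

Let `f` be an automorphism that fixes the vertices modulo the radical and has nonzero diagonal
coefficients on the arrows involved in relations (`PathBasis.Neutral`). Modulo inner automorphisms
it simplifies in three steps. A unit congruent to 1 modulo the radical makes it fix the vertices
(`PathBasis.exists_straighten`), so that arrows go to combinations of parallel paths. The relations
then force the cycle coefficients to be those of a conjugation by `1 + ∑ ζ a • cyc a`, and they kill
the detours of arrows in relations (`PathBasis.exists_cycle_normalization`,
`PathBasis.detourCf_eq_zero`). Finally a combination of vertices rescales the arrows of a spanning
tree to coefficient 1.

What remains is `α ↦ t α • (α + n α • detour α)`, with `n` supported on the `m` relation-free arrows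
that have a detour and `t` on the `c(Q)` arrows off the tree. These maps are multiplicative because
the detour of a relation-free arrow cannot be prolonged (`PathBasis.deformLinear_mul`). They compose
as in `k ^ m ⋊ (kˣ) ^ c(Q)`, and only the trivial one is inner
(`PathBasis.eq_one_of_param_mem_inn`).

Their classes make up exactly the neutral component. They are joined to 1 by rational curves, and
the condition `Neutral` is clopen, being detected by a regular function with values 0 and 1. That
function needs the exclusion of the Kronecker quiver: otherwise two parallel relation-free arrows
could be mixed linearly. The parameters `n` and `t` are regular in `f`, which gives an isomorphism
of algebraic groups (`PathBasis.exists_outNeutral_equiv`).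

The semidirect product embeds into lower triangular matrices with first column `(1, n, 0)` and
diagonal `(1, χ t, t)`. Its vector part is abelian, and its torus is maximal because every character
`χ j` is nontrivial, so that nothing outside the torus commutes with all of it. -/

noncomputable section

/-! ## Regular isomorphisms -/

section RegularIso

variable {k : Type w} [Field k]

theorem IsRegularIso.trans {G H K : Type*} [Group G] [Group H] [Group K]
    {R : Subalgebra k (G → k)} {R' : Subalgebra k (H → k)} {R'' : Subalgebra k (K → k)}
    {e : G ≃* H} {e' : H ≃* K} (h : IsRegularIso R R' e) (h' : IsRegularIso R' R'' e') :
    IsRegularIso R R'' (e.trans e') :=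
  fun F => (h' F).trans (h (F ∘ e'))

theorem mem_of_forall_eq {G : Type*} {R : Subalgebra k (G → k)} {F F' : G → k} (hF : F ∈ R)
    (h : ∀ g, F' g = F g) : F' ∈ R :=
  (funext h : F' = F) ▸ hF

theorem mem_comap_pullback {G H : Type*} {R : Subalgebra k (G → k)} {f : G → H} {F : H → k} :
    F ∈ R.comap (pullback k f) ↔ (fun g => F (f g)) ∈ R := Iff.rfl

theorem isClosed_zariski_of_eq {G : Type*} {R : Subalgebra k (G → k)} {F F' : G → k} (hF : F ∈ R)
    (hF' : F' ∈ R) : IsClosed[zariskiTopology R] {g | F g = F' g} := by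
  let := zariskiTopology R
  refine ⟨?_⟩
  refine TopologicalSpace.isOpen_generateFrom_of_mem ⟨F - F', R.sub_mem hF hF', ?_⟩
  ext g
  simp [sub_eq_zero]

theorem isClosed_zariski_setOf_forall {G : Type*} {R : Subalgebra k (G → k)} {ι : Sort*}
    {p : ι → G → Prop} (h : ∀ i, IsClosed[zariskiTopology R] {g | p i g}) :
    IsClosed[zariskiTopology R] {g | ∀ i, p i g} := by
  let := zariskiTopology R
  rw [Set.ofPred_forall]
  exact isClosed_iInter h

theorem isClosed_zariski_and {G : Type*} {R : Subalgebra k (G → k)}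
    {p q : G → Prop} (h : IsClosed[zariskiTopology R] {g | p g})
    (h' : IsClosed[zariskiTopology R] {g | q g}) :
    IsClosed[zariskiTopology R] {g | p g ∧ q g} := by
  let := zariskiTopology R
  exact h.inter h'

end RegularIso

/-! ## Laurent monomials -/

section Laurent

variable (k : Type w) [Field k] (ι : Type*)

/-- The group of Laurent monomials, as functions on a torus. -/
def laurentMonomials : Subgroup ((ι → kˣ) → kˣ) :=
  Subgroup.closure (Set.range fun i t => t i)

/-- The algebra of polynomial functions on an affine space. -/
def polyFunctions : Subalgebra k ((ι → k) → k) :=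
  Algebra.adjoin k (Set.range fun i z => z i)

variable {k ι}

theorem coord_mem_laurentMonomials (i : ι) :
    (fun t : ι → kˣ => t i) ∈ laurentMonomials k ι :=
  Subgroup.subset_closure ⟨i, rfl⟩

/-- Clearing denominators turns a monomial identity between diagonal entries of a matrix into a
closed condition. Both polynomials are required to be nonzero on the torus so that the induction
passes to inverses. -/
theorem exists_polyFunctions_of_mem_laurentMonomials {μ : (ι → kˣ) → kˣ}
    (h : μ ∈ laurentMonomials k ι) :
    ∃ p ∈ polyFunctions k ι, ∃ q ∈ polyFunctions k ι, ∀ t : ι → kˣ,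
      p (fun i => t i) ≠ 0 ∧ q (fun i => t i) ≠ 0 ∧ (μ t : k) * q (fun i => t i) =
        p (fun i => t i) := by
  induction h using Subgroup.closure_induction with
  | mem x hx =>
    obtain ⟨i, rfl⟩ := hx
    exact ⟨fun z => z i, Algebra.subset_adjoin ⟨i, rfl⟩, 1, one_mem _, fun t => by simp⟩
  | one => exact ⟨1, one_mem _, 1, one_mem _, fun t => by simp⟩
  | mul x y _ _ hx hy =>
    obtain ⟨p, hp, q, hq, h⟩ := hx
    obtain ⟨p', hp', q', hq', h'⟩ := hy
    refine ⟨p * p', mul_mem hp hp', q * q', mul_mem hq hq', fun t => ?_⟩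
    refine ⟨mul_ne_zero (h t).1 (h' t).1, mul_ne_zero (h t).2.1 (h' t).2.1, ?_⟩
    simp only [Pi.mul_apply, Units.val_mul, ← (h t).2.2, ← (h' t).2.2]
    ring
  | inv x _ hx =>
    obtain ⟨p, hp, q, hq, h⟩ := hx
    refine ⟨q, hq, p, hp, fun t => ⟨(h t).2.1, (h t).1, ?_⟩⟩
    rw [← (h t).2.2]
    simp

/-- A Laurent monomial, and its inverse, composed with a family of units whose values and inverses
agree with members of an algebra of functions on a set, agree with members of the algebra too. -/
theorem exists_mem_of_mem_laurentMonomials {X : Type*} {R : Subalgebra k (X → k)} {Y : Set X}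
    {t : X → ι → kˣ} (ht : ∀ i, ∃ F ∈ R, ∀ x ∈ Y, (t x i : k) = F x)
    (ht' : ∀ i, ∃ F ∈ R, ∀ x ∈ Y, ((t x i)⁻¹ : k) = F x) {μ : (ι → kˣ) → kˣ}
    (h : μ ∈ laurentMonomials k ι) :
    (∃ F ∈ R, ∀ x ∈ Y, (μ (t x) : k) = F x) ∧ ∃ F ∈ R, ∀ x ∈ Y, ((μ (t x))⁻¹ : k) = F x := by
  induction h using Subgroup.closure_induction with
  | mem x hx =>
    obtain ⟨i, rfl⟩ := hx
    exact ⟨ht i, ht' i⟩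
  | one => exact ⟨⟨1, one_mem _, by simp⟩, 1, one_mem _, by simp⟩
  | mul x y _ _ hx hy =>
    obtain ⟨⟨F, hF, h⟩, F', hF', h'⟩ := hx
    obtain ⟨⟨G, hG, g⟩, G', hG', g'⟩ := hy
    refine ⟨⟨F * G, mul_mem hF hG, fun x hx => ?_⟩, F' * G', mul_mem hF' hG', fun x hx => ?_⟩
    · simp [h x hx, g x hx]
    · simp [mul_comm, ← h' x hx, ← g' x hx]
  | inv x _ hx =>
    obtain ⟨⟨F, hF, h⟩, F', hF', h'⟩ := hx
    refine ⟨⟨F', hF', fun x hx => ?_⟩, F, hF, fun x hx => ?_⟩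
    · simp [← h' x hx]
    · simp [← h x hx]

end Laurent

/-! ## The semidirect product of a torus and a vector group -/

section TorusVector

variable {k : Type w} [Field k] {m b : ℕ}

/-- The semidirect product of the vector group `k ^ m` and the torus `(kˣ) ^ b`, which acts on the
`j`-th coordinate by the character `χ j`. -/
@[ext]
structure TorusVector (χ : Fin m → ((Fin b → kˣ) →* kˣ)) where
  /-- The component in the vector group. -/
  vec : Fin m → k
  /-- The component in the torus. -/
  tor : Fin b → kˣ

namespace TorusVector

variable {χ : Fin m → ((Fin b → kˣ) →* kˣ)}

instance : Mul (TorusVector χ) := ⟨fun x y => ⟨fun j => x.vec j + χ j x.tor * y.vec j, x.tor * y.tor⟩⟩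

instance : One (TorusVector χ) := ⟨⟨0, 1⟩⟩

instance : Inv (TorusVector χ) := ⟨fun x => ⟨fun j => -((χ j x.tor)⁻¹ * x.vec j), x.tor⁻¹⟩⟩

@[simp] theorem mul_vec (x y : TorusVector χ) (j : Fin m) :
    (x * y).vec j = x.vec j + χ j x.tor * y.vec j := rfl

@[simp] theorem mul_tor (x y : TorusVector χ) : (x * y).tor = x.tor * y.tor := rfl

@[simp] theorem one_vec : (1 : TorusVector χ).vec = 0 := rfl

@[simp] theorem one_tor : (1 : TorusVector χ).tor = 1 := rfl

@[simp] theorem inv_vec (x : TorusVector χ) (j : Fin m) :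
    x⁻¹.vec j = -((χ j x.tor : k)⁻¹ * x.vec j) := by
  rw [← Units.val_inv_eq_inv_val]
  rfl

@[simp] theorem inv_tor (x : TorusVector χ) : x⁻¹.tor = x.tor⁻¹ := rfl

instance : Group (TorusVector χ) :=
  Group.ofLeftAxioms
    (fun x y z => by
      ext j
      · simp; ring
      · simp [mul_assoc])
    (fun x => by ext j <;> simp)
    (fun x => by ext j <;> simp)

variable (χ)

/-- The regular functions on the semidirect product: polynomials in the coordinates and in the
inverses of the coordinates of the torus. -/
def regular : Subalgebra k (TorusVector χ → k) :=
  Algebra.adjoin k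
    ((Set.range fun j x => x.vec j) ∪ (Set.range fun i x => (x.tor i : k)) ∪
      (Set.range fun i x => ((x.tor i)⁻¹ : k)))

variable {χ}

theorem vec_mem_regular (j : Fin m) : (fun x : TorusVector χ => x.vec j) ∈ regular χ :=
  Algebra.subset_adjoin (Or.inl (Or.inl ⟨j, rfl⟩))

theorem tor_mem_regular (i : Fin b) : (fun x : TorusVector χ => (x.tor i : k)) ∈ regular χ :=
  Algebra.subset_adjoin (Or.inl (Or.inr ⟨i, rfl⟩))

theorem tor_inv_mem_regular (i : Fin b) :
    (fun x : TorusVector χ => ((x.tor i)⁻¹ : k)) ∈ regular χ :=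
  Algebra.subset_adjoin (Or.inr ⟨i, rfl⟩)

theorem monomial_mem_regular {μ : (Fin b → kˣ) → kˣ} (h : μ ∈ laurentMonomials k (Fin b)) :
    (fun x : TorusVector χ => (μ x.tor : k)) ∈ regular χ ∧
      (fun x : TorusVector χ => ((μ x.tor)⁻¹ : k)) ∈ regular χ := by
  obtain ⟨⟨F, hF, h⟩, F', hF', h'⟩ := exists_mem_of_mem_laurentMonomials (R := regular χ)
    (Y := Set.univ) (t := fun x => x.tor) (fun i => ⟨_, tor_mem_regular i, fun _ _ => rfl⟩)
    (fun i => ⟨_, tor_inv_mem_regular i, fun _ _ => rfl⟩) h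
  constructor
  · convert hF using 1
    exact funext fun x => h x trivial
  · convert hF' using 1
    exact funext fun x => h' x trivial

/-- The vector component of `x⁻¹` is `-χ(t)⁻¹ v`; it is regular because the characters are Laurent
monomials. -/
theorem comp_inv_mem_regular (hχ : ∀ j, ⇑(χ j) ∈ laurentMonomials k (Fin b))
    {F : TorusVector χ → k} (hF : F ∈ regular χ) : (fun x => F x⁻¹) ∈ regular χ := by
  have h : regular χ ≤ (regular χ).comap (pullback k fun x => x⁻¹) := by
    refine Algebra.adjoin_le ?_
    rintro _ ((⟨j, rfl⟩ | ⟨i, rfl⟩) | ⟨i, rfl⟩)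
    · exact mem_comap_pullback.2 <| mem_of_forall_eq
        (neg_mem (mul_mem (monomial_mem_regular (hχ j)).2 (vec_mem_regular j))) fun x => by simp
    · exact mem_comap_pullback.2 <| mem_of_forall_eq (tor_inv_mem_regular i) fun x => by simp
    · exact mem_comap_pullback.2 <| mem_of_forall_eq (tor_mem_regular i) fun x => by simp
  exact h hF

/-! ### The embedding into lower triangular matrices -/

/-- The matrix with first column `(1, ν)`, diagonal `(1, ψ)` and zeros elsewhere. -/
def arrowMatrix {r : ℕ} (ν ψ : Fin r → k) : Matrix (Fin (r + 1)) (Fin (r + 1)) k :=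
  Matrix.of (Fin.cons (Fin.cons 1 0) fun i => Fin.cons (ν i) fun j => if i = j then ψ i else 0)

/-! ### Matrices supported on the first column and the diagonal -/

section arrowMatrix

variable {r : ℕ} (ν ψ ν' ψ' : Fin r → k)

@[simp] theorem arrowMatrix_zero_zero : arrowMatrix ν ψ 0 0 = 1 := rfl

@[simp] theorem arrowMatrix_zero_succ (j : Fin r) : arrowMatrix ν ψ 0 j.succ = 0 := rfl

@[simp] theorem arrowMatrix_succ_zero (i : Fin r) : arrowMatrix ν ψ i.succ 0 = ν i := rfl

@[simp] theorem arrowMatrix_succ_succ (i j : Fin r) :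
    arrowMatrix ν ψ i.succ j.succ = if i = j then ψ i else 0 := rfl

theorem arrowMatrix_mul :
    arrowMatrix ν ψ * arrowMatrix ν' ψ' = arrowMatrix (ν + ψ * ν') (ψ * ψ') := by
  ext i j
  rw [Matrix.mul_apply, Fin.sum_univ_succ]
  refine Fin.cases ?_ (fun i => ?_) i <;> refine Fin.cases ?_ (fun j => ?_) j <;> simp
  split_ifs with h
  · rw [h]
  · rfl

theorem arrowMatrix_zero_one : arrowMatrix (0 : Fin r → k) 1 = 1 := by
  ext i j
  refine Fin.cases ?_ (fun i => ?_) i <;> refine Fin.cases ?_ (fun j => ?_) j <;>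
    simp [Matrix.one_apply, (Fin.succ_ne_zero _).symm]

end arrowMatrix

variable (χ) in
/-- The representation of the semidirect product by lower triangular matrices. -/
def toMatrix : TorusVector χ →* Matrix (Fin (m + b + 1)) (Fin (m + b + 1)) k where
  -- The torus coordinates are repeated on the diagonal, next to the characters, to make the
  -- representation faithful.
  toFun x := arrowMatrix (Fin.append x.vec 0) (Fin.append (fun j => (χ j x.tor : k)) fun i => x.tor i)
  map_one' := by
    rw [← arrowMatrix_zero_one]
    congr 1 <;> ext i <;> refine Fin.addCases (fun i => ?_) (fun i => ?_) i <;> simp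
  map_mul' x y := by
    rw [arrowMatrix_mul]
    congr 1 <;> ext i <;> refine Fin.addCases (fun i => ?_) (fun i => ?_) i <;> simp

variable (χ) in
/-- The representation of the semidirect product in the general linear group. -/
def toGL : TorusVector χ →* GL (Fin (m + b + 1)) k := (toMatrix χ).toHomUnits

theorem toGL_apply (x : TorusVector χ) :
    (toGL χ x).1 = arrowMatrix (Fin.append x.vec 0)
      (Fin.append (fun j => (χ j x.tor : k)) fun i => x.tor i) := rfl

theorem toGL_inv_apply (x : TorusVector χ) :
    ((toGL χ x)⁻¹ : GL (Fin (m + b + 1)) k) = toGL χ x⁻¹ := (map_inv _ _).symm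

theorem toGL_injective : Function.Injective (toGL χ) := by
  intro x y h
  have h' := congrArg (fun g : GL (Fin (m + b + 1)) k => g.1) h
  simp only [toGL_apply] at h'
  ext i
  · simpa using congrFun (congrFun h' (Fin.castAdd b i).succ) 0
  · simpa using congrFun (congrFun h' (Fin.natAdd m i).succ) (Fin.natAdd m i).succ

theorem entry_mem_glRegular {n : ℕ} (i j : Fin n) :
    (fun g : GL (Fin n) k => (g : Matrix (Fin n) (Fin n) k) i j) ∈ glRegular k n :=
  Algebra.subset_adjoin (Or.inl ⟨i, j, rfl⟩)

theorem inv_entry_mem_glRegular {n : ℕ} (i j : Fin n) :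
    (fun g : GL (Fin n) k => ((g⁻¹ : GL (Fin n) k) : Matrix (Fin n) (Fin n) k) i j) ∈
      glRegular k n :=
  Algebra.subset_adjoin (Or.inr ⟨i, j, rfl⟩)

theorem lowerTriangular_toGL (x : TorusVector χ) {i j : Fin (m + b + 1)} (h : i < j) :
    (toGL χ x).1 i j = 0 := by
  rw [toGL_apply]
  revert h
  refine Fin.cases ?_ (fun i => ?_) i <;> refine Fin.cases ?_ (fun j => ?_) j <;> intro h
  · simp at h
  · simp
  · simp at h
  · rw [arrowMatrix_succ_succ, if_neg]
    rintro rfl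
    simp at h

theorem polyFunctions_comp_mem {X ι : Type*} {R : Subalgebra k (X → k)} {z : X → ι → k}
    (hz : ∀ i, (fun x => z x i) ∈ R) {p : (ι → k) → k} (hp : p ∈ polyFunctions k ι) :
    (fun x => p (z x)) ∈ R := by
  have h : polyFunctions k ι ≤ R.comap (pullback k z) := by
    refine Algebra.adjoin_le ?_
    rintro _ ⟨i, rfl⟩
    exact hz i
  exact h hp

/-- The shape of the matrix is given by linear equations, and the character entries are tied to the
last `b` diagonal entries by `χ j * q j = p j`. No inequality is needed, since a triangular matrix
in `GL` has nonzero diagonal entries. -/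
theorem isClosed_range_toGL (hχ : ∀ j, ⇑(χ j) ∈ laurentMonomials k (Fin b)) :
    IsClosed[zariskiTopology (glRegular k (m + b + 1))]
      ((toGL χ).range : Set (GL (Fin (m + b + 1)) k)) := by
  choose p hp q hq hpq using fun j => exists_polyFunctions_of_mem_laurentMonomials (hχ j)
  let d (g : GL (Fin (m + b + 1)) k) (i : Fin b) : k := g.1 (Fin.natAdd m i).succ (Fin.natAdd m i).succ
  have key : ((toGL χ).range : Set (GL (Fin (m + b + 1)) k)) =
      {g | g.1 0 0 = 1 ∧ (∀ j : Fin (m + b), g.1 0 j.succ = 0) ∧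
        (∀ ij : {ij : Fin (m + b) × Fin (m + b) // ij.1 ≠ ij.2}, g.1 ij.1.1.succ ij.1.2.succ = 0) ∧
        (∀ i : Fin b, g.1 (Fin.natAdd m i).succ 0 = 0) ∧
        ∀ j : Fin m, g.1 (Fin.castAdd b j).succ (Fin.castAdd b j).succ * q j (d g) = p j (d g)} := by
    ext g
    constructor
    · rintro ⟨x, rfl⟩
      refine ⟨rfl, fun _ => rfl, ?_, ?_, ?_⟩
      · rintro ⟨⟨i, j⟩, h⟩
        simpa [toGL_apply] using fun h' => absurd h' h
      · intro i
        simp [toGL_apply]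
      · intro j
        have hd : d (toGL χ x) = fun i => (x.tor i : k) := by
          ext i
          simp [d, toGL_apply]
        rw [hd]
        simpa [toGL_apply] using (hpq j x.tor).2.2
    · rintro ⟨h1, h2, h3, h4, h5⟩
      have htri : g.1.BlockTriangular OrderDual.toDual := by
        intro i j hij
        have hij : i < j := hij
        revert hij
        refine Fin.cases ?_ (fun i => ?_) i <;> refine Fin.cases ?_ (fun j => ?_) j <;> intro h
        · simp at h
        · exact h2 j
        · simp at h
        · exact h3 ⟨(i, j), fun h' => by
            obtain rfl : i = j := h'
            simp at h⟩
      -- The determinant of a triangular matrix is the product of its diagonal; its being nonzero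
      -- supplies the units of the torus component.
      have hdet : (∏ i, g.1 i i) ≠ 0 := by
        rw [← Matrix.det_of_isLowerTriangular g.1 htri]
        exact g.det.ne_zero
      have hne : ∀ i, g.1 i i ≠ 0 := fun i => (Finset.prod_ne_zero_iff.1 hdet) i (Finset.mem_univ i)
      let t : Fin b → kˣ := fun i => Units.mk0 (d g i) (hne _)
      refine ⟨⟨fun j => g.1 (Fin.castAdd b j).succ 0, t⟩, ?_⟩
      ext i j
      rw [toGL_apply]
      refine Fin.cases ?_ (fun i => ?_) i <;> refine Fin.cases ?_ (fun j => ?_) j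
      · exact h1.symm
      · exact (h2 j).symm
      · refine Fin.addCases (fun i => ?_) (fun i => ?_) i
        · simp
        · simpa using (h4 i).symm
      · rw [arrowMatrix_succ_succ]
        split_ifs with h
        · subst h
          refine Fin.addCases (fun i => ?_) (fun i => ?_) i
          · have := hpq i t
            rw [Fin.append_left]
            exact mul_right_cancel₀ this.2.1 (this.2.2.trans (h5 i).symm)
          · simp [t, d]
        · exact (h3 ⟨(i, j), h⟩).symm
  rw [key]
  have hd : ∀ i, (fun g => d g i) ∈ glRegular k (m + b + 1) := fun i => entry_mem_glRegular _ _
  have hc : ∀ c : k, (fun _ => c) ∈ glRegular k (m + b + 1) := fun c =>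
    (glRegular k (m + b + 1)).algebraMap_mem c
  refine isClosed_zariski_and (isClosed_zariski_of_eq (entry_mem_glRegular _ _) (hc 1)) <|
    isClosed_zariski_and (isClosed_zariski_setOf_forall fun j =>
      isClosed_zariski_of_eq (entry_mem_glRegular _ _) (hc 0)) <|
    isClosed_zariski_and (isClosed_zariski_setOf_forall fun j =>
      isClosed_zariski_of_eq (entry_mem_glRegular _ _) (hc 0)) <|
    isClosed_zariski_and (isClosed_zariski_setOf_forall fun j =>
      isClosed_zariski_of_eq (entry_mem_glRegular _ _) (hc 0)) <|
    isClosed_zariski_setOf_forall fun j => isClosed_zariski_of_eq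
      (mul_mem (entry_mem_glRegular _ _) (polyFunctions_comp_mem hd (hq j)))
      (polyFunctions_comp_mem hd (hp j))

theorem comp_toGL_mem_regular (hχ : ∀ j, ⇑(χ j) ∈ laurentMonomials k (Fin b))
    {F : GL (Fin (m + b + 1)) k → k} (hF : F ∈ glRegular k (m + b + 1)) :
    (fun x => F (toGL χ x)) ∈ regular χ := by
  have hc : ∀ c : k, (fun _ => c) ∈ regular χ := fun c => (regular χ).algebraMap_mem c
  have hentry : ∀ i j, (fun x => (toGL χ x).1 i j) ∈ regular χ := by
    intro i j
    simp only [toGL_apply]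
    refine Fin.cases ?_ (fun i => ?_) i <;> refine Fin.cases ?_ (fun j => ?_) j
    · exact hc 1
    · exact hc 0
    · refine Fin.addCases (fun i => ?_) (fun i => ?_) i
      · simpa using vec_mem_regular i
      · simpa using hc 0
    · simp only [arrowMatrix_succ_succ]
      split_ifs
      · refine Fin.addCases (fun i => ?_) (fun i => ?_) i
        · simpa using (monomial_mem_regular (hχ i)).1
        · simpa using tor_mem_regular i
      · exact hc 0
  have h : glRegular k (m + b + 1) ≤ (regular χ).comap (pullback k (toGL χ)) := by
    refine Algebra.adjoin_le ?_
    rintro _ (⟨i, j, rfl⟩ | ⟨i, j, rfl⟩)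
    · exact hentry i j
    · have := comp_inv_mem_regular hχ (hentry i j)
      refine mem_comap_pullback.2 <| mem_of_forall_eq this fun x => ?_
      rw [← toGL_inv_apply]
  exact h hF

theorem exists_lowerTriangular_embedding (hχ : ∀ j, ⇑(χ j) ∈ laurentMonomials k (Fin b)) :
    ∃ (n : ℕ) (G : Subgroup (GL (Fin n) k)) (e : TorusVector χ ≃* G),
      IsClosed[zariskiTopology (glRegular k n)] (G : Set (GL (Fin n) k)) ∧
      (∀ g ∈ G, ∀ i j : Fin n, i < j → (g : Matrix (Fin n) (Fin n) k) i j = 0) ∧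
      IsRegularIso (regular χ) (restrictRegular (glRegular k n) G) e := by
  let e : TorusVector χ ≃* (toGL χ).range := MonoidHom.ofInjective toGL_injective
  refine ⟨m + b + 1, (toGL χ).range, e, isClosed_range_toGL hχ, ?_, fun F => ⟨?_, fun hF => ?_⟩⟩
  · rintro _ ⟨x, rfl⟩ i j h
    exact lowerTriangular_toGL x h
  · rintro ⟨F', hF', rfl⟩
    exact comp_toGL_mem_regular hχ hF'
  -- The coordinates of the inverse map are matrix entries; the inverses of the torus coordinates
  -- are entries of the inverse matrix.
  · have h : regular χ ≤
        (restrictRegular (glRegular k (m + b + 1)) (toGL χ).range).comap (pullback k e.symm) := by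
      refine Algebra.adjoin_le ?_
      rintro _ ((⟨j, rfl⟩ | ⟨i, rfl⟩) | ⟨i, rfl⟩)
      · refine ⟨_, entry_mem_glRegular (Fin.castAdd b j).succ 0, ?_⟩
        funext g
        obtain ⟨x, rfl⟩ := e.surjective g
        change (toGL χ x).1 (Fin.castAdd b j).succ 0 = (e.symm (e x)).vec j
        simp [toGL_apply]
      · refine ⟨_, entry_mem_glRegular (Fin.natAdd m i).succ (Fin.natAdd m i).succ, ?_⟩
        funext g
        obtain ⟨x, rfl⟩ := e.surjective g
        change (toGL χ x).1 (Fin.natAdd m i).succ (Fin.natAdd m i).succ = (e.symm (e x)).tor i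
        simp [toGL_apply]
      · refine ⟨_, inv_entry_mem_glRegular (Fin.natAdd m i).succ (Fin.natAdd m i).succ, ?_⟩
        funext g
        obtain ⟨x, rfl⟩ := e.surjective g
        change ((toGL χ x)⁻¹).1 (Fin.natAdd m i).succ (Fin.natAdd m i).succ =
          ((e.symm (e x)).tor i : k)⁻¹
        rw [toGL_inv_apply, toGL_apply]
        simp
    exact mem_of_forall_eq (mem_comap_pullback.1 (h hF)) fun g => by simp

/-! ### The maximal torus and its complement -/

section Decomposition

variable {G : Type*} [Group G] {R : Subalgebra k (G → k)} (E : G ≃* TorusVector χ)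

/-- The subgroup of a group `G ≅ k ^ m ⋊ (kˣ) ^ b` that corresponds to the torus. -/
def torusSubgroup : Subgroup G where
  carrier := {g | ∀ j, (E g).vec j = 0}
  one_mem' := by simp
  mul_mem' := by
    intro x y hx hy j
    simp [hx j, hy j]
  inv_mem' := by
    intro x hx j
    simp [hx j]

/-- The subgroup of a group `G ≅ k ^ m ⋊ (kˣ) ^ b` that corresponds to the vector group. -/
def vectorSubgroup : Subgroup G where
  carrier := {g | ∀ i, (E g).tor i = 1}
  one_mem' := by simp
  mul_mem' := by
    intro x y hx hy j
    simp [hx j, hy j]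
  inv_mem' := by
    intro x hx j
    simp [hx j]

theorem mem_vectorSubgroup {g : G} : g ∈ vectorSubgroup E ↔ ∀ i, (E g).tor i = 1 := Iff.rfl

/-- The isomorphism of the torus `(kˣ) ^ b` with the torus subgroup. -/
def torusEquiv : (Fin b → kˣ) ≃* torusSubgroup E where
  toFun t := ⟨E.symm ⟨0, t⟩, fun j => by simp⟩
  invFun g := (E g).tor
  left_inv t := by simp
  right_inv g := by
    apply Subtype.ext
    apply E.injective
    ext j
    · simpa using (g.2 j).symm
    · simp
  map_mul' t t' := by
    apply Subtype.ext
    apply E.injective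
    ext j <;> simp

theorem comp_mem_of_mem_regular (hE : IsRegularIso R (regular χ) E) {F : TorusVector χ → k}
    (hF : F ∈ regular χ) : (fun g => F (E g)) ∈ R := (hE F).1 hF

theorem isTorusOfRank_torusSubgroup (hE : IsRegularIso R (regular χ) E) :
    IsTorusOfRank R (torusSubgroup E) b := by
  constructor
  · exact isClosed_zariski_setOf_forall fun j => isClosed_zariski_of_eq
      (comp_mem_of_mem_regular E hE (vec_mem_regular j)) (R.zero_mem)
  refine ⟨torusEquiv E, fun F => ⟨?_, fun hF => ?_⟩⟩
  · rintro ⟨F', hF', rfl⟩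
    have hF'' : F' ∘ E.symm ∈ regular χ := by
      rw [hE]
      exact mem_of_forall_eq hF' fun g => by simp
    have h : regular χ ≤ (torusRegular k b).comap (pullback k fun t => ⟨0, t⟩) := by
      refine Algebra.adjoin_le ?_
      rintro _ ((⟨j, rfl⟩ | ⟨i, rfl⟩) | ⟨i, rfl⟩)
      · exact (torusRegular k b).zero_mem
      · exact Algebra.subset_adjoin (Or.inl ⟨i, rfl⟩)
      · refine Algebra.subset_adjoin (Or.inr ⟨i, ?_⟩)
        ext t
        exact (Units.val_inv_eq_inv_val _).symm
    exact h hF''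
  · have h : torusRegular k b ≤
        (restrictRegular R (torusSubgroup E)).comap (pullback k (torusEquiv E).symm) := by
      refine Algebra.adjoin_le ?_
      rintro _ (⟨i, rfl⟩ | ⟨i, rfl⟩)
      · exact ⟨_, comp_mem_of_mem_regular E hE (tor_mem_regular i), rfl⟩
      · refine ⟨_, comp_mem_of_mem_regular E hE (tor_inv_mem_regular i), ?_⟩
        funext g
        change ((E g).tor i : k)⁻¹ = (((E g).tor i)⁻¹ : kˣ)
        simp
    exact mem_of_forall_eq (mem_comap_pullback.1 (h hF)) fun g => by simp

/-- A larger torus is commutative, so each of its elements, with vector component `v`, commutes with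
all `(0, t)`. This gives `(χ j t - 1) * v j = 0`, and a `t` with `χ j t ≠ 1` forces `v j = 0`. -/
theorem isMaximalTorusOfRank_torusSubgroup (hE : IsRegularIso R (regular χ) E)
    (hχ : ∀ j, ∃ t, χ j t ≠ 1) : IsMaximalTorusOfRank R (torusSubgroup E) b := by
  refine ⟨isTorusOfRank_torusSubgroup E hE, ?_⟩
  rintro T n ⟨-, e, -⟩ hT
  refine le_antisymm (fun g hg j => ?_) hT
  obtain ⟨t, ht⟩ := hχ j
  have hcomm : ∀ x y : T, x * y = y * x := fun x y => by
    obtain ⟨x, rfl⟩ := e.surjective x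
    obtain ⟨y, rfl⟩ := e.surjective y
    rw [← map_mul, mul_comm, map_mul]
  have h := congrArg Subtype.val (hcomm ⟨g, hg⟩ ⟨_, hT (torusEquiv E t).2⟩)
  have h' := congrArg (fun x => (E x).vec j) h
  simp only [torusEquiv, Subgroup.coe_mul, MulEquiv.coe_mk, Equiv.coe_fn_mk, map_mul,
    MulEquiv.apply_symm_apply, mul_vec, Pi.zero_apply, mul_zero, add_zero, zero_add] at h'
  have : ((χ j t : k) - 1) * (E g).vec j = 0 := by linear_combination -h'
  refine (mul_eq_zero.1 this).resolve_left fun h0 => ht ?_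
  exact Units.ext (sub_eq_zero.1 h0)

theorem vectorSubgroup_normal : (vectorSubgroup E).Normal where
  conj_mem x hx g i := by simp [hx i]

theorem isClosed_vectorSubgroup (hE : IsRegularIso R (regular χ) E) :
    IsClosed[zariskiTopology R] (vectorSubgroup E : Set G) := by
  have : (vectorSubgroup E : Set G) = {g | ∀ i, ((E g).tor i : k) = 1} := by
    ext g
    simp [mem_vectorSubgroup]
  rw [this]
  exact isClosed_zariski_setOf_forall fun i => isClosed_zariski_of_eq
      (comp_mem_of_mem_regular E hE (tor_mem_regular i)) (R.one_mem)

/-- With trivial torus components the product is the addition of vectors, so the group is even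
abelian. -/
theorem isNilpotent_vectorSubgroup : Group.IsNilpotent (vectorSubgroup E) := by
  have hcomm : ∀ x y : vectorSubgroup E, x * y = y * x := by
    rintro ⟨x, hx⟩ ⟨y, hy⟩
    have h1 : (E x).tor = 1 := funext hx
    have h2 : (E y).tor = 1 := funext hy
    apply Subtype.ext
    apply E.injective
    ext j
    · simp [h1, h2, add_comm]
    · simp [h1, h2]
  let : CommGroup (vectorSubgroup E) := { (inferInstance : Group (vectorSubgroup E)) with
    mul_comm := hcomm }
  exact CommGroup.isNilpotent

theorem isComplement'_torusSubgroup_vectorSubgroup :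
    (torusSubgroup E).IsComplement' (vectorSubgroup E) := by
  refine Subgroup.isComplement'_of_disjoint_and_mul_eq_univ ?_ ?_
  · rw [Subgroup.disjoint_def]
    intro x hx hy
    apply E.injective
    ext j
    · simpa using hx j
    · simpa using hy j
  · refine Set.eq_univ_of_forall fun g => ?_
    let s : torusSubgroup E := torusEquiv E (E g).tor
    refine Set.mem_mul.2 ⟨s, s.2, (s : G)⁻¹ * g, fun i => ?_, by simp⟩
    simp [s, torusEquiv]

end Decomposition

end TorusVector

end TorusVector

/-! ## The combinatorics of gentle quivers

Paths of positive length are encoded by the words of their arrows, in the order in which they are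
multiplied: the first letter of a word is the last arrow of the path. -/

/-- The combinatorial data of a connected gentle quiver with relations that is not the Kronecker
quiver: `ok β α` says that `β α` is a path that is not a relation. -/
structure GentleDatum (V E : Type*) where
  /-- The start of an arrow. -/
  src : E → V
  /-- The end of an arrow. -/
  tgt : E → V
  /-- The path `β α` is defined and not a relation. -/
  ok : E → E → Prop
  tgt_eq_src : ∀ {β α}, ok β α → tgt α = src β
  ok_right_unique : ∀ {β α α'}, ok β α → ok β α' → α = α'
  ok_left_unique : ∀ {β β' α}, ok β α → ok β' α → β = β'
  rel_right_unique : ∀ {β α α'}, tgt α = src β → ¬ ok β α → tgt α' = src β → ¬ ok β α' → α = α'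
  rel_left_unique : ∀ {β β' α}, tgt α = src β → ¬ ok β α → tgt α = src β' → ¬ ok β' α → β = β'
  bounded : ∃ L : ℕ, ∀ l : List E, l.IsChain ok → l.length ≤ L
  out_le_two : ∀ {α β γ}, src α = src β → src α = src γ → α = β ∨ α = γ ∨ β = γ
  in_le_two : ∀ {α β γ}, tgt α = tgt β → tgt α = tgt γ → α = β ∨ α = γ ∨ β = γ
  connected : ∀ W : Set V, W.Nonempty → (∀ α, src α ∈ W ↔ tgt α ∈ W) → W = Set.univ
  -- The only field in which the exclusion of the Kronecker quiver enters: parallel arrows outside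
  -- all relations coincide.
  parallel_free : ∀ {α α'}, src α = src α' → tgt α = tgt α' →
    (∀ β, (tgt β = src α → ok α β) ∧ (tgt α = src β → ok β α)) →
    (∀ β, (tgt β = src α' → ok α' β) ∧ (tgt α' = src β → ok β α')) → α = α'

namespace GentleDatum

variable {V E : Type*} (D : GentleDatum V E)

/-- A word is good if it encodes a nonzero path of positive length. -/
def Good (l : List E) : Prop := l ≠ [] ∧ l.IsChain D.ok

/-- The arrow `α` is not part of any relation. -/
def Free (α : E) : Prop := ∀ β, (D.tgt β = D.src α → D.ok α β) ∧ (D.tgt α = D.src β → D.ok β α)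

/-- The path encoded by the word `l` starts in `a`. -/
def StartsAt (l : List E) (a : V) : Prop := ∀ α ∈ l.getLast?, D.src α = a

/-- The path encoded by the word `l` ends in `b`. -/
def EndsAt (l : List E) (b : V) : Prop := ∀ α ∈ l.head?, D.tgt α = b

/-- A nonzero path of positive length from `a` to `a`. -/
def IsCycle (a : V) (l : List E) : Prop := D.Good l ∧ D.StartsAt l a ∧ D.EndsAt l a

/-- A nonzero path parallel to `α` that neither begins nor ends with `α`. -/
def IsDetour (α : E) (l : List E) : Prop :=
  D.Good l ∧ D.StartsAt l (D.src α) ∧ D.EndsAt l (D.tgt α) ∧ l.head? ≠ some α ∧ l.getLast? ≠ some α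

variable {D}

/-! ### Words of nonzero paths -/

theorem Good.singleton (α : E) : D.Good [α] := ⟨by simp, by simp⟩

theorem Good.left {l m : List E} (h : D.Good (l ++ m)) (hl : l ≠ []) : D.Good l :=
  ⟨hl, h.2.left_of_append⟩

theorem Good.right {l m : List E} (h : D.Good (l ++ m)) (hm : m ≠ []) : D.Good m :=
  ⟨hm, h.2.right_of_append⟩

theorem good_append_iff {l m : List E} {β α : E} :
    D.Good ((l ++ [β]) ++ (α :: m)) ↔ D.Good (l ++ [β]) ∧ D.Good (α :: m) ∧ D.ok β α := by
  simp [Good, List.isChain_append]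
  tauto

theorem Good.append_of_overlap {l m n : List E} (h : D.Good (l ++ m)) (h' : D.Good (m ++ n))
    (hm : m ≠ []) : D.Good (l ++ m ++ n) :=
  ⟨by simp [hm], h.2.append_overlap h'.2 hm⟩

/-- A closed chain could be traversed any number of times, which would give good words of unbounded
length. -/
theorem not_transGen_ok (x : E) : ¬ Relation.TransGen D.ok x x := by
  intro h
  obtain ⟨L, hL⟩ := D.bounded
  obtain ⟨z, hxz, hz⟩ := Relation.TransGen.tail'_iff.1 h
  obtain ⟨l, hl, hlast⟩ := List.exists_isChain_cons_of_relationReflTransGen hxz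
  have key : ∀ n : ℕ, ∃ m : List E, (x :: m).IsChain D.ok ∧ n ≤ m.length := by
    intro n
    induction n with
    | zero => exact ⟨[], by simp, by simp⟩
    | succ n ih =>
      obtain ⟨m, hm, hn⟩ := ih
      refine ⟨l ++ x :: m, ?_, by simp; omega⟩
      rw [← List.cons_append]
      refine hl.append hm ?_
      intro y hy w hw
      rw [List.getLast?_eq_some_getLast (by simp)] at hy
      simp only [Option.mem_def, Option.some.injEq] at hy
      simp only [List.head?_cons, Option.mem_def, Option.some.injEq] at hw
      rw [← hy, ← hw, hlast]
      exact hz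
  obtain ⟨m, hm, hn⟩ := key L
  have := hL _ hm
  simp at this
  omega

theorem Good.nodup {l : List E} (h : D.Good l) : l.Nodup := by
  have h1 : l.IsChain (Relation.TransGen D.ok) := h.2.imp fun _ _ => Relation.TransGen.single
  refine h1.pairwise.imp fun {a b} hab => ?_
  rintro rfl
  exact not_transGen_ok _ hab

/-- Every letter has at most one possible successor, so words with the same first letter can differ
only in where they stop. -/
theorem prefix_or_prefix_of_head?_eq {l m : List E} (hl : l.IsChain D.ok) (hm : m.IsChain D.ok)
    (h : l.head? = m.head?) : l <+: m ∨ m <+: l := by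
  induction l generalizing m with
  | nil => simp
  | cons x l ih =>
    obtain _ | ⟨y, m⟩ := m
    · simp
    obtain rfl : x = y := by simpa using h
    simp only [List.cons_prefix_cons, true_and]
    obtain _ | ⟨z, l⟩ := l
    · simp
    obtain _ | ⟨z', m⟩ := m
    · simp
    rw [List.isChain_cons_cons] at hl hm
    obtain rfl := D.ok_right_unique hl.1 hm.1
    exact ih hl.2 hm.2 rfl

theorem exists_append_singleton {l : List E} (h : l ≠ []) : ∃ m β, l = m ++ [β] := by
  simpa using (List.eq_nil_or_concat l).resolve_left h

/-- Otherwise the longer word would contain the common last letter twice. -/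
theorem Good.eq_of_prefix {l m : List E} (hl : D.Good l) (hm : D.Good m) (h : l <+: m)
    (h' : l.getLast? = m.getLast?) : l = m := by
  obtain ⟨n, rfl⟩ := h
  obtain rfl | hn := eq_or_ne n []
  · simp
  obtain ⟨n, x, rfl⟩ := exists_append_singleton hn
  obtain ⟨l, y, rfl⟩ := exists_append_singleton hl.1
  have hnd := hm.nodup
  rw [← List.append_assoc, List.getLast?_concat, List.getLast?_concat, Option.some.injEq] at h'
  subst h'
  simp [List.nodup_append] at hnd

/-- A nonzero path is determined by its first and its last arrow. -/
theorem Good.ext {l m : List E} (hl : D.Good l) (hm : D.Good m) (h : l.head? = m.head?)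
    (h' : l.getLast? = m.getLast?) : l = m := by
  obtain hp | hp := prefix_or_prefix_of_head?_eq hl.2 hm.2 h
  · exact hl.eq_of_prefix hm hp h'
  · exact (hm.eq_of_prefix hl hp h'.symm).symm

/-- The letters of a good word are distinct. Hence every word squares to zero in the algebra, which
is what makes automorphisms preserve the radical. -/
theorem not_good_append_self (l : List E) : ¬ D.Good (l ++ l) := by
  intro h
  have := h.nodup
  obtain _ | ⟨x, l⟩ := l
  · exact h.1 rfl
  · simp [List.nodup_append] at this

/-- The last letter `e` and the first letter `g` of a cycle `u` form a relation, since `u` squares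
to zero. If another cycle `u'` has the same first letter, then its last letter is also `e`, because
an arrow is in at most one relation on each side, and `Good.ext` applies. If `g' ≠ g`, then `e g'`
and `e' g` are not relations, so `u u' u` would be good although its letters repeat. -/
theorem IsCycle.unique {a : V} {u u' : List E} (h : D.IsCycle a u) (h' : D.IsCycle a u') :
    u = u' := by
  obtain ⟨hu, hs, he⟩ := h
  obtain ⟨hu', hs', he'⟩ := h'
  obtain ⟨g, m, rfl⟩ := List.exists_cons_of_ne_nil hu.1
  obtain ⟨g', m', rfl⟩ := List.exists_cons_of_ne_nil hu'.1
  obtain ⟨n, e, hn⟩ := exists_append_singleton hu.1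
  obtain ⟨n', e', hn'⟩ := exists_append_singleton hu'.1
  simp only [StartsAt, hn, hn'] at hs hs'
  simp only [EndsAt] at he he'
  simp at hs hs' he he'
  have h1 : ¬ D.ok e g := fun h => not_good_append_self (g :: m) <| by
    nth_rw 1 [hn]
    exact good_append_iff.2 ⟨hn ▸ hu, hu, h⟩
  have h2 : ¬ D.ok e' g' := fun h => not_good_append_self (g' :: m') <| by
    nth_rw 1 [hn']
    exact good_append_iff.2 ⟨hn' ▸ hu', hu', h⟩
  by_cases hg : g = g'
  · subst hg
    obtain rfl : e = e' := D.rel_left_unique (by rw [he, hs]) h1 (by rw [he, hs']) h2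
    exact hu.ext hu' rfl (by rw [hn, hn']; simp)
  · exfalso
    have h3 : D.ok e g' := by
      by_contra h
      exact hg (D.rel_right_unique (by rw [he, hs]) h1 (by rw [he', hs]) h)
    have h4 : D.ok e' g := by
      by_contra h
      exact hg (D.rel_right_unique (by rw [he, hs']) h (by rw [he', hs']) h2)
    have h5 : D.Good ((g :: m) ++ (g' :: m')) := by
      rw [hn]
      exact good_append_iff.2 ⟨hn ▸ hu, hu', h3⟩
    have h6 : D.Good ((g' :: m') ++ (g :: m)) := by
      rw [hn']
      exact good_append_iff.2 ⟨hn' ▸ hu', hu, h4⟩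
    have h7 := (h5.append_of_overlap h6 hu'.1).nodup
    simp [List.nodup_append] at h7

/-- At most two arrows end where `α` ends, and one of them is `α`; this fixes the first letter of a
detour. The last letter is fixed in the same way at the source, and the two letters determine the
word. -/
theorem IsDetour.unique {α : E} {l l' : List E} (h : D.IsDetour α l) (h' : D.IsDetour α l') :
    l = l' := by
  obtain ⟨hl, hs, he, hh, ht⟩ := h
  obtain ⟨hl', hs', he', hh', ht'⟩ := h'
  refine hl.ext hl' ?_ ?_
  · obtain ⟨g, m, rfl⟩ := List.exists_cons_of_ne_nil hl.1
    obtain ⟨g', m', rfl⟩ := List.exists_cons_of_ne_nil hl'.1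
    simp [EndsAt] at he he' hh hh'
    obtain h | h | h := D.in_le_two he.symm he'.symm
    · exact absurd h.symm hh
    · exact absurd h.symm hh'
    · simp [h]
  · obtain ⟨m, g, rfl⟩ := exists_append_singleton hl.1
    obtain ⟨m', g', rfl⟩ := exists_append_singleton hl'.1
    simp [StartsAt] at hs hs' ht ht'
    obtain h | h | h := D.out_le_two hs.symm hs'.symm
    · exact absurd h.symm ht
    · exact absurd h.symm ht'
    · simp [h]

/-- The nonzero paths parallel to an arrow. -/
theorem Good.parallel_cases {α : E} {l : List E} (h : D.Good l) (hs : D.StartsAt l (D.src α))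
    (he : D.EndsAt l (D.tgt α)) : l = [α] ∨ (∃ u, D.IsCycle (D.tgt α) u ∧ l = u ++ [α]) ∨
      (∃ v, D.IsCycle (D.src α) v ∧ l = α :: v) ∨ D.IsDetour α l := by
  by_cases hlast : l.getLast? = some α
  · obtain ⟨u, β, rfl⟩ := exists_append_singleton h.1
    obtain rfl : β = α := by simpa using hlast
    obtain rfl | hu := eq_or_ne u []
    · simp
    right; left
    refine ⟨u, ⟨h.left hu, ?_, ?_⟩, rfl⟩
    · obtain ⟨u, γ, rfl⟩ := exists_append_singleton hu
      have := D.tgt_eq_src (good_append_iff.1 h).2.2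
      simp [StartsAt, this]
    · obtain ⟨γ, u, rfl⟩ := List.exists_cons_of_ne_nil hu
      simpa [EndsAt] using he
  by_cases hhead : l.head? = some α
  · obtain ⟨β, v, rfl⟩ := List.exists_cons_of_ne_nil h.1
    obtain rfl : β = α := by simpa using hhead
    obtain rfl | hv := eq_or_ne v []
    · simp
    right; right; left
    refine ⟨v, ⟨h.right (l := [β]) hv, ?_, ?_⟩, rfl⟩
    · obtain ⟨v, γ, rfl⟩ := exists_append_singleton hv
      have : (β :: (v ++ [γ])).getLast? = some γ := by
        rw [← List.cons_append, List.getLast?_concat]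
      simpa [StartsAt, this] using hs
    · obtain ⟨γ, v, rfl⟩ := List.exists_cons_of_ne_nil hv
      have := D.tgt_eq_src (good_append_iff (l := []).1 h).2.2
      simp [EndsAt, this]
  exact Or.inr <| Or.inr <| Or.inr ⟨h, hs, he, hhead, hlast⟩

/-- Let `e` be the last letter of the detour; it starts where `α` starts. An arrow that composes
with `e` also composes with `α`, since `α` is in no relation. Uniqueness of continuations then gives
`e = α`, which a detour excludes. -/
theorem IsDetour.not_good_append {α : E} {l m : List E} (hα : D.Free α) (h : D.IsDetour α l)
    (hm : m ≠ []) : ¬ D.Good (l ++ m) := by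
  intro hg
  obtain ⟨hl, hs, -, -, ht⟩ := h
  obtain ⟨l, e, rfl⟩ := exists_append_singleton hl.1
  obtain ⟨β, m, rfl⟩ := List.exists_cons_of_ne_nil hm
  have hok := (good_append_iff.1 hg).2.2
  simp [StartsAt] at hs ht
  exact ht (D.ok_left_unique hok ((hα β).1 ((D.tgt_eq_src hok).trans hs)))

theorem IsDetour.not_good_prepend {α : E} {l m : List E} (hα : D.Free α) (h : D.IsDetour α l)
    (hm : m ≠ []) : ¬ D.Good (m ++ l) := by
  intro hg
  obtain ⟨hl, -, he, hh, -⟩ := h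
  obtain ⟨m, e, rfl⟩ := exists_append_singleton hm
  obtain ⟨β, l, rfl⟩ := List.exists_cons_of_ne_nil hl.1
  have hok := (good_append_iff.1 hg).2.2
  simp [EndsAt] at he hh
  exact hh (D.ok_right_unique hok ((hα e).2 (he.symm.trans (D.tgt_eq_src hok))))

/-- The letters of a good word are distinct, so `α` in the interior prevents `α` from being the
first or the last letter. -/
theorem IsCycle.isDetour {α : E} {u v : List E} (hu : D.IsCycle (D.tgt α) u)
    (hv : D.IsCycle (D.src α) v) (h : D.Good (u ++ α :: v)) : D.IsDetour α (u ++ α :: v) := by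
  have hnd := h.nodup
  obtain ⟨β, u', rfl⟩ := List.exists_cons_of_ne_nil hu.1.1
  obtain ⟨v', γ, rfl⟩ := exists_append_singleton hv.1.1
  have e : β :: u' ++ α :: (v' ++ [γ]) = (β :: u' ++ α :: v') ++ [γ] := by simp
  have hs := hv.2.1
  have he := hu.2.2
  simp only [StartsAt, EndsAt, List.getLast?_concat, List.head?_cons, Option.mem_def,
    Option.some.injEq, forall_eq'] at hs he
  refine ⟨h, ?_, ?_, ?_, ?_⟩
  · rw [e]
    simp only [StartsAt, List.getLast?_concat, Option.mem_def, Option.some.injEq, forall_eq']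
    exact hs
  · simpa [EndsAt] using he
  · rintro h'
    simp only [List.cons_append, List.head?_cons, Option.some.injEq] at h'
    subst h'
    simp at hnd
  · rw [e, List.getLast?_concat]
    rintro h'
    simp only [Option.some.injEq] at h'
    subst h'
    simp [List.nodup_append] at hnd

/-! ### Chosen cycles and detours -/

variable (D)

open Classical in
/-- The word of the nonzero path of positive length from `a` to `a`, and the empty word if there is
no such path. -/
def cycle (a : V) : List E := if h : ∃ l, D.IsCycle a l then h.choose else []

open Classical in
/-- The word of the nonzero path parallel to `α` that neither begins nor ends with `α`, and the
empty word if there is no such path. -/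
def detour (α : E) : List E := if h : ∃ l, D.IsDetour α l then h.choose else []

variable {D}

theorem IsCycle.eq_cycle {a : V} {l : List E} (h : D.IsCycle a l) : l = D.cycle a := by
  have h' : ∃ l, D.IsCycle a l := ⟨l, h⟩
  rw [cycle, dif_pos h']
  exact h.unique h'.choose_spec

theorem IsDetour.eq_detour {α : E} {l : List E} (h : D.IsDetour α l) : l = D.detour α := by
  have h' : ∃ l, D.IsDetour α l := ⟨l, h⟩
  rw [detour, dif_pos h']
  exact h.unique h'.choose_spec

theorem isCycle_cycle {a : V} (h : D.cycle a ≠ []) : D.IsCycle a (D.cycle a) := by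
  by_cases h' : ∃ l, D.IsCycle a l
  · rw [cycle, dif_pos h']
    exact h'.choose_spec
  · rw [cycle, dif_neg h'] at h
    exact absurd rfl h

theorem isDetour_detour {α : E} (h : D.detour α ≠ []) : D.IsDetour α (D.detour α) := by
  by_cases h' : ∃ l, D.IsDetour α l
  · rw [detour, dif_pos h']
    exact h'.choose_spec
  · rw [detour, dif_neg h'] at h
    exact absurd rfl h

theorem finite_good [Finite E] : Finite {l : List E // D.Good l} := by
  obtain ⟨L, hL⟩ := D.bounded
  exact ((List.finite_length_le E L).subset fun l hl => hL l hl.2).to_subtype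

/-! ### Spanning trees -/

/-- The coboundary of a function on the vertices. -/
def coboundary {k : Type*} [Field k] (D : GentleDatum V E) (x : V → kˣ) (α : E) : kˣ :=
  x (D.tgt α) / x (D.src α)

/-- The tree grows by one arrow crossing the boundary of `W`, which exists by connectedness. The
value of `s` at the new vertex is then solved from the normalization of the new arrow, and it is
again a Laurent monomial in the arrow coefficients. The last clause, on functions constant along the
tree, serves the uniqueness of normal forms. -/
theorem exists_partial_spanningTree (k : Type*) [Field k] [Fintype V] [Nonempty V] (n : ℕ)
    (hn : n + 1 ≤ Fintype.card V) :
    ∃ (W : Finset V) (T : Finset E) (s : V → (E → kˣ) → kˣ), W.card = n + 1 ∧ T.card = n ∧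
      (∀ a, s a ∈ laurentMonomials k E) ∧
      (∀ α ∈ T, D.src α ∈ W ∧ D.tgt α ∈ W ∧ ∀ t, t α * D.coboundary (fun a => s a t) α = 1) ∧
      ∀ x : V → kˣ, (∀ α ∈ T, x (D.tgt α) = x (D.src α)) → ∀ a ∈ W, ∀ b ∈ W, x a = x b := by
  classical
  induction n with
  | zero =>
    obtain ⟨a⟩ := ‹Nonempty V›
    refine ⟨{a}, ∅, fun _ => 1, by simp, by simp, fun _ => one_mem _, by simp, ?_⟩
    simp
  | succ n ih =>
    obtain ⟨W, T, s, hW, hT, hs, hα, hx⟩ := ih (by omega)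
    have hne : (W : Set V) ≠ Set.univ := by
      intro h
      have := Finset.coe_eq_univ.1 h
      rw [this, Finset.card_univ] at hW
      omega
    have hcross : ∃ α, ¬ (D.src α ∈ W ↔ D.tgt α ∈ W) := by
      by_contra! h
      refine hne (D.connected W ?_ h)
      exact Finset.coe_nonempty.2 (Finset.card_pos.1 (by omega))
    obtain ⟨α, hcross⟩ := hcross
    have hαT : α ∉ T := fun h => hcross ⟨fun _ => (hα α h).2.1, fun _ => (hα α h).1⟩
    have hc := coord_mem_laurentMonomials (k := k) α
    -- The old end of the new arrow is `c`, the new one `d`; its two orientations give `μ = s c / t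
    -- α` and `μ = s c * t α`.
    obtain ⟨c, d, hcW, hdW, μ, hμ, hcd, hxcd⟩ : ∃ c d, c ∈ W ∧ d ∉ W ∧ ∃ μ ∈ laurentMonomials k E,
        ((D.src α = c ∧ D.tgt α = d ∧ ∀ t, t α * (μ t / s c t) = 1) ∨
          (D.tgt α = c ∧ D.src α = d ∧ ∀ t, t α * (s c t / μ t) = 1)) ∧
        ∀ x : V → kˣ, x (D.tgt α) = x (D.src α) → x c = x d := by
      by_cases h : D.src α ∈ W
      · have h' : D.tgt α ∉ W := fun h' => hcross ⟨fun _ => h', fun _ => h⟩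
        refine ⟨_, _, h, h', s (D.src α) * (fun t => t α)⁻¹, mul_mem (hs _) (inv_mem hc),
          Or.inl ⟨rfl, rfl, fun t => ?_⟩, fun x hx => hx.symm⟩
        simp
      · have h' : D.tgt α ∈ W := by
          by_contra h'
          exact hcross ⟨fun h'' => absurd h'' h, fun h'' => absurd h'' h'⟩
        refine ⟨_, _, h', h, s (D.tgt α) * (fun t => t α), mul_mem (hs _) hc,
          Or.inr ⟨rfl, rfl, fun t => ?_⟩, fun x hx => hx⟩
        simp
    have hcd' : c ≠ d := fun h => hdW (h ▸ hcW)
    refine ⟨insert d W, insert α T, Function.update s d μ, ?_, ?_, ?_, ?_, ?_⟩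
    · rw [Finset.card_insert_of_notMem hdW, hW]
    · rw [Finset.card_insert_of_notMem hαT, hT]
    · intro a
      by_cases h : a = d
      · subst h
        simpa using hμ
      · simpa [h] using hs a
    · intro β hβ
      obtain rfl | hβ := Finset.mem_insert.1 hβ
      · obtain ⟨rfl, rfl, h⟩ | ⟨rfl, rfl, h⟩ := hcd
        · exact ⟨by simp [hcW], by simp, by simpa [coboundary, hcd'] using h⟩
        · exact ⟨by simp, by simp [hcW], by simpa [coboundary, hcd'] using h⟩
      · obtain ⟨h1, h2, h3⟩ := hα β hβ
        refine ⟨by simp [h1], by simp [h2], ?_⟩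
        have h4 : D.src β ≠ d := fun h => hdW (h ▸ h1)
        have h5 : D.tgt β ≠ d := fun h => hdW (h ▸ h2)
        simpa [coboundary, h4, h5] using h3
    · intro x hx'
      have h1 := hx x fun β hβ => hx' β (Finset.mem_insert_of_mem hβ)
      have h2 := hxcd x (hx' α (Finset.mem_insert_self _ _))
      have h3 : ∀ a ∈ insert d W, x a = x c := by
        intro a ha
        obtain rfl | ha := Finset.mem_insert.1 ha
        · exact h2.symm
        · exact h1 a ha c hcW
      intro a ha b hb
      rw [h3 a ha, h3 b hb]

/-- A spanning tree `T`, and functions `s` on the vertices by which any function on the arrows can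
be normalized to be trivial on `T`. -/
theorem exists_spanningTree (k : Type*) [Field k] [Fintype V] [Nonempty V] :
    ∃ (T : Finset E) (s : V → (E → kˣ) → kˣ), T.card + 1 = Fintype.card V ∧
      (∀ a, s a ∈ laurentMonomials k E) ∧
      (∀ α ∈ T, ∀ t, t α * D.coboundary (fun a => s a t) α = 1) ∧
      ∀ x : V → kˣ, (∀ α ∈ T, x (D.tgt α) = x (D.src α)) → ∀ a b, x a = x b := by
  have hpos := Fintype.card_pos (α := V)
  obtain ⟨W, T, s, hW, hT, hs, hα, hx⟩ :=
    exists_partial_spanningTree (D := D) k (Fintype.card V - 1) (by omega)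
  have hWu : W = Finset.univ := (Finset.card_eq_iff_eq_univ W).1 (by omega)
  subst hWu
  exact ⟨T, s, by omega, hs, fun α h => (hα α h).2.2, fun x h a b =>
    hx x h a (Finset.mem_univ a) b (Finset.mem_univ b)⟩

/-! ### Products along paths -/

/-- The product of a function along a path. -/
def along {G : Type*} [Monoid G] (t : E → G) (l : List E) : G := (l.map t).prod

/-- The product telescopes. Coboundaries therefore take the same value on an arrow and on its
detour. -/
theorem along_coboundary {k : Type*} [Field k] (x : V → kˣ) {l : List E} (h : D.Good l) {a b : V}
    (hs : D.StartsAt l a) (he : D.EndsAt l b) : along (D.coboundary x) l = x b / x a := by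
  induction l generalizing b with
  | nil => exact absurd rfl h.1
  | cons β l ih =>
    have hb : D.tgt β = b := by simpa [EndsAt] using he
    obtain rfl | hl := eq_or_ne l []
    · have ha : D.src β = a := by simpa [StartsAt] using hs
      simp [along, coboundary, ha, hb]
    · have hl' : D.Good l := h.right (l := [β]) hl
      have := ih hl' (b := D.src β) ?_ ?_
      · simp only [along, List.map_cons, List.prod_cons] at this ⊢
        rw [this, coboundary, hb]
        simp
      · obtain ⟨l, γ, rfl⟩ := exists_append_singleton hl
        rw [StartsAt, ← List.cons_append, List.getLast?_concat] at hs
        rwa [StartsAt, List.getLast?_concat]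
      · obtain ⟨γ, l, rfl⟩ := List.exists_cons_of_ne_nil hl
        have := D.tgt_eq_src (good_append_iff (l := []).1 h).2.2
        simpa [EndsAt] using this

end GentleDatum

/-! ## Algebras with a basis of paths -/

/-- A basis of the algebra `A` that consists of the vertices and the good words of the gentle
datum `D`, multiplied as paths. -/
structure PathBasis {V E : Type*} [Fintype V] (D : GentleDatum V E) (k A : Type*) [Field k] [Ring A]
    [Algebra k A] where
  /-- The basis. -/
  basis : Module.Basis (V ⊕ {l : List E // D.Good l}) k A
  sum_vertices : ∑ a, basis (Sum.inl a) = 1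
  vertex_mul_self : ∀ a, basis (Sum.inl a) * basis (Sum.inl a) = basis (Sum.inl a)
  vertex_mul_of_ne : ∀ a b, a ≠ b → basis (Sum.inl a) * basis (Sum.inl b) = 0
  word_mul_word_of_good : ∀ l m (h : D.Good (l.1 ++ m.1)),
    basis (Sum.inr l) * basis (Sum.inr m) = basis (Sum.inr ⟨l.1 ++ m.1, h⟩)
  word_mul_word_of_not_good : ∀ l m, ¬ D.Good (l.1 ++ m.1) →
    basis (Sum.inr l) * basis (Sum.inr m) = 0
  vertex_mul_word : ∀ a l, D.EndsAt l.1 a →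
    basis (Sum.inl a) * basis (Sum.inr l) = basis (Sum.inr l)
  vertex_mul_word_of_not : ∀ a l, ¬ D.EndsAt l.1 a → basis (Sum.inl a) * basis (Sum.inr l) = 0
  word_mul_vertex : ∀ a l, D.StartsAt l.1 a →
    basis (Sum.inr l) * basis (Sum.inl a) = basis (Sum.inr l)
  word_mul_vertex_of_not : ∀ a l, ¬ D.StartsAt l.1 a → basis (Sum.inr l) * basis (Sum.inl a) = 0

namespace PathBasis

open GentleDatum

variable {V E : Type*} [Fintype V] {D : GentleDatum V E} {k A : Type*} [Field k] [Ring A]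
  [Algebra k A] (B : PathBasis D k A)

/-- The idempotent of a vertex. -/
def ev (a : V) : A := B.basis (Sum.inl a)

open Classical in
/-- The element given by a word, which is zero if the word is not good. -/
def wd (l : List E) : A := if h : D.Good l then B.basis (Sum.inr ⟨l, h⟩) else 0

/-- The coefficient of a vertex. -/
def vcf (a : V) : A →ₗ[k] k := B.basis.coord (Sum.inl a)

open Classical in
/-- The coefficient of a word. -/
def cf (l : List E) : A →ₗ[k] k := if h : D.Good l then B.basis.coord (Sum.inr ⟨l, h⟩) else 0

/-- The elements in the span of the paths of positive length. -/
def Rad (x : A) : Prop := ∀ a, B.vcf a x = 0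

theorem sum_ev : ∑ a, B.ev a = 1 := B.sum_vertices

theorem wd_of_good {l : List E} (h : D.Good l) : B.wd l = B.basis (Sum.inr ⟨l, h⟩) := dif_pos h

theorem wd_of_not_good {l : List E} (h : ¬ D.Good l) : B.wd l = 0 := dif_neg h

@[simp] theorem wd_nil : B.wd [] = 0 := B.wd_of_not_good fun h => h.1 rfl

theorem good_of_wd_ne_zero {l : List E} (h : B.wd l ≠ 0) : D.Good l := by
  by_contra h'
  exact h (B.wd_of_not_good h')

@[simp] theorem ev_mul_self (a : V) : B.ev a * B.ev a = B.ev a := B.vertex_mul_self a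

theorem ev_mul_of_ne {a b : V} (h : a ≠ b) : B.ev a * B.ev b = 0 := B.vertex_mul_of_ne a b h

theorem wd_mul {l m : List E} (hl : l ≠ []) (hm : m ≠ []) : B.wd l * B.wd m = B.wd (l ++ m) := by
  by_cases h : D.Good (l ++ m)
  · rw [B.wd_of_good h, B.wd_of_good (h.left hl), B.wd_of_good (h.right hm),
      B.word_mul_word_of_good _ _ h]
  · rw [B.wd_of_not_good h]
    by_cases h1 : D.Good l
    · by_cases h2 : D.Good m
      · rw [B.wd_of_good h1, B.wd_of_good h2, B.word_mul_word_of_not_good _ _ h]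
      · rw [B.wd_of_not_good h2, mul_zero]
    · rw [B.wd_of_not_good h1, zero_mul]

theorem ev_mul_wd {a : V} {l : List E} (h : D.EndsAt l a) : B.ev a * B.wd l = B.wd l := by
  by_cases hl : D.Good l
  · rw [B.wd_of_good hl]
    exact B.vertex_mul_word a ⟨l, hl⟩ h
  · rw [B.wd_of_not_good hl, mul_zero]

theorem ev_mul_wd_of_not {a : V} {l : List E} (h : ¬ D.EndsAt l a) : B.ev a * B.wd l = 0 := by
  by_cases hl : D.Good l
  · rw [B.wd_of_good hl]
    exact B.vertex_mul_word_of_not a ⟨l, hl⟩ h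
  · rw [B.wd_of_not_good hl, mul_zero]

theorem wd_mul_ev {a : V} {l : List E} (h : D.StartsAt l a) : B.wd l * B.ev a = B.wd l := by
  by_cases hl : D.Good l
  · rw [B.wd_of_good hl]
    exact B.word_mul_vertex a ⟨l, hl⟩ h
  · rw [B.wd_of_not_good hl, zero_mul]

theorem wd_mul_ev_of_not {a : V} {l : List E} (h : ¬ D.StartsAt l a) : B.wd l * B.ev a = 0 := by
  by_cases hl : D.Good l
  · rw [B.wd_of_good hl]
    exact B.word_mul_vertex_of_not a ⟨l, hl⟩ h
  · rw [B.wd_of_not_good hl, zero_mul]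

@[simp] theorem vcf_ev_self (a : V) : B.vcf a (B.ev a) = 1 := by simp [vcf, ev]

theorem vcf_ev_of_ne {a b : V} (h : a ≠ b) : B.vcf a (B.ev b) = 0 := by
  simp [vcf, ev, h.symm]

@[simp] theorem vcf_wd (a : V) (l : List E) : B.vcf a (B.wd l) = 0 := by
  unfold wd
  split_ifs <;> simp [vcf]

theorem rad_wd (l : List E) : B.Rad (B.wd l) := fun a => B.vcf_wd a l

@[simp] theorem cf_ev (a : V) (l : List E) : B.cf l (B.ev a) = 0 := by
  unfold cf
  split_ifs <;> simp [ev]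

theorem cf_wd_self {l : List E} (h : D.Good l) : B.cf l (B.wd l) = 1 := by
  simp [cf, wd, h]

theorem cf_wd_of_ne {l m : List E} (h : l ≠ m) : B.cf l (B.wd m) = 0 := by
  unfold cf wd
  split_ifs <;> simp [h.symm]

theorem induction {p : A → Prop} (zero : p 0) (add : ∀ x y, p x → p y → p (x + y))
    (smul : ∀ (c : k) x, p x → p (c • x)) (vertex : ∀ a, p (B.ev a))
    (word : ∀ l, D.Good l → p (B.wd l)) (x : A) : p x := by
  have h := B.basis.mem_span x
  induction h using Submodule.span_induction with
  | mem x hx =>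
    obtain ⟨i, rfl⟩ := hx
    obtain a | l := i
    · exact vertex a
    · rw [← B.wd_of_good l.2]
      exact word l.1 l.2
  | zero => exact zero
  | add x y _ _ hx hy => exact add x y hx hy
  | smul c x _ hx => exact smul c x hx

theorem hom_ext {M : Type*} [AddCommMonoid M] [Module k M] {f g : A →ₗ[k] M}
    (vertex : ∀ a, f (B.ev a) = g (B.ev a)) (word : ∀ l, D.Good l → f (B.wd l) = g (B.wd l)) :
    f = g := by
  refine B.basis.ext ?_
  rintro (a | l)
  · exact vertex a
  · rw [← B.wd_of_good l.2]
    exact word l.1 l.2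

theorem ext_cf {x y : A} (h : ∀ a, B.vcf a x = B.vcf a y)
    (h' : ∀ l, D.Good l → B.cf l x = B.cf l y) : x = y := by
  refine B.basis.ext_elem ?_
  rintro (a | l)
  · exact h a
  · have := h' l.1 l.2
    simpa [cf, l.2] using this

theorem eq_sum_of_rad [Fintype {l : List E // D.Good l}] {x : A} (h : B.Rad x) :
    x = ∑ l : {l : List E // D.Good l}, B.cf l.1 x • B.wd l.1 := by
  refine B.ext_cf (fun a => by simp [h a]) fun l hl => ?_
  rw [map_sum, Finset.sum_eq_single ⟨l, hl⟩]
  · simp [B.cf_wd_self hl]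
  · intro m _ hm
    rw [map_smul, B.cf_wd_of_ne, smul_zero]
    rintro rfl
    exact hm rfl
  · simp

/-! ### Coefficients of products -/

-- The words span an ideal and the vertices are orthogonal idempotents, so each vertex coefficient
-- is a character of the algebra.
@[simp] theorem vcf_mul (a : V) (x y : A) : B.vcf a (x * y) = B.vcf a x * B.vcf a y := by
  induction x using B.induction with
  | zero => simp
  | add x x' h h' => simp only [add_mul, map_add, h, h']
  | smul c x h => simp only [smul_mul_assoc, map_smul, h, smul_eq_mul, mul_assoc]
  | vertex b =>
    induction y using B.induction with
    | zero => simp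
    | add x x' h h' => simp only [mul_add, map_add, h, h']
    | smul c x h => simp only [mul_smul_comm, map_smul, h, smul_eq_mul]; ring
    | vertex c =>
      by_cases hbc : b = c
      · subst hbc
        by_cases hab : a = b
        · subst hab; simp
        · simp [B.vcf_ev_of_ne hab]
      · rw [B.ev_mul_of_ne hbc]
        by_cases hab : a = b
        · subst hab; simp [B.vcf_ev_of_ne hbc]
        · simp [B.vcf_ev_of_ne hab]
    | word l hl =>
      by_cases h : D.EndsAt l b
      · simp [B.ev_mul_wd h]
      · simp [B.ev_mul_wd_of_not h]
  | word l hl =>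
    induction y using B.induction with
    | zero => simp
    | add x x' h h' => simp only [mul_add, map_add, h, h']
    | smul c x h => simp only [mul_smul_comm, map_smul, h, smul_eq_mul]; ring
    | vertex b =>
      by_cases h : D.StartsAt l b
      · simp [B.wd_mul_ev h]
      · simp [B.wd_mul_ev_of_not h]
    | word m hm => simp [B.wd_mul hl.1 hm.1]

@[simp] theorem vcf_one (a : V) : B.vcf a 1 = 1 := by
  rw [← B.sum_ev, map_sum, Finset.sum_eq_single a]
  · simp
  · exact fun b _ hb => B.vcf_ev_of_ne hb.symm
  · simp

/-- Multiplication by a word lengthens `l`, so only the vertex part of `y` can return `l` itself. -/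
theorem cf_wd_mul {l : List E} (hl : D.Good l) {a : V} (ha : D.StartsAt l a) (y : A) :
    B.cf l (B.wd l * y) = B.vcf a y := by
  induction y using B.induction with
  | zero => simp
  | add x x' h h' => simp only [mul_add, map_add, h, h']
  | smul c x h => simp only [mul_smul_comm, map_smul, h]
  | vertex b =>
    by_cases hab : a = b
    · subst hab
      simp [B.wd_mul_ev ha, B.cf_wd_self hl]
    · rw [B.wd_mul_ev_of_not, map_zero, B.vcf_ev_of_ne hab]
      intro hb
      obtain ⟨m, β, rfl⟩ := exists_append_singleton hl.1
      simp only [StartsAt, List.getLast?_concat, Option.mem_def, Option.some.injEq,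
        forall_eq'] at ha hb
      exact hab (ha.symm.trans hb)
  | word m hm =>
    rw [B.wd_mul hl.1 hm.1, B.cf_wd_of_ne, vcf_wd]
    simpa using hm.1

theorem cf_mul_wd {l : List E} (hl : D.Good l) {a : V} (ha : D.EndsAt l a) (y : A) :
    B.cf l (y * B.wd l) = B.vcf a y := by
  induction y using B.induction with
  | zero => simp
  | add x x' h h' => simp only [add_mul, map_add, h, h']
  | smul c x h => simp only [smul_mul_assoc, map_smul, h]
  | vertex b =>
    by_cases hab : a = b
    · subst hab
      simp [B.ev_mul_wd ha, B.cf_wd_self hl]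
    · rw [B.ev_mul_wd_of_not, map_zero, B.vcf_ev_of_ne hab]
      intro hb
      obtain ⟨β, m, rfl⟩ := List.exists_cons_of_ne_nil hl.1
      simp only [EndsAt, List.head?_cons, Option.mem_def, Option.some.injEq,
        forall_eq'] at ha hb
      exact hab (ha.symm.trans hb)
  | word m hm =>
    rw [B.wd_mul hm.1 hl.1, B.cf_wd_of_ne, vcf_wd]
    simpa using hm.1

theorem cf_wd_mul_of_not_prefix {l m : List E} (h : ¬ m <+: l) (y : A) :
    B.cf l (B.wd m * y) = 0 := by
  induction y using B.induction with
  | zero => simp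
  | add x x' h h' => simp only [mul_add, map_add, h, h', add_zero]
  | smul c x h => simp only [mul_smul_comm, map_smul, h, smul_zero]
  | vertex b =>
    by_cases hb : D.StartsAt m b
    · rw [B.wd_mul_ev hb, B.cf_wd_of_ne]
      rintro rfl
      exact h List.prefix_rfl
    · rw [B.wd_mul_ev_of_not hb, map_zero]
  | word n hn =>
    obtain rfl | hm := eq_or_ne m []
    · simp
    rw [B.wd_mul hm hn.1, B.cf_wd_of_ne]
    rintro rfl
    exact h (List.prefix_append m n)

theorem cf_mul_wd_of_not_suffix {l m : List E} (h : ¬ m <:+ l) (y : A) :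
    B.cf l (y * B.wd m) = 0 := by
  induction y using B.induction with
  | zero => simp
  | add x x' h h' => simp only [add_mul, map_add, h, h', add_zero]
  | smul c x h => simp only [smul_mul_assoc, map_smul, h, smul_zero]
  | vertex b =>
    by_cases hb : D.EndsAt m b
    · rw [B.ev_mul_wd hb, B.cf_wd_of_ne]
      rintro rfl
      exact h List.suffix_rfl
    · rw [B.ev_mul_wd_of_not hb, map_zero]
  | word n hn =>
    obtain rfl | hm := eq_or_ne m []
    · simp
    rw [B.wd_mul hn.1 hm, B.cf_wd_of_ne]
    rintro rfl
    exact h (List.suffix_append n m)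

/-- A one-letter word factors only with a vertex on one side; its coefficient is thus a derivation
with respect to the characters of the two end points. -/
theorem cf_singleton_mul (α : E) (x y : A) : B.cf [α] (x * y) =
    B.vcf (D.tgt α) x * B.cf [α] y + B.cf [α] x * B.vcf (D.src α) y := by
  have hs : D.StartsAt [α] (D.src α) := by simp [StartsAt]
  have he : D.EndsAt [α] (D.tgt α) := by simp [EndsAt]
  induction y using B.induction with
  | zero => simp
  | add y y' h h' => simp only [mul_add, map_add, h, h']; ring
  | smul c y h => simp only [mul_smul_comm, map_smul, h, smul_eq_mul]; ring
  | vertex b =>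
    induction x using B.induction with
    | zero => simp
    | add x x' h h' => simp only [add_mul, map_add, h, h']; ring
    | smul c x h => simp only [smul_mul_assoc, map_smul, h, smul_eq_mul]; ring
    | vertex a =>
      by_cases hab : a = b
      · subst hab; simp
      · simp [B.ev_mul_of_ne hab]
    | word l hl =>
      by_cases h : l = [α]
      · subst h
        by_cases hb : D.StartsAt [α] b
        · have hb' : D.src α = b := by simpa [StartsAt] using hb
          subst hb'
          simp [B.wd_mul_ev hb]
        · have hb' : D.src α ≠ b := by simpa [StartsAt] using hb
          simp [B.wd_mul_ev_of_not hb, B.vcf_ev_of_ne hb']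
      · by_cases hb : D.StartsAt l b
        · simp [B.wd_mul_ev hb, B.cf_wd_of_ne (Ne.symm h)]
        · simp [B.wd_mul_ev_of_not hb, B.cf_wd_of_ne (Ne.symm h)]
  | word l hl =>
    by_cases h : l = [α]
    · subst h
      rw [B.cf_mul_wd hl he, B.cf_wd_self hl]
      simp
    · rw [B.cf_mul_wd_of_not_suffix, B.cf_wd_of_ne (Ne.symm h), vcf_wd]
      · simp
      · intro h'
        obtain rfl | h'' := List.suffix_cons_iff.1 h'
        · exact h rfl
        · exact hl.1 (List.suffix_nil.1 h'')

theorem cf_singleton_mul_of_rad {α : E} {x y : A} (hx : B.Rad x) (hy : B.Rad y) :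
    B.cf [α] (x * y) = 0 := by
  simp [cf_singleton_mul, hx _, hy _]

/-- A two-letter word splits into two words only at the middle. This translates a vanishing product
into equations between arrow coefficients. -/
theorem cf_pair_mul_of_rad [Finite E] {β α : E} (h : D.ok β α) {x y : A} (hx : B.Rad x)
    (hy : B.Rad y) :
    B.cf [β, α] (x * y) = B.cf [β] x * B.cf [α] y := by
  classical
  have := D.finite_good
  have := Fintype.ofFinite {l : List E // D.Good l}
  have hg : D.Good ([β] ++ [α]) := ⟨by simp, by simpa using h⟩
  have e1 : ∀ l m : List E, D.Good l → D.Good m → B.cf [β, α] (B.wd l * B.wd m) =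
      B.cf [β] (B.wd l) * B.cf [α] (B.wd m) := by
    intro l m hl hm
    rw [B.wd_mul hl.1 hm.1]
    by_cases h1 : l = [β]
    · by_cases h2 : m = [α]
      · subst h1 h2
        rw [B.cf_wd_self (Good.singleton β), B.cf_wd_self (Good.singleton α), mul_one]
        exact B.cf_wd_self hg
      · rw [B.cf_wd_of_ne (Ne.symm h2), B.cf_wd_of_ne, mul_zero]
        rintro h3
        subst h1
        exact h2 (by simpa using h3.symm)
    · rw [B.cf_wd_of_ne (Ne.symm h1), B.cf_wd_of_ne, zero_mul]
      rintro h3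
      obtain ⟨c, l, rfl⟩ := List.exists_cons_of_ne_nil hl.1
      obtain ⟨d, m, rfl⟩ := List.exists_cons_of_ne_nil hm.1
      cases l <;> simp_all
  conv_lhs => rw [B.eq_sum_of_rad hx, B.eq_sum_of_rad hy]
  conv_rhs => rw [B.eq_sum_of_rad hx, B.eq_sum_of_rad hy]
  simp only [Finset.sum_mul_sum, map_sum, smul_mul_smul_comm, map_smul, smul_eq_mul]
  refine Finset.sum_congr rfl fun l _ => Finset.sum_congr rfl fun m _ => ?_
  rw [e1 _ _ l.2 m.2]
  ring

/-! ### Nilpotency of the radical -/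

/-- The radical is filtered by the length of words, and good words have bounded length. One exponent
serves all elements; later this keeps a geometric series a fixed polynomial. -/
theorem exists_pow_eq_zero_of_rad [Finite E] : ∃ L : ℕ, ∀ x : A, B.Rad x → x ^ L = 0 := by
  have := D.finite_good
  have := Fintype.ofFinite {l : List E // D.Good l}
  obtain ⟨L, hL⟩ := D.bounded
  let F (n : ℕ) : Submodule k A := Submodule.span k {x | ∃ l, n ≤ l.length ∧ B.wd l = x}
  have hF1 : ∀ x, B.Rad x → x ∈ F 1 := by
    intro x hx
    rw [B.eq_sum_of_rad hx]
    refine Submodule.sum_mem _ fun l _ => Submodule.smul_mem _ _ (Submodule.subset_span ?_)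
    exact ⟨l.1, List.length_pos_iff.2 l.2.1, rfl⟩
  have hmul : ∀ n, F (n + 1) * F 1 ≤ F (n + 1 + 1) := by
    intro n
    rw [Submodule.span_mul_span]
    refine Submodule.span_le.2 ?_
    rintro _ ⟨_, ⟨l, hl, rfl⟩, _, ⟨m, hm, rfl⟩, rfl⟩
    refine Submodule.subset_span ⟨l ++ m, by simp; omega, ?_⟩
    exact (B.wd_mul (by rintro rfl; simp at hl) (by rintro rfl; simp at hm)).symm
  refine ⟨L + 1, fun x hx => ?_⟩
  have hpow : ∀ n, x ^ (n + 1) ∈ F (n + 1) := by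
    intro n
    induction n with
    | zero => simpa using hF1 x hx
    | succ n ih =>
      rw [pow_succ]
      exact hmul n (Submodule.mul_mem_mul ih (hF1 x hx))
  have hbot : F (L + 1) = ⊥ := by
    refine Submodule.span_eq_bot.2 ?_
    rintro _ ⟨l, hl, rfl⟩
    refine B.wd_of_not_good fun h => ?_
    have := hL l h.2
    omega
  simpa [hbot] using hpow L

end PathBasis

/-! ## The automorphisms given by detours -/

namespace GentleDatum

variable {V E : Type*} (D : GentleDatum V E)

/-- The arrows that can be deformed: those outside of all relations that have a detour. -/
def Movable (α : E) : Prop := D.Free α ∧ D.detour α ≠ []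

variable {D}

theorem startsAt_singleton (α : E) : D.StartsAt [α] (D.src α) := by simp [StartsAt]

theorem endsAt_singleton (α : E) : D.EndsAt [α] (D.tgt α) := by simp [EndsAt]

theorem startsAt_append {l m : List E} (hm : m ≠ []) {a : V} :
    D.StartsAt (l ++ m) a ↔ D.StartsAt m a := by
  obtain ⟨m, β, rfl⟩ := exists_append_singleton hm
  rw [← List.append_assoc, StartsAt, StartsAt, List.getLast?_concat, List.getLast?_concat]

theorem endsAt_unique {l : List E} (hl : l ≠ []) {a b : V} (h : D.EndsAt l a) (h' : D.EndsAt l b) :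
    a = b := by
  obtain ⟨β, l, rfl⟩ := List.exists_cons_of_ne_nil hl
  simp only [EndsAt, List.head?_cons, Option.mem_def, Option.some.injEq, forall_eq'] at h h'
  exact h.symm.trans h'

theorem startsAt_unique {l : List E} (hl : l ≠ []) {a b : V} (h : D.StartsAt l a)
    (h' : D.StartsAt l b) : a = b := by
  obtain ⟨l, β, rfl⟩ := exists_append_singleton hl
  simp only [StartsAt, List.getLast?_concat, Option.mem_def, Option.some.injEq, forall_eq'] at h h'
  exact h.symm.trans h'

theorem Movable.isDetour {α : E} (h : D.Movable α) : D.IsDetour α (D.detour α) :=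
  isDetour_detour h.2

theorem Movable.good {α : E} (h : D.Movable α) : D.Good (D.detour α) := h.isDetour.1

theorem Movable.detour_ne_singleton {α : E} (h : D.Movable α) : D.detour α ≠ [α] := by
  intro h'
  have := h.isDetour.2.2.2.1
  rw [h'] at this
  exact this rfl

/-- The detour of a movable arrow does not consist of a single movable arrow. -/
theorem Movable.detour_ne_movable {α β : E} (h : D.Movable α) (hβ : D.Movable β) :
    D.detour α ≠ [β] := by
  intro h'
  have hd := h.isDetour
  rw [h'] at hd
  have h1 : D.src β = D.src α := startsAt_unique (by simp) (startsAt_singleton β) hd.2.1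
  have h2 : D.tgt β = D.tgt α := endsAt_unique (by simp) (endsAt_singleton β) hd.2.2.1
  have := D.parallel_free h1.symm h2.symm h.1 hβ.1
  subst this
  exact hd.2.2.2.1 rfl

@[simp] theorem along_append {G : Type*} [Monoid G] (t : E → G) (l m : List E) :
    along t (l ++ m) = along t l * along t m := by
  simp [along]

@[simp] theorem along_singleton {G : Type*} [Monoid G] (t : E → G) (α : E) :
    along t [α] = t α := by
  simp [along]

@[simp] theorem along_mul {G : Type*} [CommMonoid G] (t t' : E → G) (l : List E) :
    along (t * t') l = along t l * along t' l :=
  List.prod_map_mul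

@[simp] theorem along_one {G : Type*} [CommMonoid G] (l : List E) :
    along (1 : E → G) l = 1 :=
  List.prod_map_one

end GentleDatum

/-! ### Deformations of arrows along their detours -/

namespace PathBasis

open GentleDatum

variable {V E : Type*} [Fintype V] {D : GentleDatum V E} {k A : Type*} [Field k] [Ring A]
  [Algebra k A] (B : PathBasis D k A)

/-- Homomorphisms are determined by the vertices and the arrows. -/
theorem algHom_ext {M : Type*} [Ring M] [Algebra k M] {f g : A →ₐ[k] M}
    (hv : ∀ a, f (B.ev a) = g (B.ev a)) (ha : ∀ α, f (B.wd [α]) = g (B.wd [α])) : f = g := by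
  have h : f.toLinearMap = g.toLinearMap := by
    refine B.hom_ext hv fun l hl => ?_
    change f (B.wd l) = g (B.wd l)
    clear hl
    induction l with
    | nil => simp
    | cons α l ih =>
      obtain rfl | hl := eq_or_ne l []
      · exact ha α
      · have := B.wd_mul (l := [α]) (by simp) hl
        simp only [List.singleton_append] at this
        rw [← this, map_mul, map_mul, ih, ha]
  exact AlgHom.toLinearMap_injective h

open Classical in
/-- The multiple of the detour that is added to a word: nonzero only for movable arrows. -/
def detourTerm (n : E → k) : List E → A
  | [α] => if D.Movable α then n α • B.wd (D.detour α) else 0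
  | _ => 0

theorem detourTerm_of_movable (n : E → k) {α : E} (h : D.Movable α) :
    B.detourTerm n [α] = n α • B.wd (D.detour α) := if_pos h

theorem detourTerm_of_not_movable (n : E → k) {α : E} (h : ¬ D.Movable α) :
    B.detourTerm n [α] = 0 := if_neg h

theorem detourTerm_cases {p : List E → A → Prop} (n : E → k)
    (hm : ∀ α, D.Movable α → p [α] (n α • B.wd (D.detour α))) (h0 : ∀ l, p l 0) (l : List E) :
    p l (B.detourTerm n l) := by
  unfold detourTerm
  split
  · split_ifs with h
    · exact hm _ h
    · exact h0 _
  · exact h0 _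

theorem detourTerm_append (n : E → k) {l m : List E} (hl : l ≠ []) (hm : m ≠ []) :
    B.detourTerm n (l ++ m) = 0 := by
  obtain ⟨β, l, rfl⟩ := List.exists_cons_of_ne_nil hl
  obtain ⟨γ, m, rfl⟩ := List.exists_cons_of_ne_nil hm
  cases l <;> rfl

/-- Only arrows outside all relations are deformed, and their detours cannot be prolonged. -/
theorem detourTerm_mul_wd (n : E → k) (l : List E) {m : List E} (hm : m ≠ []) :
    B.detourTerm n l * B.wd m = 0 := by
  refine B.detourTerm_cases (p := fun _ x => x * B.wd m = 0) n (fun α h => ?_) (by simp) l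
  rw [smul_mul_assoc, B.wd_mul h.2 hm,
    B.wd_of_not_good (h.isDetour.not_good_append h.1 hm), smul_zero]

theorem wd_mul_detourTerm (n : E → k) (l : List E) {m : List E} (hm : m ≠ []) :
    B.wd m * B.detourTerm n l = 0 := by
  refine B.detourTerm_cases (p := fun _ x => B.wd m * x = 0) n (fun α h => ?_) (by simp) l
  rw [mul_smul_comm, B.wd_mul hm h.2,
    B.wd_of_not_good (h.isDetour.not_good_prepend h.1 hm), smul_zero]

theorem detourTerm_mul_detourTerm (n : E → k) (l m : List E) :
    B.detourTerm n l * B.detourTerm n m = 0 := by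
  refine B.detourTerm_cases (p := fun _ x => B.detourTerm n l * x = 0) n (fun α h => ?_) (by simp) m
  rw [mul_smul_comm, B.detourTerm_mul_wd _ _ h.2, smul_zero]

theorem rad_detourTerm (n : E → k) (l : List E) : B.Rad (B.detourTerm n l) :=
  B.detourTerm_cases (p := fun _ x => B.Rad x) n (fun α _ a => by simp) (fun _ a => by simp) l

/-- The linear map that scales the arrows by `t` and adds multiples of detours. -/
def deformLinear (n : E → k) (t : E → kˣ) : A →ₗ[k] A :=
  B.basis.constr k (Sum.elim B.ev fun l =>
    ((along t l.1 : kˣ) : k) • (B.wd l.1 + B.detourTerm n l.1))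

theorem deformLinear_ev (n : E → k) (t : E → kˣ) (a : V) :
    B.deformLinear n t (B.ev a) = B.ev a := by
  simp [deformLinear, ev]

theorem deformLinear_wd (n : E → k) (t : E → kˣ) (l : List E) :
    B.deformLinear n t (B.wd l) = ((along t l : kˣ) : k) • (B.wd l + B.detourTerm n l) := by
  by_cases h : D.Good l
  · nth_rw 1 [B.wd_of_good h]
    simp [deformLinear]
  · have : B.detourTerm n l = 0 :=
      B.detourTerm_cases (p := fun l x => ¬ D.Good l → x = 0) n
        (fun α _ h' => absurd (Good.singleton α) h') (by simp) l h
    simp [B.wd_of_not_good h, this]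

theorem detourTerm_mul_ev (n : E → k) (l : List E) (a : V) :
    (D.StartsAt l a → B.detourTerm n l * B.ev a = B.detourTerm n l) ∧
      (¬ D.StartsAt l a → B.detourTerm n l * B.ev a = 0) := by
  refine B.detourTerm_cases (p := fun l x => (D.StartsAt l a → x * B.ev a = x) ∧
    (¬ D.StartsAt l a → x * B.ev a = 0)) n (fun α h => ?_) (by simp) l
  have h1 := h.isDetour.2.1
  constructor
  · intro h'
    obtain rfl := startsAt_unique (by simp) h' (startsAt_singleton α)
    rw [smul_mul_assoc, B.wd_mul_ev h1]
  · intro h'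
    rw [smul_mul_assoc, B.wd_mul_ev_of_not, smul_zero]
    intro h''
    obtain rfl := startsAt_unique h.2 h'' h1
    exact h' (startsAt_singleton α)

theorem ev_mul_detourTerm (n : E → k) (l : List E) (a : V) :
    (D.EndsAt l a → B.ev a * B.detourTerm n l = B.detourTerm n l) ∧
      (¬ D.EndsAt l a → B.ev a * B.detourTerm n l = 0) := by
  refine B.detourTerm_cases (p := fun l x => (D.EndsAt l a → B.ev a * x = x) ∧
    (¬ D.EndsAt l a → B.ev a * x = 0)) n (fun α h => ?_) (by simp) l
  have h1 := h.isDetour.2.2.1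
  constructor
  · intro h'
    obtain rfl := endsAt_unique (by simp) h' (endsAt_singleton α)
    rw [mul_smul_comm, B.ev_mul_wd h1]
  · intro h'
    rw [mul_smul_comm, B.ev_mul_wd_of_not, smul_zero]
    intro h''
    obtain rfl := endsAt_unique h.2 h'' h1
    exact h' (endsAt_singleton α)

/-- On a product of two words every cross term contains a prolonged detour and vanishes, while a
word of length at least two receives no detour term. Products with vertices agree because a detour
is parallel to its arrow. -/
theorem deformLinear_mul (n : E → k) (t : E → kˣ) (x y : A) :
    B.deformLinear n t (x * y) = B.deformLinear n t x * B.deformLinear n t y := by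
  induction x using B.induction with
  | zero => simp
  | add x x' h h' => simp only [add_mul, map_add, h, h']
  | smul c x h => simp only [smul_mul_assoc, map_smul, h]
  | vertex a =>
    induction y using B.induction with
    | zero => simp
    | add x x' h h' => simp only [mul_add, map_add, h, h']
    | smul c x h => simp only [mul_smul_comm, map_smul, h]
    | vertex b =>
      by_cases h : a = b
      · subst h
        simp [deformLinear_ev]
      · simp [deformLinear_ev, B.ev_mul_of_ne h]
    | word l hl =>
      by_cases h : D.EndsAt l a
      · rw [B.ev_mul_wd h, deformLinear_wd, deformLinear_ev, mul_smul_comm, mul_add,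
          B.ev_mul_wd h, (B.ev_mul_detourTerm n l a).1 h]
      · rw [B.ev_mul_wd_of_not h, deformLinear_wd, deformLinear_ev, mul_smul_comm, mul_add,
          B.ev_mul_wd_of_not h, (B.ev_mul_detourTerm n l a).2 h]
        simp
  | word l hl =>
    induction y using B.induction with
    | zero => simp
    | add x x' h h' => simp only [mul_add, map_add, h, h']
    | smul c x h => simp only [mul_smul_comm, map_smul, h]
    | vertex a =>
      by_cases h : D.StartsAt l a
      · rw [B.wd_mul_ev h, deformLinear_wd, deformLinear_ev, smul_mul_assoc, add_mul,
          B.wd_mul_ev h, (B.detourTerm_mul_ev n l a).1 h]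
      · rw [B.wd_mul_ev_of_not h, deformLinear_wd, deformLinear_ev, smul_mul_assoc, add_mul,
          B.wd_mul_ev_of_not h, (B.detourTerm_mul_ev n l a).2 h]
        simp
    | word m hm =>
      rw [B.wd_mul hl.1 hm.1, deformLinear_wd, deformLinear_wd, deformLinear_wd, along_append,
        B.detourTerm_append n hl.1 hm.1, smul_mul_smul_comm, add_mul, mul_add, mul_add,
        B.detourTerm_mul_wd n l hm.1, B.wd_mul_detourTerm n m hl.1, detourTerm_mul_detourTerm,
        B.wd_mul hl.1 hm.1]
      simp

/-- The homomorphism that scales the arrows by `t` and adds multiples of detours. -/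
def deform (n : E → k) (t : E → kˣ) : A →ₐ[k] A :=
  AlgHom.ofLinearMap (B.deformLinear n t)
    (by rw [← B.sum_ev, map_sum]; simp only [deformLinear_ev]) (B.deformLinear_mul n t)

@[simp] theorem deform_ev (n : E → k) (t : E → kˣ) (a : V) : B.deform n t (B.ev a) = B.ev a :=
  B.deformLinear_ev n t a

theorem deform_wd (n : E → k) (t : E → kˣ) (l : List E) :
    B.deform n t (B.wd l) = ((along t l : kˣ) : k) • (B.wd l + B.detourTerm n l) :=
  B.deformLinear_wd n t l

theorem deform_one : B.deform 0 1 = AlgHom.id k A := by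
  refine B.algHom_ext (by simp) fun α => ?_
  have : B.detourTerm 0 [α] = 0 :=
    B.detourTerm_cases (p := fun _ x => x = 0) 0 (by simp) (by simp) [α]
  simp [deform_wd, this]

/-- The detour of a movable arrow is not a movable arrow, so the outer map merely scales it.
Comparing that scale with `t α` gives the character of the semidirect product. -/
theorem deform_comp_deform {n n' n'' : E → k} {t t' : E → kˣ}
    (h : ∀ α, D.Movable α → n'' α = n α + ((along t (D.detour α) / t α : kˣ) : k) * n' α) :
    (B.deform n t).comp (B.deform n' t') = B.deform n'' (t * t') := by
  refine B.algHom_ext (by simp) fun α => ?_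
  rw [AlgHom.comp_apply, deform_wd, deform_wd, map_smul, map_add, deform_wd, along_singleton,
    along_singleton, along_singleton]
  by_cases hα : D.Movable α
  · have h0 : B.detourTerm n (D.detour α) = 0 := by
      refine B.detourTerm_cases (p := fun l x => l = D.detour α → x = 0) n (fun β hβ h' => ?_)
        (by simp) _ rfl
      exact absurd h'.symm (hα.detour_ne_movable hβ)
    rw [B.detourTerm_of_movable _ hα, B.detourTerm_of_movable _ hα, B.detourTerm_of_movable _ hα,
      map_smul, deform_wd, h0, h α hα]
    simp only [smul_add, smul_smul, Pi.mul_apply, Units.val_mul, add_zero, add_assoc,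
      ← add_smul, Units.val_div_eq_div_val]
    congr 2
    · ring
    · have := (t α).ne_zero
      field_simp
  · simp only [B.detourTerm_of_not_movable _ hα, map_zero, add_zero, smul_smul, Pi.mul_apply,
      Units.val_mul]
    rw [mul_comm]

end PathBasis

/-! ## The action of automorphisms on vertices and arrows -/

namespace PathBasis

open GentleDatum

variable {V E : Type*} [Fintype V] {D : GentleDatum V E} {k A : Type*} [Field k] [Ring A]
  [Algebra k A] (B : PathBasis D k A)

/-- The automorphism induces the identity modulo the radical. -/
def FixesVertices (f : A ≃ₐ[k] A) : Prop := ∀ a, B.vcf a (f (B.ev a)) = 1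

/-- The matrix coefficients of the action on the radical modulo its square. -/
def arrowCf (f : A ≃ₐ[k] A) (α β : E) : k := B.cf [β] (f (B.wd [α]))

/-- The image of a word squares to zero, and every character vanishes on such an element. -/
theorem rad_map_wd (f : A ≃ₐ[k] A) (l : List E) : B.Rad (f (B.wd l)) := by
  intro a
  obtain rfl | hl := eq_or_ne l []
  · simp
  have h : B.vcf a (f (B.wd l)) * B.vcf a (f (B.wd l)) = 0 := by
    rw [← vcf_mul, ← map_mul, B.wd_mul hl hl, B.wd_of_not_good (not_good_append_self l)]
    simp
  exact mul_self_eq_zero.1 h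

theorem vcf_map_ev_eq (f : A ≃ₐ[k] A) (a b : V) :
    B.vcf a (f (B.ev b)) = 0 ∨ B.vcf a (f (B.ev b)) = 1 := by
  have h : B.vcf a (f (B.ev b)) * B.vcf a (f (B.ev b)) = B.vcf a (f (B.ev b)) := by
    rw [← vcf_mul, ← map_mul, ev_mul_self]
  have : B.vcf a (f (B.ev b)) * (B.vcf a (f (B.ev b)) - 1) = 0 := by linear_combination h
  obtain h | h := mul_eq_zero.1 this
  · exact Or.inl h
  · exact Or.inr (sub_eq_zero.1 h)

/-- Longer words are products of radical elements, and so are their images, which therefore have no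
arrow coefficients: the automorphism acts on the radical modulo its square. -/
theorem cf_map [Fintype E] (f : A ≃ₐ[k] A) {x : A} (hx : B.Rad x) (γ : E) :
    B.cf [γ] (f x) = ∑ β, B.cf [β] x * B.arrowCf f β γ := by
  classical
  have := D.finite_good
  have := Fintype.ofFinite {l : List E // D.Good l}
  have key : ∀ l, D.Good l →
      B.cf [γ] (f (B.wd l)) = ∑ β, B.cf [β] (B.wd l) * B.arrowCf f β γ := by
    intro l hl
    obtain ⟨α, l, rfl⟩ := List.exists_cons_of_ne_nil hl.1
    obtain rfl | hl' := eq_or_ne l []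
    · rw [Finset.sum_eq_single α]
      · rw [B.cf_wd_self hl, one_mul, arrowCf]
      · intro β _ hβ
        rw [B.cf_wd_of_ne (by simpa using hβ), zero_mul]
      · simp
    · rw [Finset.sum_eq_zero]
      · have := B.wd_mul (l := [α]) (by simp) hl'
        simp only [List.singleton_append] at this
        rw [← this, map_mul, B.cf_singleton_mul_of_rad (B.rad_map_wd f _) (B.rad_map_wd f _)]
      · intro β _
        rw [B.cf_wd_of_ne, zero_mul]
        intro h
        simp at h
        exact hl' h.2
  conv_lhs => rw [B.eq_sum_of_rad hx]
  conv_rhs => rw [B.eq_sum_of_rad hx]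
  simp only [map_sum, map_smul, Finset.sum_mul, smul_eq_mul]
  rw [Finset.sum_comm]
  refine Finset.sum_congr rfl fun l _ => ?_
  rw [key _ l.2, Finset.mul_sum]
  exact Finset.sum_congr rfl fun β _ => by ring

theorem arrowCf_mul [Fintype E] (f g : A ≃ₐ[k] A) (α γ : E) :
    B.arrowCf (f * g) α γ = ∑ β, B.arrowCf g α β * B.arrowCf f β γ :=
  B.cf_map f (B.rad_map_wd g [α]) γ

theorem sum_arrowCf_mul_inv [Fintype E] (f : A ≃ₐ[k] A) (α : E) :
    ∑ β, B.arrowCf f α β * B.arrowCf f⁻¹ β α = 1 := by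
  rw [← B.arrowCf_mul, inv_mul_cancel]
  exact B.cf_wd_self (Good.singleton α)

theorem sum_arrowCf_inv_mul [Fintype E] (f : A ≃ₐ[k] A) (α : E) :
    ∑ β, B.arrowCf f⁻¹ α β * B.arrowCf f β α = 1 := by
  simpa using B.sum_arrowCf_mul_inv f⁻¹ α

theorem exists_arrowCf_ne_zero [Fintype E] (f : A ≃ₐ[k] A) (α : E) : ∃ β, B.arrowCf f α β ≠ 0 := by
  by_contra! h
  have := B.sum_arrowCf_mul_inv f α
  simp [h] at this

namespace FixesVertices

variable {B} {f g : A ≃ₐ[k] A}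

/-- For `b ≠ a` the image of vertex `b` is annihilated by that of `a`, on which the character at `a`
is 1. -/
theorem vcf_map (hf : B.FixesVertices f) (a : V) (x : A) : B.vcf a (f x) = B.vcf a x := by
  induction x using B.induction with
  | zero => simp
  | add x y h h' => simp [h, h']
  | smul c x h => simp [h]
  | vertex b =>
    by_cases hab : a = b
    · subst hab
      simp [hf a]
    · rw [B.vcf_ev_of_ne hab]
      have : B.vcf a (f (B.ev a)) * B.vcf a (f (B.ev b)) = 0 := by
        rw [← vcf_mul, ← map_mul, B.ev_mul_of_ne hab]
        simp
      rwa [hf a, one_mul] at this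
  | word l hl => rw [B.rad_map_wd f l a, vcf_wd]

theorem one : B.FixesVertices 1 := fun a => B.vcf_ev_self a

/-- Write `α` as `ev (tgt α) * α * ev (src α)`: modulo the square of the radical, the images of the
two vertices act through the unchanged characters. -/
theorem parallel_of_arrowCf_ne_zero (hf : B.FixesVertices f) {α β : E}
    (h : B.arrowCf f α β ≠ 0) : D.src β = D.src α ∧ D.tgt β = D.tgt α := by
  have h1 : B.wd [α] = B.ev (D.tgt α) * B.wd [α] * B.ev (D.src α) := by
    rw [B.ev_mul_wd (endsAt_singleton α), B.wd_mul_ev (startsAt_singleton α)]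
  have h2 : B.arrowCf f α β =
      B.vcf (D.tgt β) (B.ev (D.tgt α)) * B.cf [β] (f (B.wd [α])) *
        B.vcf (D.src β) (B.ev (D.src α)) := by
    rw [arrowCf]
    nth_rw 1 [h1]
    rw [map_mul f, map_mul f, cf_singleton_mul, cf_singleton_mul, vcf_mul, B.rad_map_wd f [α],
      B.rad_map_wd f [α], hf.vcf_map, hf.vcf_map]
    ring
  constructor
  · by_contra hne
    rw [h2, B.vcf_ev_of_ne hne, mul_zero] at h
    exact h rfl
  · by_contra hne
    rw [h2, B.vcf_ev_of_ne hne, zero_mul, zero_mul] at h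
    exact h rfl

/-- This is the coefficient of the nonzero path `β' α'` in the image of the product `β α = 0`. -/
theorem arrowCf_mul_arrowCf_eq_zero [Finite E] (f : A ≃ₐ[k] A) {β α β' α' : E}
    (h : ¬ D.ok β α) (h' : D.ok β' α') :
    B.arrowCf f β β' * B.arrowCf f α α' = 0 := by
  rw [arrowCf, arrowCf, ← B.cf_pair_mul_of_rad h' (B.rad_map_wd f _) (B.rad_map_wd f _), ← map_mul,
    B.wd_mul (by simp) (by simp), B.wd_of_not_good]
  · simp
  · intro hg
    exact h (by simpa using hg.2)

variable [Fintype E]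

/-- An arrow in a relation is mapped, to first order, to a multiple of a single arrow. -/
theorem arrowCf_self_mul_arrowCf (hf : B.FixesVertices f) {α α' : E} (hα : ¬ D.Free α)
    (hne : α' ≠ α) : B.arrowCf f α α * B.arrowCf f α α' = 0 := by
  by_contra hcon
  obtain ⟨h1, h2⟩ := mul_ne_zero_iff.1 hcon
  obtain ⟨hs, ht⟩ := hf.parallel_of_arrowCf_ne_zero h2
  simp only [Free, not_forall, not_and_or] at hα
  -- Take a relation between `α` and `δ`, and an arrow `δ'` occurring in the image of `δ`. If `δ' =
  -- δ`, then `δ` composes with `α'`, otherwise `δ'` composes with `α`; a failure would put one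
  -- arrow into two relations on the same side. The coefficient of that path in the image of the
  -- relation is a product of two nonzero factors.
  obtain ⟨δ, ⟨hc, hn⟩ | ⟨hc, hn⟩⟩ := hα
  · obtain ⟨δ', hδ'⟩ := B.exists_arrowCf_ne_zero f δ
    obtain ⟨hs', ht'⟩ := hf.parallel_of_arrowCf_ne_zero hδ'
    by_cases hδ : δ' = δ
    · subst hδ
      have hok : D.ok α' δ' := by
        by_contra h
        exact hne (D.rel_left_unique (hc.trans hs.symm) h hc hn)
      exact mul_ne_zero h2 hδ' (arrowCf_mul_arrowCf_eq_zero f hn hok)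
    · have hok : D.ok α δ' := by
        by_contra h
        exact hδ (D.rel_right_unique (ht'.trans hc) h hc hn)
      exact mul_ne_zero h1 hδ' (arrowCf_mul_arrowCf_eq_zero f hn hok)
  · obtain ⟨δ', hδ'⟩ := B.exists_arrowCf_ne_zero f δ
    obtain ⟨hs', ht'⟩ := hf.parallel_of_arrowCf_ne_zero hδ'
    by_cases hδ : δ' = δ
    · subst hδ
      have hok : D.ok δ' α' := by
        by_contra h
        exact hne (D.rel_right_unique (ht.trans hc) h hc hn)
      exact mul_ne_zero hδ' h2 (arrowCf_mul_arrowCf_eq_zero f hn hok)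
    · have hok : D.ok δ' α := by
        by_contra h
        exact hδ (D.rel_left_unique (hc.trans hs'.symm) h hc hn)
      exact mul_ne_zero hδ' h1 (arrowCf_mul_arrowCf_eq_zero f hn hok)

theorem arrowCf_mul_inv_of_not_free (hf : B.FixesVertices f) {α : E} (hα : ¬ D.Free α)
    (h : B.arrowCf f α α ≠ 0) : B.arrowCf f α α * B.arrowCf f⁻¹ α α = 1 := by
  rw [← B.sum_arrowCf_mul_inv f α, Finset.sum_eq_single α]
  · intro β _ hβ
    rw [(mul_eq_zero.1 (hf.arrowCf_self_mul_arrowCf hα hβ)).resolve_left h, zero_mul]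
  · simp

end FixesVertices

/-! ### The neutrality condition -/

/-- The automorphisms that represent elements of the neutral component of the group of outer
automorphisms. -/
def Neutral (f : A ≃ₐ[k] A) : Prop :=
  B.FixesVertices f ∧ ∀ α, ¬ D.Free α → B.arrowCf f α α ≠ 0

/-- For an arrow in a relation, the row of `f` at `α` is diagonal. For a free arrow the column is:
another arrow `β` contributing to it would be parallel to `α`, hence in a relation by
`parallel_free`, and its own row would be diagonal. -/
theorem Neutral.arrowCf_mul_inv {B : PathBasis D k A} [Fintype E] {f : A ≃ₐ[k] A}
    (hf : B.Neutral f) (α : E) : B.arrowCf f α α * B.arrowCf f⁻¹ α α = 1 := by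
  by_cases hα : D.Free α
  · rw [mul_comm, ← B.sum_arrowCf_inv_mul f α, Finset.sum_eq_single α]
    · intro β _ hβ
      suffices B.arrowCf f β α = 0 by rw [this, mul_zero]
      by_contra hne
      obtain ⟨h1, h2⟩ := hf.1.parallel_of_arrowCf_ne_zero hne
      have hβ' : ¬ D.Free β := fun h => hβ (D.parallel_free h1.symm h2.symm h hα)
      exact mul_ne_zero (hf.2 β hβ') hne (hf.1.arrowCf_self_mul_arrowCf hβ' (Ne.symm hβ))
    · simp
  · exact hf.1.arrowCf_mul_inv_of_not_free hα (hf.2 α hα)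

open Classical in
/-- The indicator function of the automorphisms that represent elements of the neutral component. -/
def neutralIndicator [Fintype E] (f : A ≃ₐ[k] A) : k :=
  -- Vertex factors are 0 or 1, being characters of idempotents. Pairing each arrow coefficient with
  -- that of `f⁻¹` normalizes the nonzero products to 1 as well, once the vertices are fixed.
  (∏ a, B.vcf a (f (B.ev a))) *
    ∏ α ∈ Finset.univ.filter (fun α => ¬ D.Free α), B.arrowCf f α α * B.arrowCf f⁻¹ α α

theorem neutralIndicator_of_neutral [Fintype E] {f : A ≃ₐ[k] A} (hf : B.Neutral f) :
    B.neutralIndicator f = 1 := by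
  rw [neutralIndicator, Finset.prod_eq_one fun a _ => hf.1 a,
    Finset.prod_eq_one fun α _ => hf.arrowCf_mul_inv α, one_mul]

open Classical in
theorem neutralIndicator_of_not_neutral [Fintype E] {f : A ≃ₐ[k] A} (hf : ¬ B.Neutral f) :
    B.neutralIndicator f = 0 := by
  rw [neutralIndicator]
  by_cases h : B.FixesVertices f
  · have : ∃ α, ¬ D.Free α ∧ B.arrowCf f α α = 0 := by
      by_contra! h'
      exact hf ⟨h, h'⟩
    obtain ⟨α, hα, h0⟩ := this
    rw [Finset.prod_eq_zero (i := α) (s := Finset.univ.filter _) (by simp [hα]) (by simp [h0]),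
      mul_zero]
  · simp only [FixesVertices, not_forall] at h
    obtain ⟨a, ha⟩ := h
    rw [Finset.prod_eq_zero (Finset.mem_univ a) ((B.vcf_map_ev_eq f a a).resolve_right ha),
      zero_mul]

/-! ### Inner automorphisms -/

variable (k) in
/-- The inner automorphism given by a unit. -/
def inner (x : Aˣ) : A ≃ₐ[k] A := MulSemiringAction.toAlgAut (ConjAct Aˣ) k A (ConjAct.toConjAct x)

theorem inner_apply (x : Aˣ) (y : A) : inner k x y = x * y * (x⁻¹ : Aˣ) := rfl

theorem inner_mem (x : Aˣ) : inner k x ∈ Inn k A := ⟨_, rfl⟩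

theorem exists_inner_of_mem {f : A ≃ₐ[k] A} (h : f ∈ Inn k A) : ∃ x : Aˣ, f = inner k x := by
  obtain ⟨x, rfl⟩ := h
  exact ⟨ConjAct.ofConjAct x, rfl⟩

theorem vcf_mul_vcf_inv (x : Aˣ) (a : V) : B.vcf a x * B.vcf a (x⁻¹ : Aˣ) = 1 := by
  rw [← vcf_mul, Units.mul_inv, vcf_one]

theorem vcf_unit_ne_zero (x : Aˣ) (a : V) : B.vcf a x ≠ 0 :=
  left_ne_zero_of_mul_eq_one (B.vcf_mul_vcf_inv x a)

theorem vcf_inner (x : Aˣ) (a : V) (y : A) : B.vcf a (inner k x y) = B.vcf a y := by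
  rw [inner_apply, vcf_mul, vcf_mul]
  linear_combination B.vcf a y * B.vcf_mul_vcf_inv x a

theorem arrowCf_inner_mul (x : Aˣ) (f : A ≃ₐ[k] A) (α β : E) :
    B.arrowCf (inner k x * f) α β =
      B.vcf (D.tgt β) x * B.vcf (D.src β) (x⁻¹ : Aˣ) * B.arrowCf f α β := by
  change B.cf [β] (inner k x (f (B.wd [α]))) = _
  rw [inner_apply, cf_singleton_mul, cf_singleton_mul, vcf_mul, B.rad_map_wd f [α],
    B.rad_map_wd f [α], arrowCf]
  ring

/-- Conjugation preserves vertex coefficients and multiplies arrow coefficients by nonzero scalars,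
so neutrality is a condition on outer classes. -/
theorem neutral_inner_mul {x : Aˣ} {f : A ≃ₐ[k] A} :
    B.Neutral (inner k x * f) ↔ B.Neutral f := by
  have h1 : ∀ a, B.vcf a ((inner k x * f) (B.ev a)) = B.vcf a (f (B.ev a)) := fun a =>
    B.vcf_inner x a _
  simp only [Neutral, FixesVertices, h1, arrowCf_inner_mul, ne_eq, mul_eq_zero,
    B.vcf_unit_ne_zero, false_or]

end PathBasis

/-! ## Normal forms of automorphisms that fix the vertices -/

namespace GentleDatum

variable {V E : Type*} {D : GentleDatum V E}

/-- If there is no cycle, the default value is the empty word, for which the condition is vacuous.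
-/
theorem endsAt_cycle (a : V) : D.EndsAt (D.cycle a) a := by
  by_cases h : D.cycle a = []
  · simp [h, EndsAt]
  · exact (isCycle_cycle h).2.2

theorem startsAt_cycle (a : V) : D.StartsAt (D.cycle a) a := by
  by_cases h : D.cycle a = []
  · simp [h, StartsAt]
  · exact (isCycle_cycle h).2.1

theorem endsAt_detour (α : E) : D.EndsAt (D.detour α) (D.tgt α) := by
  by_cases h : D.detour α = []
  · simp [h, EndsAt]
  · exact (isDetour_detour h).2.2.1

theorem startsAt_detour (α : E) : D.StartsAt (D.detour α) (D.src α) := by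
  by_cases h : D.detour α = []
  · simp [h, StartsAt]
  · exact (isDetour_detour h).2.1

/-- With its mirror image and the two analogues for cycles, this isolates coefficients in products:
such terms cannot contribute to a word that begins, or ends, with the letter `α`. -/
theorem detour_not_prefix {α : E} (h : D.detour α ≠ []) (m : List E) :
    ¬ D.detour α <+: α :: m := by
  intro h'
  have h1 := (isDetour_detour h).2.2.2.1
  obtain ⟨β, l, hl⟩ := List.exists_cons_of_ne_nil h
  rw [hl] at h' h1
  obtain rfl := (List.cons_prefix_cons.1 h').1
  exact h1 rfl

theorem detour_not_suffix {α : E} (h : D.detour α ≠ []) (m : List E) :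
    ¬ D.detour α <:+ m ++ [α] := by
  intro h'
  have h1 := (isDetour_detour h).2.2.2.2
  obtain ⟨l, β, hl⟩ := exists_append_singleton h
  rw [hl] at h' h1
  obtain ⟨n, hn⟩ := h'
  rw [← List.append_assoc] at hn
  obtain rfl : β = α := by simpa using (List.append_inj' hn rfl).2
  simp at h1

theorem not_prefix_cons_of_good {α : E} {u : List E} (hu : u ≠ []) (h : D.Good (u ++ [α]))
    (m : List E) : ¬ (u ++ [α]) <+: α :: m := by
  intro h'
  obtain ⟨β, l, rfl⟩ := List.exists_cons_of_ne_nil hu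
  rw [List.cons_append] at h'
  obtain rfl := (List.cons_prefix_cons.1 h').1
  have := h.nodup
  simp at this

theorem not_suffix_concat_of_good {α : E} {u : List E} (hu : u ≠ []) (h : D.Good (α :: u))
    (m : List E) : ¬ (α :: u) <:+ m ++ [α] := by
  intro h'
  obtain ⟨l, β, rfl⟩ := exists_append_singleton hu
  obtain ⟨n, hn⟩ := h'
  rw [← List.cons_append, ← List.append_assoc] at hn
  obtain rfl : β = α := by simpa using (List.append_inj' hn rfl).2
  have := h.nodup
  simp at this

end GentleDatum

namespace PathBasis

open GentleDatum

variable {V E : Type*} [Fintype V] {D : GentleDatum V E} {k A : Type*} [Field k] [Ring A]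
  [Algebra k A] (B : PathBasis D k A)

/-- The element given by the cycle at a vertex, which is zero if there is none. -/
def cyc (a : V) : A := B.wd (D.cycle a)

theorem ev_mul_cyc (a : V) : B.ev a * B.cyc a = B.cyc a := B.ev_mul_wd (endsAt_cycle a)

theorem cyc_mul_ev (a : V) : B.cyc a * B.ev a = B.cyc a := B.wd_mul_ev (startsAt_cycle a)

theorem cyc_mul_cyc (a b : V) : B.cyc a * B.cyc b = 0 := by
  by_cases hab : a = b
  · subst hab
    by_cases h : D.cycle a = []
    · simp [cyc, h]
    · rw [cyc, B.wd_mul h h, B.wd_of_not_good (not_good_append_self _)]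
  · rw [← B.cyc_mul_ev a, ← B.ev_mul_cyc b, mul_assoc, ← mul_assoc (B.ev a), B.ev_mul_of_ne hab,
      zero_mul, mul_zero]

/-- A linear combination of cycles. -/
def cycSum (ζ : V → k) : A := ∑ a, ζ a • B.cyc a

theorem rad_cycSum (ζ : V → k) : B.Rad (B.cycSum ζ) := fun a => by simp [cycSum, cyc]

theorem cycSum_mul_self (ζ : V → k) : B.cycSum ζ * B.cycSum ζ = 0 := by
  simp [cycSum, Finset.sum_mul_sum, cyc_mul_cyc]

theorem cycSum_mul_ev (ζ : V → k) (a : V) : B.cycSum ζ * B.ev a = ζ a • B.cyc a := by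
  rw [cycSum, Finset.sum_mul, Finset.sum_eq_single a]
  · rw [smul_mul_assoc, cyc_mul_ev]
  · intro b _ hb
    rw [smul_mul_assoc, ← cyc_mul_ev, mul_assoc, B.ev_mul_of_ne hb, mul_zero, smul_zero]
  · simp

theorem ev_mul_cycSum (ζ : V → k) (a : V) : B.ev a * B.cycSum ζ = ζ a • B.cyc a := by
  rw [cycSum, Finset.mul_sum, Finset.sum_eq_single a]
  · rw [mul_smul_comm, ev_mul_cyc]
  · intro b _ hb
    rw [mul_smul_comm, ← ev_mul_cyc, ← mul_assoc, B.ev_mul_of_ne hb.symm, zero_mul, smul_zero]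
  · simp

theorem cycSum_mul_wd (ζ : V → k) {l : List E} {a : V} (h : D.EndsAt l a) :
    B.cycSum ζ * B.wd l = ζ a • (B.cyc a * B.wd l) := by
  rw [← B.ev_mul_wd h, ← mul_assoc, cycSum_mul_ev, smul_mul_assoc, ← mul_assoc, cyc_mul_ev]

theorem wd_mul_cycSum (ζ : V → k) {l : List E} {a : V} (h : D.StartsAt l a) :
    B.wd l * B.cycSum ζ = ζ a • (B.wd l * B.cyc a) := by
  rw [← B.wd_mul_ev h, mul_assoc, ev_mul_cycSum, mul_smul_comm, mul_assoc, ev_mul_cyc]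

/-- The unit `1 + ∑ ζ a • cyc a`. -/
def cycUnit (ζ : V → k) : Aˣ where
  val := 1 + B.cycSum ζ
  inv := 1 - B.cycSum ζ
  val_inv := by
    have := B.cycSum_mul_self ζ
    noncomm_ring
    simp [this]
  inv_val := by
    have := B.cycSum_mul_self ζ
    noncomm_ring
    simp [this]

theorem cf_ev_mul_of_not {l : List E} {a : V} (h : ¬ D.EndsAt l a) (y : A) :
    B.cf l (B.ev a * y) = 0 := by
  induction y using B.induction with
  | zero => simp
  | add x y h h' => simp [mul_add, h, h']
  | smul c x h => simp [h]
  | vertex b =>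
    by_cases hab : a = b
    · subst hab; simp
    · simp [B.ev_mul_of_ne hab]
  | word m hm =>
    by_cases hma : D.EndsAt m a
    · rw [B.ev_mul_wd hma, B.cf_wd_of_ne]
      rintro rfl
      exact h hma
    · simp [B.ev_mul_wd_of_not hma]

theorem cf_mul_ev_of_not {l : List E} {a : V} (h : ¬ D.StartsAt l a) (y : A) :
    B.cf l (y * B.ev a) = 0 := by
  induction y using B.induction with
  | zero => simp
  | add x y h h' => simp [add_mul, h, h']
  | smul c x h => simp [h]
  | vertex b =>
    by_cases hab : b = a
    · subst hab; simp
    · simp [B.ev_mul_of_ne hab]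
  | word m hm =>
    by_cases hma : D.StartsAt m a
    · rw [B.wd_mul_ev hma, B.cf_wd_of_ne]
      rintro rfl
      exact h hma
    · simp [B.wd_mul_ev_of_not hma]

/-- A nonzero product of a cycle and `α` does not begin with `α`, as its letters are distinct. -/
theorem cf_cons_cyc_mul (α : E) (a : V) (m : List E) (z : A) :
    B.cf (α :: m) (B.cyc a * B.wd [α] * z) = 0 := by
  by_cases h : D.cycle a = []
  · simp [cyc, h]
  rw [cyc, B.wd_mul h (by simp)]
  by_cases hg : D.Good (D.cycle a ++ [α])
  · exact B.cf_wd_mul_of_not_prefix (not_prefix_cons_of_good h hg m) z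
  · simp [B.wd_of_not_good hg]

theorem cf_concat_mul_cyc (α : E) (a : V) (m : List E) (z : A) :
    B.cf (m ++ [α]) (z * (B.wd [α] * B.cyc a)) = 0 := by
  by_cases h : D.cycle a = []
  · simp [cyc, h]
  rw [cyc, B.wd_mul (by simp) h]
  by_cases hg : D.Good ([α] ++ D.cycle a)
  · exact B.cf_mul_wd_of_not_suffix (not_suffix_concat_of_good h hg m) z
  · rw [B.wd_of_not_good hg, mul_zero, map_zero]

theorem cf_cons_detour_mul (α : E) (m : List E) (z : A) :
    B.cf (α :: m) (B.wd (D.detour α) * z) = 0 := by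
  by_cases h : D.detour α = []
  · simp [h]
  · exact B.cf_wd_mul_of_not_prefix (detour_not_prefix h m) z

theorem cf_concat_mul_detour (α : E) (m : List E) (z : A) :
    B.cf (m ++ [α]) (z * B.wd (D.detour α)) = 0 := by
  by_cases h : D.detour α = []
  · simp [h]
  · exact B.cf_mul_wd_of_not_suffix (detour_not_suffix h m) z

/-- The expansion of an element of the radical parallel to an arrow. -/
theorem parallel_expansion {α : E} {z : A} (hz : B.Rad z) (hz' : B.ev (D.tgt α) * z = z)
    (hz'' : z * B.ev (D.src α) = z) :
    z = B.cf [α] z • B.wd [α] +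
      B.cf (D.cycle (D.tgt α) ++ [α]) z • (B.cyc (D.tgt α) * B.wd [α]) +
      B.cf (α :: D.cycle (D.src α)) z • (B.wd [α] * B.cyc (D.src α)) +
      B.cf (D.detour α) z • B.wd (D.detour α) := by
  have hα : D.Good [α] := Good.singleton α
  refine B.ext_cf (fun a => by simp [hz a]) fun l hl => ?_
  simp only [map_add, map_smul, smul_eq_mul]
  by_cases hs : D.StartsAt l (D.src α)
  swap
  · rw [← hz'', ← B.wd_mul_ev (startsAt_singleton α), ← B.cyc_mul_ev (D.src α),
      ← B.wd_mul_ev (startsAt_detour α)]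
    simp only [← mul_assoc, B.cf_mul_ev_of_not hs, mul_zero, add_zero]
  by_cases he : D.EndsAt l (D.tgt α)
  swap
  · rw [← hz', ← B.ev_mul_wd (endsAt_singleton α), ← B.ev_mul_cyc (D.tgt α),
      ← B.ev_mul_wd (endsAt_detour α)]
    simp only [mul_assoc, B.cf_ev_mul_of_not he, mul_zero, add_zero]
  -- Each of the four kinds of parallel path occurs in exactly one of the four terms.
  obtain rfl | ⟨u, hu, rfl⟩ | ⟨u, hu, rfl⟩ | hd := hl.parallel_cases hs he
  · rw [B.cf_wd_self hl, cyc, cyc, B.cf_singleton_mul_of_rad (B.rad_wd _) (B.rad_wd _),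
      B.cf_singleton_mul_of_rad (B.rad_wd _) (B.rad_wd _), ← mul_one (B.wd (D.detour α)),
      B.cf_cons_detour_mul]
    simp
  · have h1 : D.cycle (D.tgt α) ≠ [] := hu.eq_cycle ▸ hu.1.1
    rw [hu.eq_cycle] at hl ⊢
    rw [cyc, B.wd_mul h1 (by simp), B.cf_wd_self hl, ← one_mul (B.wd (D.detour α)),
      B.cf_concat_mul_detour, ← one_mul (B.wd [α] * _), B.cf_concat_mul_cyc, B.cf_wd_of_ne]
    · simp
    · simpa using h1
  · have h1 : D.cycle (D.src α) ≠ [] := hu.eq_cycle ▸ hu.1.1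
    rw [hu.eq_cycle] at hl ⊢
    rw [cyc, cyc, B.wd_mul (l := [α]) (by simp) h1, List.singleton_append, B.cf_wd_self hl,
      ← mul_one (B.wd (D.detour α)), B.cf_cons_detour_mul, ← mul_one (_ * B.wd [α]), ← cyc,
      B.cf_cons_cyc_mul, B.cf_wd_of_ne]
    · simp
    · simpa using h1
  · have h1 : ¬ [α] <+: l := by
      rintro ⟨m, rfl⟩
      exact hd.2.2.2.1 rfl
    have h2 : ¬ [α] <:+ l := by
      rintro ⟨m, rfl⟩
      exact hd.2.2.2.2 (by simp)
    rw [B.cf_mul_wd_of_not_suffix h2, B.cf_wd_mul_of_not_prefix h1, ← mul_one (B.wd [α]),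
      B.cf_wd_mul_of_not_prefix h1, ← hd.eq_detour, B.cf_wd_self hl]
    simp

/-! ### Automorphisms that fix the vertices: the cycle coefficients -/

section NormalForm

variable {h : A ≃ₐ[k] A}

theorem map_arrow_expansion (hv : ∀ a, h (B.ev a) = B.ev a) (α : E) :
    h (B.wd [α]) = B.arrowCf h α α • B.wd [α] +
      B.cf (D.cycle (D.tgt α) ++ [α]) (h (B.wd [α])) • (B.cyc (D.tgt α) * B.wd [α]) +
      B.cf (α :: D.cycle (D.src α)) (h (B.wd [α])) • (B.wd [α] * B.cyc (D.src α)) +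
      B.cf (D.detour α) (h (B.wd [α])) • B.wd (D.detour α) := by
  refine B.parallel_expansion (B.rad_map_wd h _) ?_ ?_
  · rw [← hv, ← map_mul, B.ev_mul_wd (endsAt_singleton α)]
  · rw [← hv, ← map_mul, B.wd_mul_ev (startsAt_singleton α)]

/-- The coefficients of the two arrows adjacent to a cycle determine each other. -/
theorem cycle_coefficients (hv : ∀ a, h (B.ev a) = B.ev a) {δ α : E} {b : V} (hb : D.cycle b ≠ []) (hα : D.tgt α = b)
    (hδ : D.src δ = b) (h1 : D.Good (D.cycle b ++ [α])) (h2 : D.Good (δ :: D.cycle b)) :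
    B.arrowCf h δ δ * B.cf (D.cycle b ++ [α]) (h (B.wd [α])) +
      B.cf (δ :: D.cycle b) (h (B.wd [δ])) * B.arrowCf h α α = 0 := by
  have hgood : D.Good (δ :: (D.cycle b ++ [α])) := by
    exact Good.append_of_overlap (l := [δ]) (n := [α]) h2 h1 hb
  -- The successor of `δ` is the first letter of the cycle. If `α` were a successor too, it would be
  -- that letter, and the cycle followed by `α` would repeat it.
  have hrel : B.wd [δ] * B.wd [α] = 0 := by
    rw [B.wd_mul (by simp) (by simp), B.wd_of_not_good]
    intro hg
    obtain ⟨γ, u, hu⟩ := List.exists_cons_of_ne_nil hb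
    rw [hu] at h1 h2
    obtain rfl : γ = α := D.ok_right_unique
      (good_append_iff (l := []).1 h2).2.2 (good_append_iff (l := []).1 hg).2.2
    simpa using h1.nodup
  have key : h (B.wd [δ]) * h (B.wd [α]) = 0 := by rw [← map_mul, hrel, map_zero]
  -- In the expanded product of the images only two terms reach the word of `δ`, the cycle and `α`:
  -- the cycle comes either from the image of `α` or from that of `δ`.
  have hL : B.cf (δ :: (D.cycle b ++ [α])) (h (B.wd [δ]) * h (B.wd [α])) = 0 := by
    rw [key, map_zero]
  have eδ := B.map_arrow_expansion hv δ
  have eα := B.map_arrow_expansion hv α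
  rw [hα] at eα
  rw [hδ] at eδ
  set xα := B.cf (D.cycle b ++ [α]) (h (B.wd [α]))
  set yδ := B.cf (δ :: D.cycle b) (h (B.wd [δ]))
  rw [eδ] at hL
  simp only [add_mul, map_add, smul_mul_assoc, map_smul, B.cf_cons_cyc_mul, B.cf_cons_detour_mul,
    smul_zero, add_zero] at hL
  rw [eα] at hL
  simp only [← List.cons_append] at hL
  simp only [mul_add, map_add, mul_smul_comm, map_smul, B.cf_concat_mul_cyc,
    B.cf_concat_mul_detour, smul_zero, add_zero, hrel, zero_add] at hL
  have e1 : B.wd [δ] * (B.cyc b * B.wd [α]) = B.wd (δ :: D.cycle b ++ [α]) := by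
    rw [cyc, B.wd_mul hb (by simp), B.wd_mul (by simp) (by simp)]
    rfl
  have e2 : B.wd [δ] * B.cyc b * (B.cyc b * B.wd [α]) = 0 := by
    rw [mul_assoc, ← mul_assoc (B.cyc b), cyc_mul_cyc, zero_mul, mul_zero]
  rw [e2, mul_assoc, e1, B.cf_wd_self (by simpa using hgood)] at hL
  simp only [map_zero, smul_eq_mul, mul_one] at hL
  linear_combination hL

/-- At most one arrow can precede the cycle at `b` and at most one can follow it. Either of them
determines the scalar `ζ b`, and `cycle_coefficients` makes the two values agree. The equations are
multiplied by the paths because the coefficients are constrained only where the path is nonzero. -/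
theorem exists_cycle_coefficients (hv : ∀ a, h (B.ev a) = B.ev a)
    (ht : ∀ α, B.arrowCf h α α ≠ 0) : ∃ ζ : V → k, ∀ α,
    B.cf (D.cycle (D.tgt α) ++ [α]) (h (B.wd [α])) • (B.cyc (D.tgt α) * B.wd [α]) =
      -(ζ (D.tgt α) * B.arrowCf h α α) • (B.cyc (D.tgt α) * B.wd [α]) ∧
    B.cf (α :: D.cycle (D.src α)) (h (B.wd [α])) • (B.wd [α] * B.cyc (D.src α)) =
      (ζ (D.src α) * B.arrowCf h α α) • (B.wd [α] * B.cyc (D.src α)) := by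
  have key : ∀ b, ∃ z : k, (∀ α, D.tgt α = b → B.cyc b * B.wd [α] ≠ 0 →
      B.cf (D.cycle b ++ [α]) (h (B.wd [α])) = -(z * B.arrowCf h α α)) ∧
      ∀ δ, D.src δ = b → B.wd [δ] * B.cyc b ≠ 0 →
        B.cf (δ :: D.cycle b) (h (B.wd [δ])) = z * B.arrowCf h δ δ := by
    intro b
    by_cases hb : D.cycle b = []
    · exact ⟨0, by simp [cyc, hb], by simp [cyc, hb]⟩
    have g1 : ∀ α, B.cyc b * B.wd [α] ≠ 0 → D.Good (D.cycle b ++ [α]) := fun α hne => by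
      rw [cyc, B.wd_mul hb (by simp)] at hne
      exact B.good_of_wd_ne_zero hne
    have g2 : ∀ δ, B.wd [δ] * B.cyc b ≠ 0 → D.Good (δ :: D.cycle b) := fun δ hne => by
      rw [cyc, B.wd_mul (by simp) hb] at hne
      exact B.good_of_wd_ne_zero hne
    by_cases h1 : ∃ α, D.tgt α = b ∧ B.cyc b * B.wd [α] ≠ 0
    · obtain ⟨α, hα, hne⟩ := h1
      refine ⟨-(B.cf (D.cycle b ++ [α]) (h (B.wd [α])) / B.arrowCf h α α), ?_, ?_⟩
      · intro α' hα' hne'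
        obtain ⟨u, γ, hu⟩ := exists_append_singleton hb
        have ga := g1 _ hne
        have ga' := g1 _ hne'
        rw [hu] at ga ga'
        obtain rfl := D.ok_right_unique (good_append_iff.1 ga).2.2 (good_append_iff.1 ga').2.2
        have := ht α
        field_simp
      · intro δ hδ hne'
        have := B.cycle_coefficients hv hb hα hδ (g1 _ hne) (g2 _ hne')
        have := ht α
        field_simp
        linear_combination B.cycle_coefficients hv hb hα hδ (g1 _ hne) (g2 _ hne')
    by_cases h2 : ∃ δ, D.src δ = b ∧ B.wd [δ] * B.cyc b ≠ 0
    · obtain ⟨δ, hδ, hne⟩ := h2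
      refine ⟨B.cf (δ :: D.cycle b) (h (B.wd [δ])) / B.arrowCf h δ δ, ?_, ?_⟩
      · exact fun α hα hne' => absurd ⟨α, hα, hne'⟩ h1
      · intro δ' hδ' hne'
        obtain ⟨γ, u, hu⟩ := List.exists_cons_of_ne_nil hb
        have ga := g2 _ hne
        have ga' := g2 _ hne'
        rw [hu] at ga ga'
        obtain rfl := D.ok_left_unique (good_append_iff (l := []).1 ga).2.2
          (good_append_iff (l := []).1 ga').2.2
        have := ht δ
        field_simp
    · exact ⟨0, fun α hα hne' => absurd ⟨α, hα, hne'⟩ h1, fun α hα hne' => absurd ⟨α, hα, hne'⟩ h2⟩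
  choose ζ hζ using key
  refine ⟨ζ, fun α => ⟨?_, ?_⟩⟩
  · by_cases h0 : B.cyc (D.tgt α) * B.wd [α] = 0
    · simp [h0]
    · rw [(hζ (D.tgt α)).1 α rfl h0]
  · by_cases h0 : B.wd [α] * B.cyc (D.src α) = 0
    · simp [h0]
    · rw [(hζ (D.src α)).2 α rfl h0]

end NormalForm

variable (D) in
open Classical in
/-- Equal to `1` if the detour of the arrow `α` is composed of a cycle, `α` and a cycle, and to `0`
otherwise. -/
def detourSign (k : Type*) [Field k] (α : E) : k :=
  if D.cycle (D.tgt α) ≠ [] ∧ D.cycle (D.src α) ≠ [] ∧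
    D.Good (D.cycle (D.tgt α) ++ α :: D.cycle (D.src α)) then 1 else 0

/-- Framing `α` by cycles on both sides gives, if nonzero, a detour, and the detour is unique. -/
theorem cyc_mul_wd_mul_cyc (α : E) :
    B.cyc (D.tgt α) * B.wd [α] * B.cyc (D.src α) = detourSign D k α • B.wd (D.detour α) := by
  rw [detourSign]
  split_ifs with hc
  · obtain ⟨h1, h2, h3⟩ := hc
    rw [← ((isCycle_cycle h1).isDetour (isCycle_cycle h2) h3).eq_detour, cyc, cyc,
      B.wd_mul h1 (by simp), B.wd_mul (by simp) h2]
    simp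
  · rw [zero_smul]
    by_cases h1 : D.cycle (D.tgt α) = []
    · simp [cyc, h1]
    by_cases h2 : D.cycle (D.src α) = []
    · simp [cyc, h2]
    rw [cyc, cyc, B.wd_mul h1 (by simp), B.wd_mul (by simp) h2, B.wd_of_not_good]
    intro h3
    exact hc ⟨h1, h2, by simpa using h3⟩

/-- The coefficient of the detour in the normal form of an automorphism, in terms of the image `z`
of the arrow `α` and of the inverse `s` of the coefficient of `α` in `z`. -/
def detourCf (α : E) (z : A) (s : k) : k :=
  B.cf (D.detour α) z * s - detourSign D k α *
    (B.cf (D.cycle (D.tgt α) ++ [α]) z * s) * (B.cf (α :: D.cycle (D.src α)) z * s)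

/-! ### Automorphisms that fix the vertices: the detour coefficients -/

section NormalForm

variable {h : A ≃ₐ[k] A}

/-- Conjugation produces both cycle terms and also `-ζ (tgt α) * ζ (src α)` times the doubly framed
arrow, a multiple of the detour. The correction in `detourCf` compensates for that multiple,
expressing the product of the two values of `ζ` by coefficients of the image, so that no choice of
`ζ` enters. -/
theorem exists_cycle_normalization (hv : ∀ a, h (B.ev a) = B.ev a)
    (ht : ∀ α, B.arrowCf h α α ≠ 0) : ∃ ζ : V → k, ∀ α, h (B.wd [α]) = B.arrowCf h α α •
    ((1 - B.cycSum ζ) * B.wd [α] * (1 + B.cycSum ζ) +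
      B.detourCf α (h (B.wd [α])) (B.arrowCf h α α)⁻¹ • B.wd (D.detour α)) := by
  obtain ⟨ζ, hζ⟩ := B.exists_cycle_coefficients hv ht
  refine ⟨ζ, fun α => ?_⟩
  obtain ⟨h1, h2⟩ := hζ α
  have e := B.map_arrow_expansion hv α
  rw [h1, h2] at e
  have e1 : (1 - B.cycSum ζ) * B.wd [α] * (1 + B.cycSum ζ) = B.wd [α] -
      ζ (D.tgt α) • (B.cyc (D.tgt α) * B.wd [α]) + ζ (D.src α) • (B.wd [α] * B.cyc (D.src α)) -
      (ζ (D.tgt α) * ζ (D.src α) * detourSign D k α) • B.wd (D.detour α) := by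
    rw [mul_smul, ← B.cyc_mul_wd_mul_cyc, sub_mul, one_mul, B.cycSum_mul_wd ζ (endsAt_singleton α),
      mul_add, mul_one, sub_mul, B.wd_mul_cycSum ζ (startsAt_singleton α), smul_mul_assoc,
      mul_assoc (B.cyc _), B.wd_mul_cycSum ζ (startsAt_singleton α), mul_smul_comm, smul_smul,
      mul_assoc (B.cyc _)]
    abel
  have hne := ht α
  have e2 : B.detourCf α (h (B.wd [α])) (B.arrowCf h α α)⁻¹ =
      B.cf (D.detour α) (h (B.wd [α])) * (B.arrowCf h α α)⁻¹ +
        ζ (D.tgt α) * ζ (D.src α) * detourSign D k α := by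
    rw [detourCf]
    by_cases hε : detourSign D k α = 0
    · simp [hε]
    -- If the doubly framed arrow is nonzero, both singly framed ones are, so `ζ` is read off from
    -- the cycle coefficients.
    have hw : B.cyc (D.tgt α) * B.wd [α] * B.cyc (D.src α) ≠ 0 := by
      rw [B.cyc_mul_wd_mul_cyc]
      refine smul_ne_zero hε fun h0 => ?_
      have hc : D.cycle (D.tgt α) ≠ [] ∧ D.cycle (D.src α) ≠ [] ∧
          D.Good (D.cycle (D.tgt α) ++ α :: D.cycle (D.src α)) := by
        by_contra hc
        exact hε (if_neg hc)
      have hd := (isCycle_cycle hc.1).isDetour (isCycle_cycle hc.2.1) hc.2.2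
      have := B.cf_wd_self hd.1
      rw [hd.eq_detour, h0, map_zero] at this
      exact zero_ne_one this
    have hw1 : B.cyc (D.tgt α) * B.wd [α] ≠ 0 := left_ne_zero_of_mul hw
    have hw2 : B.wd [α] * B.cyc (D.src α) ≠ 0 := by
      rw [mul_assoc] at hw
      exact right_ne_zero_of_mul hw
    rw [smul_left_injective k hw1 h1, smul_left_injective k hw2 h2]
    field_simp
    ring
  rw [e1, e2, add_smul]
  nth_rw 1 [e]
  have e3 : B.cf (D.detour α) (h (B.wd [α])) • B.wd (D.detour α) = B.arrowCf h α α •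
      (B.cf (D.detour α) (h (B.wd [α])) * (B.arrowCf h α α)⁻¹) • B.wd (D.detour α) := by
    rw [smul_smul]
    congr 1
    field_simp
  rw [e3]
  module

/-- The coefficient of the detour of an arrow in a relation vanishes. -/
theorem detourCf_eq_zero (hv : ∀ a, h (B.ev a) = B.ev a)
    (ht : ∀ α, B.arrowCf h α α ≠ 0) {α : E} (hα : ¬ D.Free α) (hd : D.detour α ≠ []) :
    B.detourCf α (h (B.wd [α])) (B.arrowCf h α α)⁻¹ = 0 := by
  obtain ⟨ζ, hζ⟩ := B.exists_cycle_normalization hv ht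
  have hdet := isDetour_detour hd
  set ν := B.cycSum ζ with hν
  have hν2 : (1 + ν) * (1 - ν) = 1 := by
    have := B.cycSum_mul_self ζ
    rw [← hν] at this
    noncomm_ring
    simp [this]
  simp only [Free, not_forall, not_and_or] at hα
  obtain ⟨β, ⟨hc, hn⟩ | ⟨hc, hn⟩⟩ := hα
  · have hrel : B.wd [α] * B.wd [β] = 0 := by
      rw [B.wd_mul (by simp) (by simp), B.wd_of_not_good]
      exact fun hg => hn (good_append_iff (l := []).1 hg).2.2
    -- Since `β` is already in a relation with `α`, it composes with the other arrow starting at the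
    -- same vertex, the last letter of the detour. The coefficient of this path in the image of `α β
    -- = 0` will isolate the coefficient of the detour.
    have hgood : D.Good (D.detour α ++ [β]) := by
      obtain ⟨l, e, hl⟩ := exists_append_singleton hd
      rw [hl] at hdet ⊢
      refine good_append_iff.2 ⟨hdet.1, Good.singleton β, ?_⟩
      by_contra hne
      have hs := hdet.2.1
      have hh := hdet.2.2.2.2
      simp only [StartsAt, List.getLast?_concat, Option.mem_def, Option.some.injEq,
        forall_eq'] at hs hh
      refine hh ?_
      rw [D.rel_left_unique (hc.trans hs.symm) hne hc hn]
    have key : h (B.wd [α]) * h (B.wd [β]) = 0 := by rw [← map_mul, hrel, map_zero]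
    have hL := congrArg (B.cf (D.detour α ++ [β])) key
    rw [map_zero, hζ β, mul_smul_comm, mul_add, mul_smul_comm, map_smul, map_add, map_smul,
      B.cf_concat_mul_detour, smul_zero, add_zero] at hL
    replace hL := (smul_eq_zero.1 hL).resolve_left (ht β)
    rw [hζ α, smul_mul_assoc, map_smul] at hL
    replace hL := (smul_eq_zero.1 hL).resolve_left (ht α)
    -- The undeformed parts are simultaneous conjugates of `α` and `β`, so their product still
    -- vanishes.
    have e1 : (1 - ν) * B.wd [α] * (1 + ν) * ((1 - ν) * B.wd [β] * (1 + ν)) = 0 := by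
      calc _ = (1 - ν) * B.wd [α] * ((1 + ν) * (1 - ν)) * B.wd [β] * (1 + ν) := by noncomm_ring
        _ = 0 := by rw [hν2, mul_one, mul_assoc (1 - ν), hrel, mul_zero, zero_mul]
    have e2 : B.wd (D.detour α) * ((1 - ν) * B.wd [β] * (1 + ν)) =
        B.wd (D.detour α ++ [β]) * (1 + ν) -
          ζ (D.tgt β) • (B.wd (D.detour α) * (B.cyc (D.tgt β) * B.wd [β]) * (1 + ν)) := by
      rw [sub_mul, one_mul, B.cycSum_mul_wd ζ (endsAt_singleton β), ← mul_assoc, mul_sub,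
        B.wd_mul hd (by simp), mul_smul_comm, sub_mul, smul_mul_assoc]
    have e3 : B.cf (D.detour α ++ [β])
        (B.wd (D.detour α) * (B.cyc (D.tgt β) * B.wd [β]) * (1 + ν)) = 0 := by
      by_cases h0 : D.cycle (D.tgt β) = []
      · simp [cyc, h0]
      -- With the cycle inserted the word is too long to be a prefix of the detour followed by `β`.
      rw [cyc, B.wd_mul h0 (by simp), B.wd_mul hd (by simp), B.cf_wd_mul_of_not_prefix]
      intro hp
      have h3 := hp.length_le
      have h4 := List.length_pos_iff.2 h0
      simp only [List.length_append, List.length_cons, List.length_nil] at h3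
      omega
    rw [add_mul, e1, zero_add, smul_mul_assoc, e2, map_smul, map_sub, map_smul, e3,
      B.cf_wd_mul hgood ((startsAt_append (by simp)).2 (startsAt_singleton β)), map_add,
      vcf_one, B.rad_cycSum ζ] at hL
    simpa using hL
  · have hrel : B.wd [β] * B.wd [α] = 0 := by
      rw [B.wd_mul (by simp) (by simp), B.wd_of_not_good]
      exact fun hg => hn (good_append_iff (l := []).1 hg).2.2
    have hgood : D.Good (β :: D.detour α) := by
      obtain ⟨e, l, hl⟩ := List.exists_cons_of_ne_nil hd
      rw [hl] at hdet ⊢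
      refine (good_append_iff (l := [])).2 ⟨Good.singleton β, hdet.1, ?_⟩
      by_contra hne
      have hs := hdet.2.2.1
      have hh := hdet.2.2.2.1
      simp only [EndsAt, List.head?_cons, Option.mem_def, Option.some.injEq,
        forall_eq'] at hs hh
      refine hh ?_
      rw [D.rel_right_unique (hs.trans hc) hne hc hn]
    have key : h (B.wd [β]) * h (B.wd [α]) = 0 := by rw [← map_mul, hrel, map_zero]
    have hL := congrArg (B.cf (β :: D.detour α)) key
    rw [map_zero, hζ β, smul_mul_assoc, add_mul, smul_mul_assoc, map_smul, map_add, map_smul,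
      B.cf_cons_detour_mul, smul_zero, add_zero] at hL
    replace hL := (smul_eq_zero.1 hL).resolve_left (ht β)
    rw [hζ α, mul_smul_comm, map_smul] at hL
    replace hL := (smul_eq_zero.1 hL).resolve_left (ht α)
    have e1 : (1 - ν) * B.wd [β] * (1 + ν) * ((1 - ν) * B.wd [α] * (1 + ν)) = 0 := by
      calc _ = (1 - ν) * B.wd [β] * ((1 + ν) * (1 - ν)) * B.wd [α] * (1 + ν) := by noncomm_ring
        _ = 0 := by rw [hν2, mul_one, mul_assoc (1 - ν), hrel, mul_zero, zero_mul]
    have e2 : (1 - ν) * B.wd [β] * (1 + ν) * B.wd (D.detour α) =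
        (1 - ν) * B.wd (β :: D.detour α) +
          ζ (D.src β) • ((1 - ν) * (B.wd [β] * B.cyc (D.src β) * B.wd (D.detour α))) := by
      rw [mul_assoc (1 - ν), mul_add, mul_one, B.wd_mul_cycSum ζ (startsAt_singleton β),
        mul_assoc (1 - ν), add_mul, smul_mul_assoc, mul_add, mul_smul_comm,
        B.wd_mul (by simp) hd]
      rfl
    have e3 : B.cf (β :: D.detour α)
        ((1 - ν) * (B.wd [β] * B.cyc (D.src β) * B.wd (D.detour α))) = 0 := by
      by_cases h0 : D.cycle (D.src β) = []
      · simp [cyc, h0]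
      rw [cyc, B.wd_mul (by simp) h0, B.wd_mul (by simp) hd, B.cf_mul_wd_of_not_suffix]
      intro hp
      have h3 := hp.length_le
      have h4 := List.length_pos_iff.2 h0
      simp only [List.length_append, List.length_cons, List.length_nil] at h3
      omega
    have hE : D.EndsAt (β :: D.detour α) (D.tgt β) := by simp [EndsAt]
    rw [mul_add, e1, zero_add, mul_smul_comm, e2, map_smul, map_add, map_smul, e3,
      B.cf_mul_wd hgood hE, map_sub, vcf_one, B.rad_cycSum ζ] at hL
    simpa using hL

/-- Conjugation by the unit `1 + ∑ ζ a • cyc a` undoes the cycle terms. It leaves the detour of a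
movable arrow unchanged, since that cannot be prolonged by a cycle; all other detour coefficients
vanish. -/
theorem exists_detour_normalForm (hv : ∀ a, h (B.ev a) = B.ev a)
    (ht : ∀ α, B.arrowCf h α α ≠ 0) : ∃ x : Aˣ, (∀ a, inner k x (h (B.ev a)) = B.ev a) ∧
    ∀ α, inner k x (h (B.wd [α])) = B.arrowCf h α α • (B.wd [α] + B.detourTerm (fun α =>
      B.detourCf α (h (B.wd [α])) (B.arrowCf h α α)⁻¹) [α]) := by
  obtain ⟨ζ, hζ⟩ := B.exists_cycle_normalization hv ht
  have hu : ∀ y : A, inner k (B.cycUnit ζ) y = (1 + B.cycSum ζ) * y * (1 - B.cycSum ζ) :=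
    fun y => rfl
  have hν := B.cycSum_mul_self ζ
  refine ⟨B.cycUnit ζ, fun a => ?_, fun α => ?_⟩
  · rw [hv, hu]
    have h1 := B.cycSum_mul_ev ζ a
    have h2 := B.ev_mul_cycSum ζ a
    rw [add_mul, one_mul, mul_sub, mul_one, add_mul, h1, h2, cycSum, Finset.mul_sum,
      Finset.sum_eq_zero fun b _ => by rw [smul_mul_smul_comm, cyc_mul_cyc, smul_zero]]
    abel
  · have hinv : ∀ y : A, (1 + B.cycSum ζ) * ((1 - B.cycSum ζ) * y * (1 + B.cycSum ζ)) *
        (1 - B.cycSum ζ) = y := by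
      intro y
      have e1 : (1 + B.cycSum ζ) * (1 - B.cycSum ζ) = 1 := (B.cycUnit ζ).val_inv
      calc _ = ((1 + B.cycSum ζ) * (1 - B.cycSum ζ)) * y *
            ((1 + B.cycSum ζ) * (1 - B.cycSum ζ)) := by simp only [mul_assoc]
        _ = y := by rw [e1, one_mul, mul_one]
    nth_rw 1 [hζ α]
    rw [hu, mul_smul_comm, smul_mul_assoc, mul_add, add_mul, hinv]
    congr 2
    by_cases hm : D.Movable α
    · rw [B.detourTerm_of_movable _ hm, mul_smul_comm, smul_mul_assoc, add_mul,
        B.cycSum_mul_wd ζ (endsAt_detour α)]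
      have e1 : B.cyc (D.tgt α) * B.wd (D.detour α) = 0 := by
        by_cases h0 : D.cycle (D.tgt α) = []
        · simp [cyc, h0]
        · rw [cyc, B.wd_mul h0 hm.2, B.wd_of_not_good (hm.isDetour.not_good_prepend hm.1 h0)]
      have e2 : B.wd (D.detour α) * B.cyc (D.src α) = 0 := by
        by_cases h0 : D.cycle (D.src α) = []
        · simp [cyc, h0]
        · rw [cyc, B.wd_mul hm.2 h0, B.wd_of_not_good (hm.isDetour.not_good_append hm.1 h0)]
      rw [e1, smul_zero, add_zero, one_mul, mul_sub, mul_one,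
        B.wd_mul_cycSum ζ (startsAt_detour α), e2, smul_zero, sub_zero]
    · rw [B.detourTerm_of_not_movable _ hm]
      by_cases hd : D.detour α = []
      · simp [hd]
      · rw [B.detourCf_eq_zero hv ht (fun hf => hm ⟨hf, hd⟩) hd]
        simp

end NormalForm

end PathBasis

/-! ## Normal forms of automorphisms modulo inner automorphisms -/

namespace PathBasis

open GentleDatum

variable {V E : Type*} [Fintype V] {D : GentleDatum V E} {k A : Type*} [Field k] [Ring A]
  [Algebra k A] (B : PathBasis D k A)

/-- The element that conjugates the vertices to their images under an automorphism. -/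
def vertexTransport (f : A ≃ₐ[k] A) : A := ∑ a, f (B.ev a) * B.ev a

theorem vcf_vertexTransport {f : A ≃ₐ[k] A} (hf : B.FixesVertices f) (a : V) :
    B.vcf a (B.vertexTransport f) = 1 := by
  rw [vertexTransport, map_sum, Finset.sum_eq_single a]
  · simp [hf a]
  · intro b _ hb
    rw [vcf_mul, B.vcf_ev_of_ne hb.symm, mul_zero]
  · simp

/-- The unit given by a scalar for each vertex. -/
def vertexUnit (s : V → kˣ) : Aˣ where
  val := ∑ a, (s a : k) • B.ev a
  inv := ∑ a, ((s a)⁻¹ : k) • B.ev a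
  val_inv := by
    rw [Finset.sum_mul_sum, ← B.sum_ev]
    refine Finset.sum_congr rfl fun a _ => ?_
    rw [Finset.sum_eq_single a]
    · simp
    · intro b _ hb
      rw [smul_mul_smul_comm, B.ev_mul_of_ne hb.symm, smul_zero]
    · simp
  inv_val := by
    rw [Finset.sum_mul_sum, ← B.sum_ev]
    refine Finset.sum_congr rfl fun a _ => ?_
    rw [Finset.sum_eq_single a]
    · simp
    · intro b _ hb
      rw [smul_mul_smul_comm, B.ev_mul_of_ne hb.symm, smul_zero]
    · simp

theorem sum_smul_ev_mul_ev (c : V → k) (a : V) : (∑ b, c b • B.ev b) * B.ev a = c a • B.ev a := by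
  rw [Finset.sum_mul, Finset.sum_eq_single a]
  · simp
  · intro b _ hb
    rw [smul_mul_assoc, B.ev_mul_of_ne hb, smul_zero]
  · simp

theorem ev_mul_sum_smul_ev (c : V → k) (a : V) : B.ev a * (∑ b, c b • B.ev b) = c a • B.ev a := by
  rw [Finset.mul_sum, Finset.sum_eq_single a]
  · simp
  · intro b _ hb
    rw [mul_smul_comm, B.ev_mul_of_ne hb.symm, smul_zero]
  · simp

theorem inner_vertexUnit (s : V → kˣ) {y : A} {a b : V} (ha : B.ev b * y = y)
    (hb : y * B.ev a = y) : inner k (B.vertexUnit s) y = ((s b / s a : kˣ) : k) • y := by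
  have h1 : ((B.vertexUnit s : Aˣ) : A) * y = (s b : k) • y := by
    rw [← ha, ← mul_assoc]
    change (∑ a, (s a : k) • B.ev a) * B.ev b * y = _
    rw [sum_smul_ev_mul_ev, smul_mul_assoc]
  have h2 : y * (((B.vertexUnit s)⁻¹ : Aˣ) : A) = ((s a)⁻¹ : k) • y := by
    rw [← hb, mul_assoc]
    change y * (B.ev a * ∑ a, ((s a)⁻¹ : k) • B.ev a) = _
    rw [B.ev_mul_sum_smul_ev (fun a => ((s a)⁻¹ : k)), mul_smul_comm]
  rw [inner_apply, h1, smul_mul_assoc, h2, smul_smul, Units.val_div_eq_div_val, div_eq_mul_inv]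

/-- A detour is parallel to its arrow, so both are scaled alike: `t` changes by a coboundary and `n`
not at all. -/
theorem inner_vertexUnit_comp_deform (s : V → kˣ) (n : E → k) (t : E → kˣ) :
    ((inner k (B.vertexUnit s) : A ≃ₐ[k] A) : A →ₐ[k] A).comp (B.deform n t) =
      B.deform n (t * D.coboundary s) := by
  refine B.algHom_ext (fun a => ?_) fun α => ?_
  · have := B.inner_vertexUnit s (B.ev_mul_self a) (B.ev_mul_self a)
    simpa using this
  · rw [AlgHom.comp_apply, deform_wd, deform_wd, map_smul, along_singleton, along_singleton]
    have := B.inner_vertexUnit s (y := B.wd [α] + B.detourTerm n [α]) (a := D.src α) (b := D.tgt α)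
      (by rw [mul_add, B.ev_mul_wd (endsAt_singleton α),
        (B.ev_mul_detourTerm n [α] _).1 (endsAt_singleton α)])
      (by rw [add_mul, B.wd_mul_ev (startsAt_singleton α),
        (B.detourTerm_mul_ev n [α] _).1 (startsAt_singleton α)])
    change (t α : k) • inner k (B.vertexUnit s) (B.wd [α] + B.detourTerm n [α]) = _
    rw [this, smul_smul, Pi.mul_apply, Units.val_mul, coboundary]

/-! ### Straightening the images of the vertices -/

section

variable [Finite E]

/-- A number such that the power with this exponent of each element of the radical vanishes. -/
def nilpotencyBound : ℕ := B.exists_pow_eq_zero_of_rad.choose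

theorem pow_nilpotencyBound {x : A} (hx : B.Rad x) : x ^ B.nilpotencyBound = 0 :=
  B.exists_pow_eq_zero_of_rad.choose_spec x hx

/-- The inverse of `vertexTransport` if the automorphism induces the identity modulo the
radical. -/
def vertexTransportInv (f : A ≃ₐ[k] A) : A :=
  ∑ i ∈ Finset.range B.nilpotencyBound, (1 - B.vertexTransport f) ^ i

/-- The conjugate of an automorphism that fixes the vertices. -/
def straighten (f : A ≃ₐ[k] A) (y : A) : A := B.vertexTransportInv f * f y * B.vertexTransport f

/-- The element `p = ∑ f (ev a) * ev a` satisfies `f (ev a) * p = p * ev a` and is congruent to 1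
modulo the radical, so a finite geometric sum inverts it. Conjugation by `p⁻¹` then restores the
vertices. -/
theorem exists_straighten {f : A ≃ₐ[k] A} (hf : B.FixesVertices f) :
    ∃ x : Aˣ, (∀ a, B.vcf a x = 1) ∧ (∀ y, inner k x (f y) = B.straighten f y) ∧
      ∀ a, inner k x (f (B.ev a)) = B.ev a := by
  have hrad : B.Rad (1 - B.vertexTransport f) := fun a => by
    rw [map_sub, vcf_one, B.vcf_vertexTransport hf, sub_self]
  have hpow := B.pow_nilpotencyBound hrad
  have h1 : B.vertexTransportInv f * B.vertexTransport f = 1 := by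
    have := geom_sum_mul (1 - B.vertexTransport f) B.nilpotencyBound
    rw [hpow, sub_sub_cancel_left, mul_neg, zero_sub, neg_inj] at this
    exact this
  have h2 : B.vertexTransport f * B.vertexTransportInv f = 1 := by
    have := mul_geom_sum (1 - B.vertexTransport f) B.nilpotencyBound
    rw [hpow, sub_sub_cancel_left, neg_mul, zero_sub, neg_inj] at this
    exact this
  have hev : ∀ a, f (B.ev a) * B.vertexTransport f = B.vertexTransport f * B.ev a := by
    intro a
    rw [vertexTransport, Finset.mul_sum, Finset.sum_mul, Finset.sum_eq_single a,
      Finset.sum_eq_single a]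
    · rw [← mul_assoc, ← map_mul, ev_mul_self, mul_assoc, ev_mul_self]
    · intro b _ hb
      rw [mul_assoc, B.ev_mul_of_ne hb, mul_zero]
    · simp
    · intro b _ hb
      rw [← mul_assoc, ← map_mul, B.ev_mul_of_ne hb.symm, map_zero, zero_mul]
    · simp
  refine ⟨⟨B.vertexTransportInv f, B.vertexTransport f, h1, h2⟩, fun a => ?_, fun y => rfl,
    fun a => ?_⟩
  · have := congrArg (B.vcf a) h1
    rwa [vcf_mul, B.vcf_vertexTransport hf, mul_one, vcf_one] at this
  · change B.vertexTransportInv f * f (B.ev a) * B.vertexTransport f = B.ev a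
    rw [mul_assoc, hev, ← mul_assoc, h1, one_mul]

/-- The coefficient of the detour of an arrow in the normal form of an automorphism. -/
def normalVec (f : A ≃ₐ[k] A) (α : E) : k :=
  -- For neutral `f` the diagonal coefficient of `f⁻¹` is the inverse of that of `f`; using it
  -- avoids division and keeps the expression regular.
  B.detourCf α (B.straighten f (B.wd [α])) (B.arrowCf f⁻¹ α α)

end

open Classical in
/-- The coefficients of the arrows in the normal form of an automorphism. -/
def normalTor (f : A ≃ₐ[k] A) (α : E) : kˣ :=
  if h : B.arrowCf f α α ≠ 0 then Units.mk0 _ h else 1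

variable [Fintype E]

theorem Neutral.normalTor {B : PathBasis D k A} {f : A ≃ₐ[k] A} (hf : B.Neutral f) (α : E) :
    (B.normalTor f α : k) = B.arrowCf f α α ∧ (B.normalTor f α : k)⁻¹ = B.arrowCf f⁻¹ α α := by
  have h := hf.arrowCf_mul_inv α
  rw [PathBasis.normalTor, dif_pos (left_ne_zero_of_mul_eq_one h)]
  exact ⟨rfl, (eq_inv_of_mul_eq_one_right h).symm⟩

/-- The straightening unit has all vertex coefficients 1, so it does not change the arrow
coefficients; the vertex-fixing normal form then applies to the conjugate. -/
theorem exists_deform {f : A ≃ₐ[k] A} (hf : B.Neutral f) :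
    ∃ x : Aˣ, ((inner k x * f : A ≃ₐ[k] A) : A →ₐ[k] A) =
      B.deform (B.normalVec f) (B.normalTor f) := by
  obtain ⟨x, hx1, hx, hxv⟩ := B.exists_straighten hf.1
  have hx1' : ∀ a, B.vcf a (x⁻¹ : Aˣ) = 1 := fun a => by
    simpa [hx1 a] using B.vcf_mul_vcf_inv x a
  have hcf : ∀ α, B.arrowCf (inner k x * f) α α = B.normalTor f α := fun α => by
    rw [arrowCf_inner_mul, hx1, hx1', (hf.normalTor α).1, one_mul, one_mul]
  obtain ⟨y, hyv, hy⟩ := B.exists_detour_normalForm (h := inner k x * f) hxv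
    (fun α => by rw [hcf]; exact Units.ne_zero _)
  refine ⟨y * x, B.algHom_ext (fun a => ?_) fun α => ?_⟩
  · have := hyv a
    change inner k y (inner k x (f (B.ev a))) = B.ev a at this
    rw [deform_ev]
    refine Eq.trans ?_ this
    change inner k (y * x) (f (B.ev a)) = inner k y (inner k x (f (B.ev a)))
    simp [inner_apply, mul_assoc]
  · have e1 : ((inner k (y * x) * f : A ≃ₐ[k] A) : A →ₐ[k] A) (B.wd [α]) =
        inner k y ((inner k x * f) (B.wd [α])) := by
      change inner k (y * x) (f (B.wd [α])) = inner k y (inner k x (f (B.wd [α])))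
      simp [inner_apply, mul_assoc]
    rw [e1, hy, deform_wd, along_singleton, hcf]
    congr 3
    funext β
    rw [hcf, (hf.normalTor β).2, normalVec, ← hx]
    rfl

end PathBasis

/-! ## The parametrization of the outer automorphisms -/

namespace GentleDatum

variable {V E : Type*} (D : GentleDatum V E) {k : Type*} [Field k] {m b : ℕ}
  (eM : Fin m ≃ {α // D.Movable α}) {T : Finset E} (eB : Fin b ≃ {α // α ∉ T})

open Classical in
/-- Extension by zero of a function on the movable arrows. -/
def extVec (n : Fin m → k) (α : E) : k := if h : D.Movable α then n (eM.symm ⟨α, h⟩) else 0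

theorem extVec_apply (n : Fin m → k) {α : E} (h : D.Movable α) :
    D.extVec eM n α = n (eM.symm ⟨α, h⟩) := dif_pos h

open Classical in
/-- Extension by one of a function on the arrows outside of a spanning tree. -/
def extTor (eB : Fin b ≃ {α // α ∉ T}) : (Fin b → kˣ) →* (E → kˣ) where
  toFun t α := if h : α ∉ T then t (eB.symm ⟨α, h⟩) else 1
  map_one' := by
    ext α
    simp
  map_mul' t t' := by
    funext α
    simp only [Pi.mul_apply]
    split_ifs <;> simp

theorem extTor_apply_of_notMem (t : Fin b → kˣ) {α : E} (h : α ∉ T) :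
    extTor eB t α = t (eB.symm ⟨α, h⟩) := dif_pos h

theorem extTor_apply_of_mem (t : Fin b → kˣ) {α : E} (h : α ∈ T) :
    extTor eB t α = 1 := dif_neg (not_not_intro h)

/-- The character by which the torus acts on the coefficient of a detour. -/
def detourChar (j : Fin m) : (Fin b → kˣ) →* kˣ where
  toFun t := along (extTor eB t) (D.detour (eM j).1) / extTor eB t (eM j).1
  map_one' := by simp
  map_mul' t t' := by
    simp [mul_div_mul_comm]

theorem detourChar_apply (j : Fin m) (t : Fin b → kˣ) :
    D.detourChar eM eB j t = along (extTor eB t) (D.detour (eM j).1) / extTor eB t (eM j).1 := rfl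

theorem extTor_apply_mem_laurentMonomials (α : E) :
    (fun t => extTor eB t α) ∈ laurentMonomials k (Fin b) := by
  by_cases h : α ∈ T
  · convert one_mem (laurentMonomials k (Fin b)) using 1
    exact funext fun t => extTor_apply_of_mem eB t h
  · convert coord_mem_laurentMonomials (k := k) (eB.symm ⟨α, h⟩) using 1
    exact funext fun t => extTor_apply_of_notMem eB t h

theorem along_extTor_mem_laurentMonomials (l : List E) :
    (fun t => along (extTor eB t) l) ∈ laurentMonomials k (Fin b) := by
  induction l with
  | nil => exact one_mem _
  | cons α l ih => exact mul_mem (extTor_apply_mem_laurentMonomials eB α) ih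

theorem detourChar_mem_laurentMonomials (j : Fin m) :
    ⇑(D.detourChar (k := k) eM eB j) ∈ laurentMonomials k (Fin b) :=
  div_mem (along_extTor_mem_laurentMonomials eB _) (extTor_apply_mem_laurentMonomials eB _)

theorem extTor_restrict {t : E → kˣ} (h : ∀ α ∈ T, t α = 1) :
    extTor eB (fun i => t (eB i).1) = t := by
  funext α
  by_cases hα : α ∈ T
  · rw [extTor_apply_of_mem eB _ hα, h α hα]
  · rw [extTor_apply_of_notMem eB _ hα]
    simp

/-- The torus acts nontrivially on the coefficient of each detour. -/
theorem exists_detourChar_ne_one [Infinite k] {s : V → (E → kˣ) → kˣ}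
    (hs : ∀ α ∈ T, ∀ t, t α * D.coboundary (fun a => s a t) α = 1) (j : Fin m) :
    ∃ t, D.detourChar (k := k) eM eB j t ≠ 1 := by
  classical
  obtain ⟨c, hc⟩ : ∃ c : kˣ, c ≠ 1 := by
    obtain ⟨c, hc⟩ := Infinite.exists_notMem_finset ({0, 1} : Finset k)
    simp only [Finset.mem_insert, Finset.mem_singleton, not_or] at hc
    exact ⟨Units.mk0 c hc.1, fun h => hc.2 (congrArg Units.val h)⟩
  obtain ⟨α, hα⟩ : ∃ α, α = (eM j).1 := ⟨_, rfl⟩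
  have hm : D.Movable α := hα ▸ (eM j).2
  -- Scaling only the last letter `β` of the detour works: `β` is not `α` and occurs just once, so
  -- the quotient is `c`. Normalizing on the tree multiplies by a coboundary, which cancels between
  -- parallel paths.
  obtain ⟨l, β, hl⟩ := exists_append_singleton hm.2
  have hβ : α ≠ β := by
    have := hm.isDetour.2.2.2.2
    rw [hl, List.getLast?_concat] at this
    exact fun h => this (h ▸ rfl)
  let t : E → kˣ := Function.update 1 β c
  have ht : along t (D.detour α) / t α = c := by
    have hnd := hm.good.nodup
    rw [hl] at hnd ⊢
    have h1 : along t l = 1 := by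
      rw [along, List.prod_eq_one]
      intro x hx
      obtain ⟨γ, hγ, rfl⟩ := List.mem_map.1 hx
      have : γ ≠ β := by
        rintro rfl
        simp [List.nodup_append] at hnd
        exact hnd.2 _ hγ rfl
      simp [t, this]
    rw [along_append, along_singleton, h1]
    simp [t, hβ]
  let t' : E → kˣ := t * D.coboundary fun a => s a t
  have ht' : ∀ α ∈ T, t' α = 1 := fun α h => hs α h t
  refine ⟨fun i => t' (eB i).1, ?_⟩
  rw [detourChar_apply, extTor_restrict eB ht', ← hα, along_mul,
    along_coboundary _ hm.good hm.isDetour.2.1 hm.isDetour.2.2.1]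
  have : t' α = t α * D.coboundary (fun a => s a t) α := rfl
  rw [this, coboundary, mul_div_mul_right_eq_div, ht]
  exact hc

end GentleDatum

namespace PathBasis

open GentleDatum

variable {V E : Type*} [Fintype V] {D : GentleDatum V E} {k A : Type*} [Field k] [Ring A]
  [Algebra k A] (B : PathBasis D k A) {m b : ℕ}
  (eM : Fin m ≃ {α // D.Movable α}) {T : Finset E} (eB : Fin b ≃ {α // α ∉ T})

/-- The homomorphism from the semidirect product to the endomorphisms of the algebra. -/
def deformHom : TorusVector (D.detourChar (k := k) eM eB) →* (A →ₐ[k] A) where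
  toFun x := B.deform (D.extVec eM x.vec) (extTor eB x.tor)
  map_one' := by
    have : D.extVec eM (0 : Fin m → k) = 0 := by
      funext α
      simp [extVec]
    rw [TorusVector.one_vec, TorusVector.one_tor, map_one, this]
    exact B.deform_one
  map_mul' x y := by
    symm
    rw [TorusVector.mul_tor, map_mul]
    refine B.deform_comp_deform fun α hα => ?_
    rw [extVec_apply _ _ _ hα, extVec_apply _ _ _ hα, extVec_apply _ _ _ hα, TorusVector.mul_vec,
      detourChar_apply]
    simp

/-- The homomorphism from the semidirect product to the automorphisms of the algebra. -/
def param : TorusVector (D.detourChar (k := k) eM eB) →* (A ≃ₐ[k] A) :=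
  (AlgEquiv.algHomUnitsEquiv k A).toMonoidHom.comp (B.deformHom eM eB).toHomUnits

theorem param_apply (x : TorusVector (D.detourChar (k := k) eM eB)) (y : A) :
    B.param eM eB x y = B.deform (D.extVec eM x.vec) (extTor eB x.tor) y := rfl

theorem param_arrow (x : TorusVector (D.detourChar (k := k) eM eB)) (α : E) :
    B.param eM eB x (B.wd [α]) =
      (extTor eB x.tor α : k) • (B.wd [α] + B.detourTerm (D.extVec eM x.vec) [α]) := by
  rw [param_apply, deform_wd, along_singleton]

/-- If the map is conjugation by `y`, the coefficient of `α` gives `t α * y (src α) = y (tgt α)`. On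
the tree `t = 1`, so the vertex coefficients of `y` are all equal, and hence `t = 1` everywhere. The
coefficient of the detour then gives `n α * y (src α) = 0`. -/
theorem eq_one_of_param_mem_inn {x : TorusVector (D.detourChar (k := k) eM eB)}
    (hT : ∀ x : V → kˣ, (∀ α ∈ T, x (D.tgt α) = x (D.src α)) → ∀ a b, x a = x b)
    (hx : B.param eM eB x ∈ Inn k A) : x = 1 := by
  obtain ⟨y, hy⟩ := exists_inner_of_mem hx
  have key : ∀ α, (extTor eB x.tor α : k) • (B.wd [α] + B.detourTerm (D.extVec eM x.vec) [α]) *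
      (y : A) = y * B.wd [α] := by
    intro α
    rw [← param_arrow, hy, inner_apply, mul_assoc, Units.inv_mul, mul_one]
  have h1 : ∀ α, (extTor eB x.tor α : k) * B.vcf (D.src α) y = B.vcf (D.tgt α) y := by
    intro α
    have h0 : B.cf [α] (B.detourTerm (D.extVec eM x.vec) [α]) = 0 := by
      by_cases hα : D.Movable α
      · rw [B.detourTerm_of_movable _ hα, map_smul, B.cf_wd_of_ne hα.detour_ne_singleton.symm,
          smul_zero]
      · rw [B.detourTerm_of_not_movable _ hα, map_zero]
    have := congrArg (B.cf [α]) (key α)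
    rw [smul_mul_assoc, map_smul, cf_singleton_mul, cf_singleton_mul, map_add, map_add, h0,
      B.rad_detourTerm, vcf_wd, vcf_wd, B.cf_wd_self (Good.singleton α)] at this
    simpa using this
  let z : V → kˣ := fun a => Units.mk0 (B.vcf a y) (B.vcf_unit_ne_zero y a)
  have hz : ∀ a b, z a = z b := hT z fun α hα => by
    have := h1 α
    rw [extTor_apply_of_mem eB _ hα] at this
    exact Units.ext (by simpa [z] using this.symm)
  have ht : ∀ α, extTor eB x.tor α = 1 := fun α => by
    have := h1 α
    have h2 : B.vcf (D.tgt α) y = B.vcf (D.src α) y :=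
      congrArg Units.val (hz (D.tgt α) (D.src α))
    rw [h2] at this
    refine Units.ext (mul_right_cancel₀ (B.vcf_unit_ne_zero y (D.src α)) ?_)
    simpa using this
  ext j
  · obtain ⟨α, hα⟩ : ∃ α, α = eM j := ⟨_, rfl⟩
    have hm := α.2
    have hk := congrArg (B.cf (D.detour α.1)) (key α.1)
    have hp : ¬ [α.1] <+: D.detour α.1 := by
      rintro ⟨l, hl⟩
      exact hm.isDetour.2.2.2.1 (by rw [← hl]; rfl)
    have hs : ¬ [α.1] <:+ D.detour α.1 := by
      rintro ⟨l, hl⟩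
      exact hm.isDetour.2.2.2.2 (by rw [← hl, List.getLast?_concat])
    rw [ht, Units.val_one, one_smul, add_mul, map_add, B.cf_wd_mul_of_not_prefix hp,
      B.cf_mul_wd_of_not_suffix hs, B.detourTerm_of_movable _ hm, smul_mul_assoc, map_smul,
      B.cf_wd_mul hm.good hm.isDetour.2.1, zero_add, smul_eq_mul, mul_eq_zero] at hk
    have := hk.resolve_right (B.vcf_unit_ne_zero y _)
    rw [extVec_apply _ _ _ hm] at this
    simpa [hα] using this
  · have := ht (eB j).1
    rw [extTor_apply_of_notMem eB _ (eB j).2] at this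
    simpa using congrArg Units.val this

variable [Fintype E] {s : V → (E → kˣ) → kˣ}

variable (s) in
/-- The parameters of the normal form of an automorphism. -/
def normalParam (f : A ≃ₐ[k] A) : TorusVector (D.detourChar (k := k) eM eB) where
  vec j := B.normalVec f (eM j).1
  tor i := B.normalTor f (eB i).1 *
    D.coboundary (fun a => s a (B.normalTor f)) (eB i).1

/-- After `exists_deform`, the vertex unit given by the spanning tree data makes the torus part
trivial on `T`. The detour coefficients stay unchanged. -/
theorem exists_param (hs : ∀ α ∈ T, ∀ t, t α * D.coboundary (fun a => s a t) α = 1)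
    {f : A ≃ₐ[k] A} (hf : B.Neutral f) :
    ∃ x : Aˣ, inner k x * f = B.param eM eB (B.normalParam eM eB s f) := by
  obtain ⟨x, hx⟩ := B.exists_deform hf
  let z : V → kˣ := fun a => s a (B.normalTor f)
  refine ⟨B.vertexUnit z * x, ?_⟩
  have h1 : extTor eB (B.normalParam eM eB s f).tor = B.normalTor f * D.coboundary z :=
    extTor_restrict eB (t := B.normalTor f * D.coboundary z) fun α hα => hs α hα _
  have h2 : B.deform (D.extVec eM (B.normalParam eM eB s f).vec)
      (extTor eB (B.normalParam eM eB s f).tor) =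
      B.deform (B.normalVec f) (B.normalTor f * D.coboundary z) := by
    rw [h1]
    refine B.algHom_ext (by simp) fun α => ?_
    rw [deform_wd, deform_wd]
    congr 2
    by_cases hα : D.Movable α
    · rw [B.detourTerm_of_movable _ hα, B.detourTerm_of_movable _ hα, extVec_apply _ _ _ hα]
      simp [normalParam]
    · rw [B.detourTerm_of_not_movable _ hα, B.detourTerm_of_not_movable _ hα]
  ext y
  rw [param_apply, h2, ← inner_vertexUnit_comp_deform, ← hx]
  change inner k (B.vertexUnit z * x) (f y) = inner k (B.vertexUnit z) (inner k x (f y))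
  simp [inner_apply, mul_assoc]

end PathBasis

/-! ## Regular functions on the automorphism group -/

section AutRegular

variable {k A : Type*} [Field k] [Ring A] [Algebra k A]

theorem apply_mem_autRegular (φ : A →ₗ[k] k) (a : A) : (fun f => φ (f a)) ∈ autRegular k A :=
  Algebra.subset_adjoin (Or.inl ⟨φ, a, rfl⟩)

theorem inv_apply_mem_autRegular (φ : A →ₗ[k] k) (a : A) :
    (fun f => φ (f⁻¹ a)) ∈ autRegular k A :=
  Algebra.subset_adjoin (Or.inr ⟨φ, a, rfl⟩)

/-- The map from the automorphism group to the algebra has regular coordinates. -/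
def HasRegularCoords (k : Type*) {A : Type*} [Field k] [Ring A] [Algebra k A]
    (g : (A ≃ₐ[k] A) → A) : Prop :=
  ∀ φ : A →ₗ[k] k, (fun f => φ (g f)) ∈ autRegular k A

namespace HasRegularCoords

variable {g h : (A ≃ₐ[k] A) → A}

theorem const (a : A) : HasRegularCoords k fun _ : A ≃ₐ[k] A => a :=
  fun φ => (autRegular k A).algebraMap_mem (φ a)

theorem apply (a : A) : HasRegularCoords k fun f : A ≃ₐ[k] A => f a :=
  fun φ => apply_mem_autRegular φ a

theorem sum {ι : Type*} {s : Finset ι} {g : ι → (A ≃ₐ[k] A) → A}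
    (hg : ∀ i ∈ s, HasRegularCoords k (g i)) : HasRegularCoords k fun f => ∑ i ∈ s, g i f :=
  fun φ => mem_of_forall_eq (sum_mem fun i hi => hg i hi φ) fun f => by simp

theorem sub (hg : HasRegularCoords k g) (hh : HasRegularCoords k h) :
    HasRegularCoords k fun f => g f - h f :=
  fun φ => mem_of_forall_eq (sub_mem (hg φ) (hh φ)) fun f => by simp

theorem mul [Module.Finite k A] (hg : HasRegularCoords k g) (hh : HasRegularCoords k h) :
    HasRegularCoords k fun f => g f * h f := by
  intro φ
  let b := Module.finBasis k A
  refine mem_of_forall_eq (sum_mem (t := Finset.univ) fun i _ => sum_mem (t := Finset.univ)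
    fun j _ => mul_mem (mul_mem (hg (b.coord i)) (hh (b.coord j)))
      ((autRegular k A).algebraMap_mem (φ (b i * b j)))) fun f => ?_
  change φ (g f * h f) = _
  conv_lhs => rw [← b.sum_repr (g f), ← b.sum_repr (h f)]
  simp only [Finset.sum_mul_sum, map_sum, smul_mul_smul_comm, map_smul, Finset.sum_apply,
    Pi.mul_apply, smul_eq_mul, Module.Basis.coord_apply]
  rfl

theorem pow [Module.Finite k A] (hg : HasRegularCoords k g) (n : ℕ) :
    HasRegularCoords k fun f => g f ^ n := by
  induction n with
  | zero => simpa using const (1 : A)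
  | succ n ih => simpa only [pow_succ] using ih.mul hg

end HasRegularCoords

end AutRegular

namespace PathBasis

open GentleDatum

variable {V E : Type*} [Fintype V] {D : GentleDatum V E} {k A : Type*} [Field k]
  [Ring A] [Algebra k A] (B : PathBasis D k A)

theorem moduleFinite [Finite E] (B : PathBasis D k A) : Module.Finite k A := by
  have : Finite {l // D.Good l} := D.finite_good
  exact Module.Finite.of_basis B.basis

theorem arrowCf_mem_autRegular (α β : E) : (fun f => B.arrowCf f α β) ∈ autRegular k A :=
  apply_mem_autRegular _ _

theorem arrowCf_inv_mem_autRegular (α β : E) : (fun f => B.arrowCf f⁻¹ α β) ∈ autRegular k A :=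
  inv_apply_mem_autRegular _ _

theorem neutral_congr {f g : A ≃ₐ[k] A}
    (h : (QuotientGroup.mk f : Out k A) = QuotientGroup.mk g) : B.Neutral f ↔ B.Neutral g := by
  rw [QuotientGroup.eq_iff_div_mem] at h
  obtain ⟨x, hx⟩ := exists_inner_of_mem h
  rw [← B.neutral_inner_mul (x := x) (f := g), ← hx, div_mul_cancel]

/-! ### Regularity of the parametrization -/

section Param

variable {m b : ℕ} (eM : Fin m ≃ {α // D.Movable α}) {T : Finset E} (eB : Fin b ≃ {α // α ∉ T})

theorem apply_param_mem_regular (φ : A →ₗ[k] k) (a : A) :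
    (fun x => φ (B.param eM eB x a)) ∈ TorusVector.regular (D.detourChar (k := k) eM eB) := by
  induction a using B.induction with
  | zero => exact mem_of_forall_eq (zero_mem _) fun x => by simp
  | add y z hy hz => exact mem_of_forall_eq (add_mem hy hz) fun x => by simp
  | smul c y hy => exact mem_of_forall_eq (Subalgebra.smul_mem _ hy c) fun x => by simp
  | vertex a =>
    refine mem_of_forall_eq (Subalgebra.algebraMap_mem _ (φ (B.ev a))) fun x => ?_
    rw [param_apply, deform_ev]
    rfl
  | word l hl =>
    have hd : (fun x : TorusVector (D.detourChar (k := k) eM eB) =>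
        φ (B.detourTerm (D.extVec eM x.vec) l)) ∈ TorusVector.regular _ := by
      by_cases h : ∃ α, l = [α] ∧ D.Movable α
      · obtain ⟨α, rfl, hα⟩ := h
        refine mem_of_forall_eq (Subalgebra.smul_mem _
          (TorusVector.vec_mem_regular (eM.symm ⟨α, hα⟩)) (φ (B.wd (D.detour α)))) fun x => ?_
        rw [B.detourTerm_of_movable _ hα, extVec_apply _ _ _ hα, map_smul]
        simp [mul_comm]
      · refine mem_of_forall_eq (zero_mem _) fun x => ?_
        have : B.detourTerm (D.extVec eM x.vec) l = 0 := by
          unfold detourTerm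
          split
          · exact if_neg fun h' => h ⟨_, rfl, h'⟩
          · rfl
        simp [this]
    refine mem_of_forall_eq (mul_mem (TorusVector.monomial_mem_regular
      (along_extTor_mem_laurentMonomials eB l)).1
      (add_mem (Subalgebra.algebraMap_mem _ (φ (B.wd l))) hd)) fun x => ?_
    rw [param_apply, deform_wd, map_smul, map_add]
    rfl

theorem comp_param_mem_regular {F : (A ≃ₐ[k] A) → k} (hF : F ∈ autRegular k A) :
    (fun x => F (B.param eM eB x)) ∈ TorusVector.regular (D.detourChar (k := k) eM eB) := by
  have h : autRegular k A ≤ (TorusVector.regular (D.detourChar (k := k) eM eB)).comap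
      (pullback k (B.param eM eB)) := by
    refine Algebra.adjoin_le ?_
    rintro _ (⟨φ, a, rfl⟩ | ⟨φ, a, rfl⟩)
    · exact mem_comap_pullback.2 (B.apply_param_mem_regular eM eB φ a)
    · refine mem_comap_pullback.2 (mem_of_forall_eq (TorusVector.comp_inv_mem_regular
        (D.detourChar_mem_laurentMonomials eM eB) (B.apply_param_mem_regular eM eB φ a))
        fun x => ?_)
      rw [map_inv]
  exact h hF

end Param

/-! ### Regularity of the normal form, and the clopen set of neutral automorphisms -/

variable [Fintype E]

/-- The inverse of the transport is a polynomial in the transport whose number of terms does not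
depend on `f`. -/
theorem hasRegularCoords_straighten (y : A) : HasRegularCoords k fun f => B.straighten f y := by
  have := B.moduleFinite
  have h1 : HasRegularCoords k B.vertexTransport :=
    .sum fun a _ => (HasRegularCoords.apply _).mul (.const _)
  exact ((HasRegularCoords.sum fun i _ => ((HasRegularCoords.const 1).sub h1).pow i).mul
    (.apply y)).mul h1

theorem normalVec_mem_autRegular (α : E) : (fun f => B.normalVec f α) ∈ autRegular k A := by
  have hs := B.hasRegularCoords_straighten (B.wd [α])
  have hi := B.arrowCf_inv_mem_autRegular α α
  exact sub_mem (mul_mem (hs _) hi) (mul_mem (mul_mem ((autRegular k A).algebraMap_mem _)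
    (mul_mem (hs _) hi)) (mul_mem (hs _) hi))

theorem neutralIndicator_mem_autRegular : B.neutralIndicator ∈ autRegular k A := by
  classical
  refine mem_of_forall_eq (mul_mem
    (prod_mem (t := Finset.univ) fun a _ => apply_mem_autRegular (B.vcf a) (B.ev a))
    (prod_mem (t := Finset.univ.filter fun α => ¬ D.Free α) fun α _ =>
      mul_mem (B.arrowCf_mem_autRegular α α) (B.arrowCf_inv_mem_autRegular α α))) fun f => ?_
  simp only [neutralIndicator, Pi.mul_apply, Finset.prod_apply]

/-- A regular function with values in `{0, 1}` has clopen fibres. -/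
theorem isClopen_setOf_neutral :
    IsClosed[zariskiTopology (autRegular k A)] {f | B.Neutral f} ∧
      IsOpen[zariskiTopology (autRegular k A)] {f | B.Neutral f} := by
  have h : {f | B.Neutral f} = {f | B.neutralIndicator f = (1 : (A ≃ₐ[k] A) → k) f} := by
    ext f
    by_cases hf : B.Neutral f
    · simp [hf, B.neutralIndicator_of_neutral hf]
    · simp [hf, B.neutralIndicator_of_not_neutral hf]
  have h' : {f | B.Neutral f} = {f | B.neutralIndicator f ≠ 0} := by
    ext f
    by_cases hf : B.Neutral f
    · simp [hf, B.neutralIndicator_of_neutral hf]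
    · simp [hf, B.neutralIndicator_of_not_neutral hf]
  refine ⟨?_, ?_⟩
  · rw [h]
    exact isClosed_zariski_of_eq B.neutralIndicator_mem_autRegular (one_mem _)
  · rw [h']
    exact TopologicalSpace.isOpen_generateFrom_of_mem ⟨_, B.neutralIndicator_mem_autRegular, rfl⟩

/-- Neutrality passes to outer classes, where it defines a clopen set containing the identity and
hence its component. -/
theorem neutral_of_mk_mem_outNeutral {f : A ≃ₐ[k] A}
    (hf : (QuotientGroup.mk f : Out k A) ∈ OutNeutral k A) : B.Neutral f := by
  let := zariskiTopology (autRegular k A)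
  let := outTopology k A
  let N : Set (Out k A) := QuotientGroup.mk '' {f | B.Neutral f}
  have hN : QuotientGroup.mk ⁻¹' N = {f | B.Neutral f} := by
    ext f
    refine ⟨?_, fun h => ⟨f, h, rfl⟩⟩
    rintro ⟨g, hg, h⟩
    exact (B.neutral_congr h).1 hg
  have hclopen : IsClopen N := by
    refine ⟨⟨?_⟩, ?_⟩
    · rw [isOpen_coinduced, Set.preimage_compl, hN]
      exact B.isClopen_setOf_neutral.1.isOpen_compl
    · rw [isOpen_coinduced, hN]
      exact B.isClopen_setOf_neutral.2
  have h1 : (1 : Out k A) ∈ N := by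
    refine ⟨1, ⟨FixesVertices.one, fun α _ => ?_⟩, rfl⟩
    simp [arrowCf, B.cf_wd_self (Good.singleton α)]
  have : QuotientGroup.mk f ∈ N := hclopen.connectedComponent_subset h1 hf
  exact hN.subset this

end PathBasis

/-! ## Connectedness -/

/-- The nonvanishing sets are stable under finite intersections, by multiplying the functions, so
they form a basis and not just a subbasis. -/
theorem exists_ne_zero_of_isOpen_zariski {k G : Type*} [Field k] {R : Subalgebra k (G → k)}
    {U : Set G} (hU : IsOpen[zariskiTopology R] U) {x : G} (hx : x ∈ U) :
    ∃ F ∈ R, F x ≠ 0 ∧ ∀ y, F y ≠ 0 → y ∈ U := by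
  induction hU with
  | basic U h =>
    obtain ⟨F, hF, rfl⟩ := h
    exact ⟨F, hF, hx, fun _ h => h⟩
  | univ => exact ⟨1, one_mem _, one_ne_zero, fun _ _ => trivial⟩
  | inter U U' _ _ h h' =>
    obtain ⟨F, hF, h1, h2⟩ := h hx.1
    obtain ⟨F', hF', h1', h2'⟩ := h' hx.2
    refine ⟨F * F', mul_mem hF hF', mul_ne_zero h1 h1', fun y hy => ⟨h2 y ?_, h2' y ?_⟩⟩
    · exact left_ne_zero_of_mul hy
    · exact right_ne_zero_of_mul hy
  | sUnion S _ h =>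
    obtain ⟨U, hU, hx⟩ := hx
    obtain ⟨F, hF, h1, h2⟩ := h U hU hx
    exact ⟨F, hF, h1, fun y hy => ⟨U, hU, h2 y hy⟩⟩

theorem continuous_zariski {k G H : Type*} [Field k] {R : Subalgebra k (G → k)}
    {R' : Subalgebra k (H → k)} {f : G → H} (hf : ∀ F ∈ R', (fun x => F (f x)) ∈ R) :
    Continuous[zariskiTopology R, zariskiTopology R'] f := by
  let := zariskiTopology R
  refine continuous_generateFrom_iff.2 ?_
  rintro _ ⟨F, hF, rfl⟩
  exact TopologicalSpace.isOpen_generateFrom_of_mem ⟨_, hf F hF, rfl⟩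

/-- The image of a cofinite subset of the affine line under a rational map is connected. -/
theorem isPreconnected_image_of_rational {k G : Type*} [Field k] [Infinite k]
    {R : Subalgebra k (G → k)} {γ : k → G} {d : Polynomial k}
    (hγ : ∀ F ∈ R, ∃ (p : Polynomial k) (N : ℕ), ∀ s, d.eval s ≠ 0 →
      F (γ s) * d.eval s ^ N = p.eval s) :
    @IsPreconnected _ (zariskiTopology R) (γ '' {s | d.eval s ≠ 0}) := by
  let := zariskiTopology R
  refine IsPreirreducible.isPreconnected ?_
  rintro U U' hU hU' ⟨_, ⟨s, hs, rfl⟩, hsU⟩ ⟨_, ⟨s', hs', rfl⟩, hsU'⟩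
  obtain ⟨F, hF, h1, h2⟩ := exists_ne_zero_of_isOpen_zariski hU hsU
  obtain ⟨F', hF', h1', h2'⟩ := exists_ne_zero_of_isOpen_zariski hU' hsU'
  obtain ⟨p, N, hp⟩ := hγ F hF
  obtain ⟨p', N', hp'⟩ := hγ F' hF'
  have hp0 : p ≠ 0 := by
    rintro rfl
    have := hp s hs
    rw [Polynomial.eval_zero] at this
    exact mul_ne_zero h1 (pow_ne_zero _ hs) this
  have hp0' : p' ≠ 0 := by
    rintro rfl
    have := hp' s' hs'
    rw [Polynomial.eval_zero] at this
    exact mul_ne_zero h1' (pow_ne_zero _ hs') this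
  have hd0 : d ≠ 0 := by
    rintro rfl
    exact hs Polynomial.eval_zero
  -- Over an infinite field a product of nonzero polynomials has a nonzero value; at such a point
  -- both open sets are met, so the image is irreducible.
  obtain ⟨r, hr⟩ : ∃ r, (p * p' * d).eval r ≠ 0 := by
    by_contra! h
    exact mul_ne_zero (mul_ne_zero hp0 hp0') hd0 (Polynomial.funext fun r => by simp [h r])
  rw [Polynomial.eval_mul, Polynomial.eval_mul] at hr
  have hd := right_ne_zero_of_mul hr
  refine ⟨γ r, ⟨r, hd, rfl⟩, h2 _ fun h => ?_, h2' _ fun h => ?_⟩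
  · exact left_ne_zero_of_mul (left_ne_zero_of_mul hr) (by rw [← hp r hd, h, zero_mul])
  · exact right_ne_zero_of_mul (left_ne_zero_of_mul hr) (by rw [← hp' r hd, h, zero_mul])

namespace TorusVector

variable {k : Type w} [Field k] {m b : ℕ} {χ : Fin m → ((Fin b → kˣ) →* kˣ)}

open Polynomial in
open Classical in
/-- Each element is joined to the identity by a connected set. -/
theorem exists_isPreconnected [Infinite k] (x : TorusVector χ) :
    ∃ S : Set (TorusVector χ), @IsPreconnected _ (zariskiTopology (regular χ)) S ∧ 1 ∈ S ∧ x ∈ S := by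
  -- The straight line from the identity at `s = 0` to `x` at `s = 1`, defined where no torus
  -- coordinate vanishes. Elsewhere the coordinate is set to 1, a value that is never used.
  let L : Fin b → k[X] := fun i => 1 + X * C ((x.tor i : k) - 1)
  let d : k[X] := ∏ i, L i
  let γ : k → TorusVector χ := fun s =>
    ⟨fun j => s * x.vec j, fun i => if h : (L i).eval s ≠ 0 then Units.mk0 _ h else 1⟩
  have hd : ∀ s, d.eval s ≠ 0 → ∀ i, (L i).eval s ≠ 0 := fun s hs i h =>
    hs (by rw [Polynomial.eval_prod]; exact Finset.prod_eq_zero (Finset.mem_univ i) h)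
  have htor : ∀ s, d.eval s ≠ 0 → ∀ i, ((γ s).tor i : k) = (L i).eval s := fun s hs i => by
    simp only [γ]
    rw [dif_pos (hd s hs i)]
    rfl
  refine ⟨γ '' {s | d.eval s ≠ 0}, isPreconnected_image_of_rational fun F hF => ?_,
    ⟨0, ?_, ?_⟩, ⟨1, ?_, ?_⟩⟩
  · induction hF using Algebra.adjoin_induction with
    | mem F hF =>
      obtain ((⟨j, rfl⟩ | ⟨i, rfl⟩) | ⟨i, rfl⟩) := hF
      · exact ⟨X * C (x.vec j), 0, fun s _ => by simp [γ, mul_comm s]⟩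
      · exact ⟨L i, 0, fun s hs => by beta_reduce; rw [htor s hs, pow_zero, mul_one]⟩
      · refine ⟨∏ i' ∈ Finset.univ.erase i, L i', 1, fun s hs => ?_⟩
        have : d = L i * ∏ i' ∈ Finset.univ.erase i, L i' :=
          (Finset.mul_prod_erase _ _ (Finset.mem_univ i)).symm
        beta_reduce
        rw [htor s hs, pow_one, this, eval_mul, inv_mul_cancel_left₀ (hd s hs i)]
    | algebraMap c => exact ⟨C c, 0, fun s _ => by simp⟩
    | add F G _ _ hF hG =>
      obtain ⟨p, N, hp⟩ := hF
      obtain ⟨q, M, hq⟩ := hG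
      refine ⟨p * d ^ M + q * d ^ N, N + M, fun s hs => ?_⟩
      simp only [eval_add, eval_mul, eval_pow, Pi.add_apply]
      rw [← hp s hs, ← hq s hs]
      ring
    | mul F G _ _ hF hG =>
      obtain ⟨p, N, hp⟩ := hF
      obtain ⟨q, M, hq⟩ := hG
      refine ⟨p * q, N + M, fun s hs => ?_⟩
      simp only [eval_mul, Pi.mul_apply]
      rw [← hp s hs, ← hq s hs]
      ring
  · simp [d, L, Polynomial.eval_prod]
  · ext j
    · simp [γ]
    · simp [γ, L]
  · simp [d, L, Polynomial.eval_prod, Finset.prod_eq_zero_iff]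
  · ext j
    · simp [γ]
    · simp [γ, L]

end TorusVector

/-! ## The neutral component of the group of outer automorphisms -/

namespace PathBasis

open GentleDatum

variable {V E : Type*} [Fintype V] {D : GentleDatum V E} {k A : Type*} [Field k]
  [Ring A] [Algebra k A] (B : PathBasis D k A) {m b : ℕ}
  (eM : Fin m ≃ {α // D.Movable α}) {T : Finset E} (eB : Fin b ≃ {α // α ∉ T})

/-- The parametrization is continuous and every parameter is joined to the identity by a connected
set. -/
theorem mk_param_mem_outNeutral [Infinite k] (x : TorusVector (D.detourChar (k := k) eM eB)) :
    (QuotientGroup.mk (B.param eM eB x) : Out k A) ∈ OutNeutral k A := by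
  obtain ⟨S, hS, h1, hx⟩ := TorusVector.exists_isPreconnected x
  let := zariskiTopology (TorusVector.regular (D.detourChar (k := k) eM eB))
  let := zariskiTopology (autRegular k A)
  let := outTopology k A
  have hc : Continuous fun x => (QuotientGroup.mk (B.param eM eB x) : Out k A) :=
    (continuous_coinduced_rng (f := (QuotientGroup.mk : (A ≃ₐ[k] A) → Out k A))).comp
      (continuous_zariski fun F hF => B.comp_param_mem_regular eM eB hF)
  exact (hS.image _ hc.continuousOn).subset_connectedComponent
    ⟨1, h1, by beta_reduce; rw [map_one]; rfl⟩ ⟨x, hx, rfl⟩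

variable [Fintype E] {s : V → (E → kˣ) → kˣ}

theorem mk_eq_mk_param (hs : ∀ α ∈ T, ∀ t, t α * D.coboundary (fun a => s a t) α = 1)
    {f : A ≃ₐ[k] A} (hf : B.Neutral f) :
    (QuotientGroup.mk f : Out k A) =
      QuotientGroup.mk (B.param eM eB (B.normalParam eM eB s f)) := by
  obtain ⟨x, hx⟩ := B.exists_param eM eB hs hf
  rw [eq_comm, ← hx, QuotientGroup.eq_iff_div_mem, mul_div_cancel_right]
  exact inner_mem x

/-- A regular function on a closed subgroup has to be a restriction. Here extension by zero is
regular, since on automorphisms it is `G` times the indicator of neutrality; this uses that neutral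
classes are exactly those in the neutral component. -/
theorem mem_outNeutralRegular [Infinite k] (B : PathBasis D k A)
    (hs : ∀ α ∈ T, ∀ t, t α * D.coboundary (fun a => s a t) α = 1)
    {F : OutNeutral k A → k} {G : (A ≃ₐ[k] A) → k} (hG : G ∈ autRegular k A)
    (h : ∀ (f : A ≃ₐ[k] A) (hf : (QuotientGroup.mk f : Out k A) ∈ OutNeutral k A),
      F ⟨_, hf⟩ = G f) : F ∈ outNeutralRegular k A := by
  classical
  refine ⟨fun y => if hy : y ∈ OutNeutral k A then F ⟨y, hy⟩ else 0, ?_, ?_⟩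
  · refine mem_comap_pullback.2 <|
      mem_of_forall_eq (mul_mem B.neutralIndicator_mem_autRegular hG) fun f => ?_
    change (if hy : (QuotientGroup.mk f : Out k A) ∈ OutNeutral k A then F ⟨_, hy⟩ else 0) =
      B.neutralIndicator f * G f
    split_ifs with hf
    · rw [B.neutralIndicator_of_neutral (B.neutral_of_mk_mem_outNeutral hf), one_mul, h f hf]
    · have : ¬ B.Neutral f := by
        intro hn
        obtain ⟨eM⟩ := Finite.exists_equiv_fin {α // D.Movable α} |>.choose_spec
        obtain ⟨eB⟩ := Finite.exists_equiv_fin {α // α ∉ T} |>.choose_spec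
        rw [B.mk_eq_mk_param eM.symm eB.symm hs hn] at hf
        exact hf (B.mk_param_mem_outNeutral _ _ _)
      rw [B.neutralIndicator_of_not_neutral this, zero_mul]
  · funext y
    exact dif_pos y.2

/-- The structure of the neutral component of the group of outer automorphisms. -/
theorem exists_outNeutral_equiv [Infinite k] [Nonempty V] (B : PathBasis D k A) :
    ∃ (m : ℕ) (χ : Fin m → ((Fin (Fintype.card E + 1 - Fintype.card V) → kˣ) →* kˣ))
      (e : OutNeutral k A ≃* TorusVector χ),
      (∀ j, ⇑(χ j) ∈ laurentMonomials k _) ∧ (∀ j, ∃ t, χ j t ≠ 1) ∧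
      IsRegularIso (outNeutralRegular k A) (TorusVector.regular χ) e := by
  classical
  obtain ⟨T, s, hcard, hsm, hs, hT⟩ := exists_spanningTree (D := D) k
  have eM := (Fintype.equivFin {α // D.Movable α}).symm
  have eB : Fin (Fintype.card E + 1 - Fintype.card V) ≃ {α // α ∉ T} := by
    refine (Fintype.equivFinOfCardEq ?_).symm
    rw [Fintype.card_subtype_compl, Fintype.card_coe]
    omega
  let Φ : TorusVector (D.detourChar (k := k) eM eB) →* OutNeutral k A :=
    ((QuotientGroup.mk' (Inn k A)).comp (B.param eM eB)).codRestrict _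
      (B.mk_param_mem_outNeutral eM eB)
  have hΦ : ∀ (f : A ≃ₐ[k] A) (hf : (QuotientGroup.mk f : Out k A) ∈ OutNeutral k A),
      Φ (B.normalParam eM eB s f) = ⟨_, hf⟩ := fun f hf => Subtype.ext
    (B.mk_eq_mk_param eM eB hs (B.neutral_of_mk_mem_outNeutral hf)).symm
  have hbij : Function.Bijective Φ := by
    refine ⟨(injective_iff_map_eq_one _).2 fun x hx => ?_, ?_⟩
    · refine B.eq_one_of_param_mem_inn eM eB hT ?_
      exact (QuotientGroup.eq_one_iff _).1 (congrArg Subtype.val hx)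
    · rintro ⟨y, hy⟩
      obtain ⟨f, rfl⟩ := QuotientGroup.mk_surjective y
      exact ⟨_, hΦ f hy⟩
  let e := (MulEquiv.ofBijective Φ hbij).symm
  have he : ∀ (f : A ≃ₐ[k] A) (hf : (QuotientGroup.mk f : Out k A) ∈ OutNeutral k A),
      e ⟨_, hf⟩ = B.normalParam eM eB s f := fun f hf => by
    rw [MulEquiv.symm_apply_eq]
    exact (hΦ f hf).symm
  refine ⟨_, _, e, D.detourChar_mem_laurentMonomials eM eB,
    D.exists_detourChar_ne_one eM eB hs, fun F => ⟨fun hF => ?_, ?_⟩⟩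
  -- The torus parameters are Laurent monomials in the diagonal arrow coefficients, whose inverses
  -- are regular as coefficients of `f⁻¹`.
  · have hmon : ∀ i, (fun t : E → kˣ => t (eB i).1 * D.coboundary (fun a => s a t) (eB i).1) ∈
        laurentMonomials k E := fun i =>
      mul_mem (coord_mem_laurentMonomials _) (div_mem (hsm _) (hsm _))
    have hreg := fun i => exists_mem_of_mem_laurentMonomials (R := autRegular k A)
      (Y := {f | B.Neutral f}) (t := B.normalTor)
      (fun α => ⟨_, B.arrowCf_mem_autRegular α α, fun f hf => (hf.normalTor α).1⟩)
      (fun α => ⟨_, B.arrowCf_inv_mem_autRegular α α, fun f hf => (hf.normalTor α).2⟩) (hmon i)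
    have hle : TorusVector.regular (D.detourChar (k := k) eM eB) ≤
        (outNeutralRegular k A).comap (pullback k e) := by
      refine Algebra.adjoin_le ?_
      rintro _ ((⟨j, rfl⟩ | ⟨i, rfl⟩) | ⟨i, rfl⟩)
      · refine B.mem_outNeutralRegular hs (B.normalVec_mem_autRegular (eM j).1) fun f hf => ?_
        change (e ⟨_, hf⟩).vec j = _
        rw [he]
        rfl
      · obtain ⟨G, hG, h⟩ := (hreg i).1
        refine B.mem_outNeutralRegular hs hG fun f hf => ?_
        change ((e ⟨_, hf⟩).tor i : k) = _
        rw [he, ← h f (B.neutral_of_mk_mem_outNeutral hf)]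
        rfl
      · obtain ⟨G, hG, h⟩ := (hreg i).2
        refine B.mem_outNeutralRegular hs hG fun f hf => ?_
        change ((e ⟨_, hf⟩).tor i : k)⁻¹ = _
        rw [he, ← h f (B.neutral_of_mk_mem_outNeutral hf)]
        rfl
    exact hle hF
  · rintro ⟨G, hG, hGF⟩
    refine mem_of_forall_eq (B.comp_param_mem_regular eM eB hG) fun x => ?_
    have := congrFun hGF (Φ x)
    change _ = F (e (Φ x)) at this
    rw [show e (Φ x) = x from (MulEquiv.ofBijective Φ hbij).symm_apply_apply x] at this
    exact this.symm

end PathBasis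

/-! ## The combinatorial datum of a gentle quiver with relations -/

/-- All arrows of a quiver. -/
abbrev QArrow (V : Type u) [Quiver.{v} V] : Type (max u v) := Σ a b : V, a ⟶ b

section Words

variable {V : Type u} [Quiver.{v} V] (P : Set (QPath V))

/-- The path `β α` is defined and not a relation. -/
inductive ArrowsOk : QArrow V → QArrow V → Prop
  | mk {a b c : V} (α : a ⟶ b) (β : b ⟶ c) (h : twoPath α β ∉ P) : ArrowsOk ⟨b, c, β⟩ ⟨a, b, α⟩

variable {P}

theorem arrowsOk_iff {a b c : V} {α : a ⟶ b} {β : b ⟶ c} :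
    ArrowsOk P ⟨b, c, β⟩ ⟨a, b, α⟩ ↔ twoPath α β ∉ P :=
  ⟨fun h => by cases h with | mk _ _ h => exact h, fun h => .mk α β h⟩

/-- The arrows of a path, the last one first. -/
def pathWord {a : V} : ∀ {b : V}, Path a b → List (QArrow V)
  | _, Path.nil => []
  | _, Path.cons p e => ⟨_, _, e⟩ :: pathWord p

@[simp] theorem pathWord_nil (a : V) : pathWord (Path.nil : Path a a) = [] := rfl

@[simp] theorem pathWord_cons {a b c : V} (p : Path a b) (e : b ⟶ c) :
    pathWord (p.cons e) = ⟨b, c, e⟩ :: pathWord p := rfl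

@[simp] theorem pathWord_comp {a b c : V} (p : Path a b) (q : Path b c) :
    pathWord (p.comp q) = pathWord q ++ pathWord p := by
  induction q with
  | nil => rfl
  | cons q e ih => simp [ih]

theorem length_pathWord {a b : V} (p : Path a b) : (pathWord p).length = p.length := by
  induction p with
  | nil => rfl
  | cons p e ih => simp [ih]

theorem pathWord_eq_nil {a b : V} {p : Path a b} (h : pathWord p = []) :
    (⟨a, b, p⟩ : QPath V) = ⟨a, a, Path.nil⟩ := by
  cases p with
  | nil => rfl
  | cons p e => simp at h

theorem head?_pathWord {a b : V} (p : Path a b) : ∀ α ∈ (pathWord p).head?, α.2.1 = b := by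
  cases p with
  | nil => simp
  | cons p e => simp

theorem getLast?_pathWord {a b : V} (p : Path a b) : ∀ α ∈ (pathWord p).getLast?, α.1 = a := by
  induction p with
  | nil => simp
  | cons p e ih =>
    intro α hα
    rw [pathWord_cons, List.getLast?_cons] at hα
    cases h : (pathWord p).getLast? with
    | none =>
      rw [h] at hα
      rw [List.getLast?_eq_none_iff] at h
      have := pathWord_eq_nil h
      cases this
      simp at hα
      rw [← hα]
    | some β =>
      rw [h] at hα
      simp at hα
      exact hα ▸ ih β h

/-- The empty word does not remember its vertex, so a common end point is assumed. -/
theorem pathWord_injective {a b : V} (p : Path a b) {a' : V} (q : Path a' b)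
    (h : pathWord p = pathWord q) : (⟨a, b, p⟩ : QPath V) = ⟨a', b, q⟩ := by
  induction p generalizing a' with
  | nil =>
    cases q with
    | nil => rfl
    | cons q e => simp at h
  | cons p e ih =>
    cases q with
    | nil => simp at h
    | cons q e' =>
      rw [pathWord_cons, pathWord_cons, List.cons.injEq] at h
      obtain ⟨h1, h2⟩ := h
      cases h1
      cases ih q h2
      rfl

theorem pathWord_injective_of_ne_nil {p q : QPath V} (hp : pathWord p.2.2 ≠ [])
    (h : pathWord p.2.2 = pathWord q.2.2) : p = q := by
  obtain ⟨a, b, p⟩ := p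
  obtain ⟨a', b', q⟩ := q
  dsimp only at hp h
  obtain ⟨α, l, hl⟩ := List.exists_cons_of_ne_nil hp
  have hb : b = b' :=
    (head?_pathWord p α (by rw [hl]; rfl)).symm.trans
      (head?_pathWord q α (by rw [← h, hl]; rfl))
  subst hb
  exact pathWord_injective p q h

theorem exists_pathWord_eq {l : List (QArrow V)} (hl : l ≠ []) (h : l.IsChain (ArrowsOk P)) :
    ∃ q : QPath V, pathWord q.2.2 = l := by
  induction l with
  | nil => exact absurd rfl hl
  | cons β l ih =>
    obtain _ | ⟨α, l⟩ := l
    · exact ⟨⟨β.1, β.2.1, Path.nil.cons β.2.2⟩, rfl⟩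
    · rw [List.isChain_cons_cons] at h
      obtain ⟨⟨a, b, q⟩, hq⟩ := ih (by simp) h.2
      have hb := head?_pathWord q α (by rw [hq]; rfl)
      obtain ⟨h1, -⟩ := h
      cases h1 with
      | mk α β h1 =>
        dsimp only at hb
        subst hb
        exact ⟨⟨a, _, q.cons β⟩, by rw [pathWord_cons, hq]⟩

/-- Relations have length two, so a subpath in `P` is a pair of consecutive arrows. -/
theorem hasSubpathIn_iff (hP : ∀ p ∈ P, p.2.2.length = 2) {a b : V} (p : Path a b) :
    HasSubpathIn P p ↔ ¬ (pathWord p).IsChain (ArrowsOk P) := by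
  constructor
  · rintro ⟨c, d, x, y, z, rfl, hy⟩ hch
    have hlen := hP _ hy
    cases y with
    | nil => simp at hlen
    | cons y β =>
      cases y with
      | nil => simp at hlen
      | cons y α =>
        cases y with
        | nil =>
          rw [pathWord_comp, pathWord_comp] at hch
          have := hch.right_of_append.left_of_append
          simp only [pathWord_cons, pathWord_nil, List.isChain_cons_cons] at this
          exact arrowsOk_iff.1 this.1 hy
        | cons y γ => simp at hlen
  · intro h
    induction p with
    | nil => simp at h
    | cons p e ih =>
      by_cases hp : (pathWord p).IsChain (ArrowsOk P)
      · cases p with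
        | nil => simp at h
        | cons p e' =>
          have : ¬ ArrowsOk P ⟨_, _, e⟩ ⟨_, _, e'⟩ := fun h' =>
            h (List.isChain_cons_cons.2 ⟨h', hp⟩)
          rw [arrowsOk_iff, not_not] at this
          exact ⟨_, _, p, e'.toPath.comp e.toPath, Path.nil, rfl, this⟩
      · obtain ⟨c, d, x, y, z, rfl, hy⟩ := ih hp
        exact ⟨c, d, x, y, z.cons e, rfl, hy⟩

end Words

theorem eq_or_eq_or_eq_of_mk_le_two {X : Type*} (h : Cardinal.mk X ≤ 2) (x y z : X) :
    x = y ∨ x = z ∨ y = z := by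
  by_contra! hne
  obtain ⟨h1, h2, h3⟩ := hne
  have hinj : Function.Injective ![x, y, z] := by
    intro i j hij
    fin_cases i <;> fin_cases j <;> simp_all [eq_comm]
  have := (Cardinal.mk_le_of_injective
    (f := fun i : ULift (Fin 3) => ![x, y, z] i.down) (hinj.comp ULift.down_injective)).trans h
  rw [Cardinal.mk_uLift, Cardinal.mk_fin] at this
  norm_num at this

namespace IsGentle

variable {V : Type u} [Quiver.{v} V] {P : Set (QPath V)}

theorem arrowsOk_right_unique (hP : IsGentle P) {β α α' : QArrow V} (h : ArrowsOk P β α)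
    (h' : ArrowsOk P β α') : α = α' := by
  cases h with
  | mk α β h =>
    cases h' with
    | mk α' _ h' =>
      have := hP.pred_not_mem β (x := ⟨_, α⟩) h (y := ⟨_, α'⟩) h'
      cases this
      rfl

theorem arrowsOk_left_unique (hP : IsGentle P) {β β' α : QArrow V} (h : ArrowsOk P β α)
    (h' : ArrowsOk P β' α) : β = β' := by
  cases h with
  | mk α β h =>
    cases h' with
    | mk _ β' h' =>
      have := hP.succ_not_mem α (x := ⟨_, β⟩) h (y := ⟨_, β'⟩) h'
      cases this
      rfl

theorem rel_right_unique (hP : IsGentle P) {β α α' : QArrow V} (h : α.2.1 = β.1)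
    (h1 : ¬ ArrowsOk P β α) (h' : α'.2.1 = β.1) (h1' : ¬ ArrowsOk P β α') : α = α' := by
  obtain ⟨b, c, β⟩ := β
  obtain ⟨a, b1, α⟩ := α
  obtain ⟨a', b2, α'⟩ := α'
  dsimp only at h h'
  subst h h'
  rw [arrowsOk_iff, not_not] at h1 h1'
  have := hP.pred_mem β (x := ⟨_, α⟩) h1 (y := ⟨_, α'⟩) h1'
  cases this
  rfl

theorem rel_left_unique (hP : IsGentle P) {β β' α : QArrow V} (h : α.2.1 = β.1)
    (h1 : ¬ ArrowsOk P β α) (h' : α.2.1 = β'.1) (h1' : ¬ ArrowsOk P β' α) : β = β' := by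
  obtain ⟨a, b, α⟩ := α
  obtain ⟨b1, c, β⟩ := β
  obtain ⟨b2, c', β'⟩ := β'
  dsimp only at h h'
  subst h h'
  rw [arrowsOk_iff, not_not] at h1 h1'
  have := hP.succ_mem α (x := ⟨_, β⟩) h1 (y := ⟨_, β'⟩) h1'
  cases this
  rfl

/-- There are finitely many arrows, so the bounds for paths ending with a given arrow have a common
upper bound. -/
theorem exists_length_le (hP : IsGentle P) [Finite (QArrow V)] :
    ∃ L : ℕ, ∀ l : List (QArrow V), l.IsChain (ArrowsOk P) → l.length ≤ L := by
  have := Fintype.ofFinite (QArrow V)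
  choose n hn using fun β : QArrow V => hP.bounded β.2.2
  refine ⟨Finset.univ.sup n, fun l hl => ?_⟩
  by_cases h0 : l = []
  · simp [h0]
  obtain ⟨⟨a, b, q⟩, hq⟩ := exists_pathWord_eq h0 hl
  cases q with
  | nil => exact absurd hq.symm h0
  | cons q e =>
    by_contra! hlt
    have h1 := (hn ⟨_, _, e⟩).1 _ q <| by
      rw [← length_pathWord]
      refine le_trans (Finset.le_sup (Finset.mem_univ _)) (hlt.le.trans ?_)
      rw [← hq]
      rfl
    rw [hasSubpathIn_iff hP.length_two] at h1
    refine h1 ?_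
    rw [← hq] at hl
    exact hl

theorem out_le_two (hP : IsGentle P) {α β γ : QArrow V} (h : α.1 = β.1) (h' : α.1 = γ.1) :
    α = β ∨ α = γ ∨ β = γ := by
  obtain ⟨a, α⟩ := α
  obtain ⟨a1, β⟩ := β
  obtain ⟨a2, γ⟩ := γ
  dsimp only at h h'
  subst h h'
  simpa using eq_or_eq_or_eq_of_mk_le_two (hP.card_out a) α β γ

theorem in_le_two (hP : IsGentle P) {α β γ : QArrow V} (h : α.2.1 = β.2.1)
    (h' : α.2.1 = γ.2.1) : α = β ∨ α = γ ∨ β = γ := by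
  obtain ⟨a, b, α⟩ := α
  obtain ⟨a1, b1, β⟩ := β
  obtain ⟨a2, b2, γ⟩ := γ
  dsimp only at h h'
  subst h h'
  let f : (Σ a : V, a ⟶ b) → QArrow V := fun x => ⟨x.1, b, x.2⟩
  have := eq_or_eq_or_eq_of_mk_le_two (hP.card_in b) ⟨a, α⟩ ⟨a1, β⟩ ⟨a2, γ⟩
  exact this.imp (fun h => congrArg f h) (Or.imp (fun h => congrArg f h) fun h => congrArg f h)

end IsGentle

theorem QuiverConnected.eq_univ {V : Type u} [Quiver.{v} V] (h : QuiverConnected V) {W : Set V}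
    (hW : W.Nonempty) (hW' : ∀ α : QArrow V, α.1 ∈ W ↔ α.2.1 ∈ W) : W = Set.univ := by
  obtain ⟨a, ha⟩ := hW
  refine Set.eq_univ_of_forall fun b => ?_
  obtain ⟨p⟩ := h.2 a b
  induction p with
  | nil => exact ha
  | cons p e ih =>
    obtain e | e := e
    · exact (hW' ⟨_, _, e⟩).1 ih
    · exact (hW' ⟨_, _, e⟩).2 ih

namespace IsGentle

variable {V : Type u} [Quiver.{v} V] {P : Set (QPath V)}

/-- An arrow into the common source would compose with both arrows, against uniqueness of
continuations; so no arrow enters the source, and likewise none leaves the target. As at most two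
arrows start or end at a vertex, the two end points form a connected component, and the quiver is
the Kronecker quiver. -/
theorem eq_of_parallel (hP : IsGentle P) (hconn : QuiverConnected V)
    (hK : ¬ IsKroneckerQuiver V) {α α' : QArrow V} (hs : α.1 = α'.1) (ht : α.2.1 = α'.2.1)
    (h : ∀ β : QArrow V, (β.2.1 = α.1 → ArrowsOk P α β) ∧ (α.2.1 = β.1 → ArrowsOk P β α))
    (h' : ∀ β : QArrow V, (β.2.1 = α'.1 → ArrowsOk P α' β) ∧ (α'.2.1 = β.1 → ArrowsOk P β α')) :
    α = α' := by
  by_contra hne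
  have hin : ∀ β : QArrow V, β.2.1 ≠ α.1 := fun β hβ =>
    hne (hP.arrowsOk_left_unique ((h β).1 hβ) ((h' β).1 (hβ.trans hs)))
  have hout : ∀ β : QArrow V, β.1 ≠ α.2.1 := fun β hβ =>
    hne (hP.arrowsOk_right_unique ((h β).2 hβ.symm) ((h' β).2 (ht.symm.trans hβ.symm)))
  have hsrc : ∀ β : QArrow V, β.1 = α.1 → β = α ∨ β = α' := fun β hβ => by
    obtain h1 | h1 | h1 := hP.out_le_two hs hβ.symm
    · exact absurd h1 hne
    · exact Or.inl h1.symm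
    · exact Or.inr h1.symm
  have htgt : ∀ β : QArrow V, β.2.1 = α.2.1 → β = α ∨ β = α' := fun β hβ => by
    obtain h1 | h1 | h1 := hP.in_le_two ht hβ.symm
    · exact absurd h1 hne
    · exact Or.inl h1.symm
    · exact Or.inr h1.symm
  have hW := hconn.eq_univ (W := {α.1, α.2.1}) ⟨_, Or.inl rfl⟩ fun β => by
    constructor
    · rintro (hβ | hβ)
      · obtain rfl | rfl := hsrc β hβ
        · exact Or.inr rfl
        · exact Or.inr ht.symm
      · exact absurd hβ (hout β)
    · rintro (hβ | hβ)
      · exact absurd hβ (hin β)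
      · obtain rfl | rfl := htgt β hβ
        · exact Or.inl rfl
        · exact Or.inl hs.symm
  obtain ⟨a, b, α⟩ := α
  obtain ⟨a', b', α'⟩ := α'
  dsimp only at hs ht
  subst hs ht
  refine hK ⟨a, b, fun hab => hin ⟨a, b, α⟩ hab.symm, fun c => ?_, ?_, ⟨fun e => hin ⟨_, _, e⟩ rfl⟩,
    ⟨fun e => hin ⟨_, _, e⟩ rfl⟩, ⟨fun e => hout ⟨_, _, e⟩ rfl⟩⟩
  · simpa using hW.symm.subset (Set.mem_univ c)
  · refine Nat.card_eq_two_iff.2 ⟨α, α', fun h => hne (by rw [h]), Set.eq_univ_of_forall fun e => ?_⟩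
    simpa using hsrc ⟨a, b, e⟩ rfl

/-- The combinatorial datum of a gentle quiver with relations. -/
def datum (hP : IsGentle P) (hconn : QuiverConnected V) (hK : ¬ IsKroneckerQuiver V)
    [Finite (QArrow V)] : GentleDatum V (QArrow V) where
  src α := α.1
  tgt α := α.2.1
  ok := ArrowsOk P
  tgt_eq_src h := by
    cases h
    rfl
  ok_right_unique := hP.arrowsOk_right_unique
  ok_left_unique := hP.arrowsOk_left_unique
  rel_right_unique := hP.rel_right_unique
  rel_left_unique := hP.rel_left_unique
  bounded := hP.exists_length_le
  out_le_two := hP.out_le_two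
  in_le_two := hP.in_le_two
  connected _ := hconn.eq_univ
  parallel_free := hP.eq_of_parallel hconn hK

end IsGentle

/-! ## The basis of paths of a gentle algebra -/

namespace PathAlgebra

variable {k : Type w} [Field k] {V : Type u} [Quiver.{v} V]

theorem of_comp {a b c : V} (p : Path a b) (q : Path b c) :
    of k ⟨b, c, q⟩ * of k ⟨a, b, p⟩ = of k ⟨a, c, p.comp q⟩ := by
  rw [mul_eq, mulMap_of_of, pathMul_comp]

theorem of_mul_of_ne {q p : QPath V} (h : p.2.1 ≠ q.1) : of k q * of k p = 0 := by
  rw [mul_eq, mulMap_of_of, pathMul_ne h]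

variable [Fintype V]

/-- Linear maps that vanish on the multiples of an element by paths vanish on all multiples. -/
theorem map_mul_mul_eq_zero {M : Type*} [AddCommGroup M] [Module k M] (f : PathAlgebra k V →ₗ[k] M)
    {x : PathAlgebra k V} (h : ∀ q r, f (of k q * x * of k r) = 0) (y z : PathAlgebra k V) :
    f (y * x * z) = 0 := by
  have h1 : ∀ q z, f (of k q * x * z) = 0 := fun q z =>
    LinearMap.congr_fun (hom_ext (f := f ∘ₗ LinearMap.mulLeft k (of k q * x)) (g := 0)
      fun r => h q r) z
  have := LinearMap.congr_fun (hom_ext (f := f ∘ₗ LinearMap.mulRight k (x * z)) (g := 0)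
    fun q => by simpa [mul_assoc] using h1 q z) y
  simpa [mul_assoc] using this

end PathAlgebra

namespace QuiverAlgebra

open PathAlgebra

variable {k : Type w} [Field k] {V : Type u} [Quiver.{v} V] [Fintype V] {P : Set (QPath V)}

theorem of_mem_relIdeal {a b : V} {p : Path a b} (h : HasSubpathIn P p) :
    of k ⟨a, b, p⟩ ∈ relIdeal k P := by
  obtain ⟨c, d, x, y, z, rfl, hy⟩ := h
  rw [← of_comp, ← of_comp]
  exact TwoSidedIdeal.mul_mem_left _ _ _ (TwoSidedIdeal.mul_mem_right _ _ _
    (TwoSidedIdeal.subset_span ⟨_, hy, rfl⟩))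

variable (k P) in
/-- The class of a path in the quotient of the path algebra. -/
def pathClass (p : QPath V) : QuiverAlgebra k P := (relIdeal k P).ringCon.mkₐ k (of k p)

theorem mk_eq_zero_iff {x : PathAlgebra k V} :
    (relIdeal k P).ringCon.mkₐ k x = 0 ↔ x ∈ relIdeal k P := by
  rw [TwoSidedIdeal.mem_iff, ← RingCon.eq]
  rfl

theorem pathClass_mul_of_comp {a b c : V} (p : Path a b) (q : Path b c) :
    pathClass k P ⟨b, c, q⟩ * pathClass k P ⟨a, b, p⟩ = pathClass k P ⟨a, c, p.comp q⟩ := by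
  rw [pathClass, pathClass, ← map_mul, of_comp]
  rfl

theorem pathClass_mul_of_ne {q p : QPath V} (h : p.2.1 ≠ q.1) :
    pathClass k P q * pathClass k P p = 0 := by
  rw [pathClass, pathClass, ← map_mul, of_mul_of_ne h, map_zero]

theorem pathClass_eq_zero (hP : ∀ p ∈ P, p.2.2.length = 2) {p : QPath V}
    (h : ¬ (pathWord p.2.2).IsChain (ArrowsOk P)) : pathClass k P p = 0 :=
  mk_eq_zero_iff.2 (of_mem_relIdeal ((hasSubpathIn_iff hP p.2.2).2 h))

theorem pathClass_mul_of_not_isChain (hP : ∀ p ∈ P, p.2.2.length = 2) {q p : QPath V}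
    (h : ¬ (pathWord q.2.2 ++ pathWord p.2.2).IsChain (ArrowsOk P)) :
    pathClass k P q * pathClass k P p = 0 := by
  obtain ⟨a, b, p⟩ := p
  obtain ⟨b', c, q⟩ := q
  by_cases hb : b = b'
  · subst hb
    rw [pathClass_mul_of_comp]
    exact pathClass_eq_zero hP (by simpa using h)
  · exact pathClass_mul_of_ne hb

theorem nil_mul_pathClass (q : QPath V) :
    pathClass k P ⟨q.2.1, q.2.1, Path.nil⟩ * pathClass k P q = pathClass k P q := by
  obtain ⟨a, b, q⟩ := q
  rw [pathClass_mul_of_comp, Path.comp_nil]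

theorem pathClass_mul_nil (q : QPath V) :
    pathClass k P q * pathClass k P ⟨q.1, q.1, Path.nil⟩ = pathClass k P q := by
  obtain ⟨a, b, q⟩ := q
  rw [pathClass_mul_of_comp, Path.nil_comp]

end QuiverAlgebra

/-! ### Reduction of the path algebra to nonzero paths -/

namespace IsGentle

open PathAlgebra QuiverAlgebra

variable {V : Type u} [Quiver.{v} V] [Finite (QArrow V)]
  {P : Set (QPath V)} (hP : IsGentle P) (hconn : QuiverConnected V) (hK : ¬ IsKroneckerQuiver V)

/-- The path of a vertex or of a good word. -/
def basisPath : V ⊕ {l // (hP.datum hconn hK).Good l} → QPath V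
  | Sum.inl a => ⟨a, a, Path.nil⟩
  | Sum.inr l => (exists_pathWord_eq l.2.1 l.2.2).choose

theorem pathWord_basisPath (l : {l // (hP.datum hconn hK).Good l}) :
    pathWord (hP.basisPath hconn hK (Sum.inr l)).2.2 = l.1 :=
  (exists_pathWord_eq l.2.1 l.2.2).choose_spec

theorem startsAt_pathWord {q : QPath V} (h0 : pathWord q.2.2 ≠ []) {a : V} :
    (hP.datum hconn hK).StartsAt (pathWord q.2.2) a ↔ a = q.1 := by
  obtain ⟨α, hα⟩ := Option.ne_none_iff_exists'.1 fun h => h0 (List.getLast?_eq_none_iff.1 h)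
  have h1 : α.1 = q.1 := getLast?_pathWord q.2.2 α hα
  rw [GentleDatum.StartsAt, hα]
  constructor
  · intro h
    exact (h α rfl).symm.trans h1
  · rintro rfl β hβ
    cases hβ
    exact h1

theorem endsAt_pathWord {q : QPath V} (h0 : pathWord q.2.2 ≠ []) {a : V} :
    (hP.datum hconn hK).EndsAt (pathWord q.2.2) a ↔ q.2.1 = a := by
  obtain ⟨α, hα⟩ := Option.ne_none_iff_exists'.1 fun h => h0 (List.head?_eq_none_iff.1 h)
  have h1 : α.2.1 = q.2.1 := head?_pathWord q.2.2 α hα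
  rw [GentleDatum.EndsAt, hα]
  constructor
  · intro h
    exact h1.symm.trans (h α rfl)
  · rintro rfl β hβ
    cases hβ
    exact h1

variable {k : Type w} [Field k] [Fintype V]

open Classical in
/-- The linear map from the path algebra that sends the nonzero paths to the basis vectors and the
other paths to zero. -/
def reduction : PathAlgebra k V →ₗ[k] (V ⊕ {l // (hP.datum hconn hK).Good l}) →₀ k :=
  Finsupp.linearCombination k fun p =>
    if h : (hP.datum hconn hK).Good (pathWord p.2.2) then
      Finsupp.single (Sum.inr ⟨_, h⟩) 1
    else if pathWord p.2.2 = [] then Finsupp.single (Sum.inl p.1) 1 else 0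

open Classical in
theorem reduction_of (p : QPath V) : hP.reduction (k := k) hconn hK (of k p) =
    if h : (hP.datum hconn hK).Good (pathWord p.2.2) then
      Finsupp.single (Sum.inr ⟨_, h⟩) 1
    else if pathWord p.2.2 = [] then Finsupp.single (Sum.inl p.1) 1 else 0 := by
  unfold reduction of
  erw [Finsupp.linearCombination_single, one_smul]

theorem reduction_of_hasSubpathIn {a b : V} {p : Path a b} (h : HasSubpathIn P p) :
    hP.reduction (k := k) hconn hK (of k ⟨a, b, p⟩) = 0 := by
  rw [hasSubpathIn_iff hP.length_two] at h
  rw [reduction_of, dif_neg fun h' => h h'.2, if_neg]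
  intro h'
  exact h (by dsimp only at h'; simp [h'])

theorem reduction_basisPath (i : V ⊕ {l // (hP.datum hconn hK).Good l}) :
    hP.reduction (k := k) hconn hK (of k (hP.basisPath hconn hK i)) = Finsupp.single i 1 := by
  rw [reduction_of]
  obtain a | l := i
  · exact (dif_neg fun h => h.1 rfl).trans (if_pos rfl)
  · have h := hP.pathWord_basisPath hconn hK l
    rw [dif_pos (h ▸ l.2)]
    congr 2
    exact Subtype.ext h

/-- The ideal is generated additively by multiples of relations. By linearity the multipliers may be
taken to be paths, and the product is then zero or a path containing a relation. -/
theorem reduction_of_mem_relIdeal {x : PathAlgebra k V} (hx : x ∈ relIdeal k P) :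
    hP.reduction (k := k) hconn hK x = 0 := by
  rw [relIdeal, TwoSidedIdeal.mem_span_iff_mem_addSubgroup_closure] at hx
  induction hx using AddSubgroup.closure_induction with
  | mem x hx =>
    obtain ⟨_, ⟨y, -, _, ⟨p, hp, rfl⟩, rfl⟩, z, -, rfl⟩ := hx
    refine map_mul_mul_eq_zero _ (fun q r => ?_) y z
    obtain ⟨a, b, p⟩ := p
    obtain ⟨b', c, q⟩ := q
    obtain ⟨d, a', r⟩ := r
    by_cases h1 : b = b'
    · subst h1
      rw [of_comp]
      by_cases h2 : a' = a
      · subst h2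
        rw [of_comp, ← Path.comp_assoc]
        exact hP.reduction_of_hasSubpathIn hconn hK ⟨_, _, r, p, q, rfl, hp⟩
      · rw [of_mul_of_ne h2, map_zero]
    · rw [of_mul_of_ne (q := ⟨b', c, q⟩) (p := ⟨a, b, p⟩) h1, zero_mul, map_zero]
  | zero => exact map_zero _
  | add x y _ _ hx hy => rw [map_add, hx, hy, add_zero]
  | neg x _ hx => rw [map_neg, hx, neg_zero]

theorem pathClass_eq_basisPath {p : QPath V} (h : (hP.datum hconn hK).Good (pathWord p.2.2)) :
    pathClass k P p = pathClass k P (hP.basisPath hconn hK (Sum.inr ⟨_, h⟩)) := by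
  congr 1
  exact pathWord_injective_of_ne_nil h.1 (hP.pathWord_basisPath hconn hK ⟨_, h⟩).symm

/-- The reduction kills the ideal and sends the representatives of the proposed basis to distinct
unit vectors. -/
theorem linearIndependent_pathClass :
    LinearIndependent k fun i => pathClass k P (hP.basisPath hconn hK i) := by
  rw [linearIndependent_iff]
  intro c hc
  have h : (relIdeal k P).ringCon.mkₐ k
      (Finsupp.linearCombination k (fun i => of k (hP.basisPath hconn hK i)) c) = 0 := by
    rw [← hc]
    exact Finsupp.apply_linearCombination k ((relIdeal k P).ringCon.mkₐ k).toLinearMap _ c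
  have := hP.reduction_of_mem_relIdeal hconn hK (mk_eq_zero_iff.1 h)
  rw [Finsupp.apply_linearCombination] at this
  have h2 : (hP.reduction (k := k) hconn hK ∘ fun i => of k (hP.basisPath hconn hK i)) =
      fun i => Finsupp.single i 1 := funext (hP.reduction_basisPath hconn hK)
  rw [h2] at this
  simpa [Finsupp.linearCombination_apply] using this

/-- A path is trivial, or its word is good and it equals the chosen representative, or it contains a
relation and vanishes in the quotient. -/
theorem top_le_span_pathClass :
    ⊤ ≤ Submodule.span k (Set.range fun i => pathClass k P (hP.basisPath hconn hK i)) := by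
  rintro x -
  obtain ⟨x, rfl⟩ := RingCon.mkₐ_surjective (α := k) _ x
  have h : Submodule.mkQ (Submodule.span k
      (Set.range fun i => pathClass k P (hP.basisPath hconn hK i))) ∘ₗ
      ((relIdeal k P).ringCon.mkₐ k).toLinearMap = 0 := by
    refine hom_ext fun p => ?_
    refine (Submodule.Quotient.mk_eq_zero _).2 ?_
    change pathClass k P p ∈ _
    by_cases hp : pathWord p.2.2 = []
    · refine Submodule.subset_span ⟨Sum.inl p.1, ?_⟩
      rw [show p = ⟨p.1, p.1, Path.nil⟩ from pathWord_eq_nil hp]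
      rfl
    by_cases hg : (pathWord p.2.2).IsChain (ArrowsOk P)
    · rw [hP.pathClass_eq_basisPath hconn hK (p := p) ⟨hp, hg⟩]
      exact Submodule.subset_span ⟨_, rfl⟩
    · rw [pathClass_eq_zero hP.length_two hg]
      exact zero_mem _
  exact (Submodule.Quotient.mk_eq_zero _).1 (LinearMap.congr_fun h x)

theorem pathClass_mul_of_good {q p : QPath V}
    (hq : pathWord q.2.2 ≠ []) (hp : pathWord p.2.2 ≠ [])
    (h : (hP.datum hconn hK).Good (pathWord q.2.2 ++ pathWord p.2.2)) :
    pathClass k P q * pathClass k P p = pathClass k P (hP.basisPath hconn hK (Sum.inr ⟨_, h⟩)) := by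
  have hpq : p.2.1 = q.1 := by
    obtain ⟨α, hα⟩ := Option.ne_none_iff_exists'.1 fun h => hq (List.getLast?_eq_none_iff.1 h)
    obtain ⟨β, hβ⟩ := Option.ne_none_iff_exists'.1 fun h => hp (List.head?_eq_none_iff.1 h)
    have hok := (List.isChain_append.1 h.2).2.2 α hα β hβ
    rw [← head?_pathWord p.2.2 β hβ, ← getLast?_pathWord q.2.2 α hα]
    exact (hP.datum hconn hK).tgt_eq_src hok
  obtain ⟨a, b, p⟩ := p
  obtain ⟨b', c, q⟩ := q
  dsimp only at hpq
  subst hpq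
  rw [pathClass_mul_of_comp]
  congr 1
  refine pathWord_injective_of_ne_nil ?_ ?_
  · simp only [pathWord_comp]
    exact h.1
  · rw [hP.pathWord_basisPath, pathWord_comp]

variable (k) in
/-- The basis of a gentle algebra that consists of the nonzero paths. -/
def pathBasis : PathBasis (hP.datum hconn hK) k (QuiverAlgebra k P) := by
  have hb : ∀ i, Module.Basis.mk (hP.linearIndependent_pathClass (k := k) hconn hK)
      (hP.top_le_span_pathClass hconn hK) i = pathClass k P (hP.basisPath hconn hK i) := fun i =>
    Module.Basis.mk_apply _ _ i
  have hw := hP.pathWord_basisPath hconn hK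
  have hne : ∀ l, pathWord (hP.basisPath hconn hK (Sum.inr l)).2.2 ≠ [] := fun l => by
    rw [hw]
    exact l.2.1
  refine
    { basis := Module.Basis.mk (hP.linearIndependent_pathClass (k := k) hconn hK)
        (hP.top_le_span_pathClass hconn hK)
      sum_vertices := ?_
      vertex_mul_self := fun a => ?_
      vertex_mul_of_ne := fun a b h => ?_
      word_mul_word_of_good := fun l m h => ?_
      word_mul_word_of_not_good := fun l m h => ?_
      vertex_mul_word := fun a l h => ?_
      vertex_mul_word_of_not := fun a l h => ?_
      word_mul_vertex := fun a l h => ?_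
      word_mul_vertex_of_not := fun a l h => ?_ } <;> simp only [hb]
  · rw [← map_one ((relIdeal k P).ringCon.mkₐ k), one_eq, map_sum]
    rfl
  · exact nil_mul_pathClass ⟨a, a, Path.nil⟩
  · exact pathClass_mul_of_ne h.symm
  · simp only [← hw] at h
    rw [hP.pathClass_mul_of_good hconn hK (hne l) (hne m) h]
    congr 3
    exact Subtype.ext (congrArg₂ _ (hw l) (hw m))
  · refine pathClass_mul_of_not_isChain hP.length_two fun h' => h ?_
    rw [hw, hw] at h'
    exact ⟨List.append_ne_nil_of_left_ne_nil l.2.1 _, h'⟩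
  · rw [← hw, hP.endsAt_pathWord hconn hK (hne l)] at h
    subst h
    exact nil_mul_pathClass _
  · rw [← hw, hP.endsAt_pathWord hconn hK (hne l)] at h
    exact pathClass_mul_of_ne h
  · rw [← hw, hP.startsAt_pathWord hconn hK (hne l)] at h
    subst h
    exact pathClass_mul_nil _
  · rw [← hw, hP.startsAt_pathWord hconn hK (hne l)] at h
    exact pathClass_mul_of_ne h

end IsGentle

end

theorem mainTheorem5 {k : Type w} [Field k] [IsAlgClosed k]
    {V : Type u} [Fintype V] [Quiver.{v} V] [∀ a b : V, Finite (a ⟶ b)]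
    (P : Set (QPath V)) (hP : IsGentle P) (hconn : QuiverConnected V)
    (hK : ¬ IsKroneckerQuiver V) :
    -- `Out°(A)` is isomorphic to an algebraic group of lower triangular invertible matrices
    (∃ (n : ℕ) (G : Subgroup (GL (Fin n) k)) (e : OutNeutral k (QuiverAlgebra k P) ≃* G),
      IsClosed[zariskiTopology (glRegular k n)] (G : Set (GL (Fin n) k)) ∧
      (∀ g ∈ G, ∀ i j : Fin n, i < j → (g : Matrix (Fin n) (Fin n) k) i j = 0) ∧
      IsRegularIso (outNeutralRegular k (QuiverAlgebra k P))
        (restrictRegular (glRegular k n) G) e) ∧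
    -- and is the semidirect product of a maximal torus `S ≅ (kˣ) ^ c(Q)` and a closed nilpotent
    -- normal subgroup `U`
    (∃ S U : Subgroup (OutNeutral k (QuiverAlgebra k P)),
      IsMaximalTorusOfRank (outNeutralRegular k (QuiverAlgebra k P)) S (cycleNumber V) ∧
      U.Normal ∧
      IsClosed[zariskiTopology (outNeutralRegular k (QuiverAlgebra k P))]
        (U : Set (OutNeutral k (QuiverAlgebra k P))) ∧
      Group.IsNilpotent U ∧
      S.IsComplement' U) := by
  have : Finite (QArrow V) := inferInstance
  have := Fintype.ofFinite (QArrow V)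
  have : Nonempty V := hconn.1
  obtain ⟨m, χ, e, hχ, hχ', he⟩ := (hP.pathBasis hconn hK k).exists_outNeutral_equiv
  have hrank : Fintype.card (QArrow V) + 1 - Fintype.card V = cycleNumber V := by
    rw [cycleNumber, Nat.card_eq_fintype_card, Nat.card_eq_fintype_card]
  refine ⟨?_, TorusVector.torusSubgroup e, TorusVector.vectorSubgroup e, ?_,
    TorusVector.vectorSubgroup_normal e, TorusVector.isClosed_vectorSubgroup e he,
    TorusVector.isNilpotent_vectorSubgroup e,
    TorusVector.isComplement'_torusSubgroup_vectorSubgroup e⟩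
  · obtain ⟨n, G, e', hG, hlow, he'⟩ := TorusVector.exists_lowerTriangular_embedding hχ
    exact ⟨n, G, e.trans e', hG, hlow, he.trans he'⟩
  · rw [← hrank]
    exact TorusVector.isMaximalTorusOfRank_torusSubgroup e he hχ'
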